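/- **Setting.** Let $\Lambda\subset\mathbb R^2$ be a lattice and let $\Omega=\Omega_1\cup\Omega_2$ be a fundamental (e.g. Wigner–Seitz) cell of $\Lambda$, split into two disjoint measurable sets, with $|\Omega_2|>0$. Let $k\in\mathbb R^2$ be a fixed wave vector, $\alpha_1,\alpha_2>0$, $L\ge 0$, and $\xi_\ell,\eta_\ell\in\mathbb R$ with $\xi_\ell\neq 0$ for $\ell=1,\dots,L$; the permittivity is $\alpha_1$ on $\Omega_1$ and $\varepsilon_2(\omega)=\alpha_2+\sum_{\ell=1}^L\frac{\xi_\ell^2}{\eta_\ell^2-\omega^2}$ on $\Omega_2$. Put $\Xi=\sum_\ell\xi_\ell^2$, $\mathbf b=(\xi_\ell\eta_\ell)_\ell\in\mathbb R^L$, $\mathbf A=\mathrm{diag}(\eta_\ell^2)$. Let $H=L^2(\Omega;\mathbb C)$, $V=H^1_{\rm per}(\Omega)$ (functions in $L^2(\Omega)$ with a weak gradient in $L^2(\Omega)^2$ with respect to all smooth $\Lambda$-periodic test functions), $X=\{v\in H: v=0 \text{ a.e. on }\Omega_1\}$ and $\mathcal V=V\times X^L$. Write $(u,v)_{\Omega_i}=\int_{\Omega_i}u\bar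 v\,dx$, $(u,v)_\alpha=\alpha_1(u,v)_{\Omega_1}+\alpha_2(u,v)_{\Omega_2}$ and $a_k(u,v)=\int_\Omega(\nabla+ik)u\cdot\overline{(\nabla+ik)v}\,dx$. A pair $(u,\lambda)\in V\times\mathbb R$ with $u\ne0$ is an eigenpair of the nonlinear problem, and $u$ an eigenfunction, if $\mathbf A-\lambda\mathbf I$ is invertible and for all $v\in V$ $$a_k(u,v)+\Xi\,(u,v)_{\Omega_2}=\lambda\,(u,v)_\alpha+\mathbf b^*(\mathbf A-\lambda\mathbf I)^{-1}\mathbf b\,(u,v)_{\Omega_2}.$$ For $z=[u;x]$ and $w=[v;y]$ in $\mathcal V$ let $$\mathfrak a(z,w)=a_k(u,v)+\Xi(u,v)_{\Omega_2}-\sum_\ell\xi_\ell\eta_\ell\big((x_\ell,v)_{\Omega_2}+(u,y_\ell)_{\Omega_2}\big)+\sum_\ell\eta_\ell^2(x_\ell,y_\ell)_{\Omega_2},$$ $$\mathfrak i(z,w)=(u,v)_\alpha+\sum_\ell(x_\ell,y_\ell)_{\Omega_2},\qquad \mathfrak a_\beta=\mathfrak a+\beta\,\mathfrak i .$$ For a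 shift $\beta>0$ and $z^0\in\mathcal V$, the inverse power iteration for the shifted linearised problem is $$\mathfrak a_\beta(z^j,w)=\mu^{j-1}\,\mathfrak i\Big(\frac{z^{j-1}}{\sqrt{\mathfrak i(z^{j-1},z^{j-1})}},w\Big)\quad\text{for all }w\in\mathcal V,\ j\ge1,\qquad \mu^j=\frac{\mathfrak a_\beta(z^j,z^j)}{\mathfrak i(z^j,z^j)}.$$ **Theorem.** Let $\beta>0$, $u^0\in V$, $x^0\in X^L$ and $z^0=[u^0;x^0]\neq0$. Assume that $x^0_\ell=0$ whenever $\eta_\ell=0$, and that $\xi_m\eta_m\,x^0_\ell=\xi_\ell\eta_\ell\,x^0_m$ whenever $\eta_\ell^2=\eta_m^2$ (so $x^0\in X^L$ is arbitrary if the $\eta_\ell^2$ are non-zero and pairwise distinct). Then the inverse power iteration started at $z^0$ determines a unique sequence $z^j=[u^j;x^j]$ in $\mathcal V$, and a subsequence of $(u^j)$ converges in $H=L^2(\Omega)$ to some $u^\star\in V$ that is an eigenfunction of the nonlinear problem. -/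

import Mathlib

open MeasureTheory Filter Topology
open scoped ContDiff ComplexConjugate

noncomputable section

/-- The plane `ℝ²` with its Euclidean norm. -/
abbrev Plane : Type := EuclideanSpace ℝ (Fin 2)

/-- The data of the two-dimensional TM problem with a lossless simplified Drude-Lorentz
permittivity: a lattice (given by a basis of periods), a periodicity cell decomposed into the
regions `Ω₁`, `Ω₂` filled by the two materials, the wave vector `k`, the constant permittivity
`α₁` of the first material and the parameters `α₂`, `ξ`, `η` of the permittivity
`α₂ + ∑ ℓ, ξ ℓ ^ 2 / (η ℓ ^ 2 - ω ^ 2)` of the second material. -/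
structure TMCrystal (L : ℕ) where
  /-- basis of the lattice of periods -/
  period : Module.Basis (Fin 2) ℝ Plane
  /-- region of the first material within the cell -/
  Ω₁ : Set Plane
  /-- region of the second material within the cell -/
  Ω₂ : Set Plane
  measurable₁ : MeasurableSet Ω₁
  measurable₂ : MeasurableSet Ω₂
  disjoint : Disjoint Ω₁ Ω₂
  /-- The union of both regions is a fundamental cell of the lattice, for instance its
  Wigner-Seitz cell. Null sets, such as a material interface, do not matter. -/
  cell : IsAddFundamentalDomain (Submodule.span ℤ (Set.range period)) (Ω₁ ∪ Ω₂) volume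
  /-- wave vector -/
  k : Plane
  α₁ : ℝ
  α₂ : ℝ
  α₁_pos : 0 < α₁
  α₂_pos : 0 < α₂
  ξ : Fin L → ℝ
  η : Fin L → ℝ

namespace TMCrystal

variable {L : ℕ} (P : TMCrystal L)

/-- The cell `Ω = Ω₁ ∪ Ω₂`. -/
def Ω : Set Plane := P.Ω₁ ∪ P.Ω₂

/-- The pivot space `H = L²(Ω)` of complex-valued functions. -/
abbrev H : Type := Lp ℂ 2 (volume.restrict P.Ω)

/-- Smooth functions on the plane that are periodic with respect to the lattice. -/
structure IsPeriodicTest (φ : Plane → ℂ) : Prop where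
  smooth : ContDiff ℝ ∞ φ
  periodic : ∀ (i : Fin 2) (x : Plane), φ (x + P.period i) = φ x

/-- The partial derivative `∂φ/∂x_j`. -/
def partialDeriv (j : Fin 2) (φ : Plane → ℂ) (x : Plane) : ℂ :=
  fderiv ℝ φ x (EuclideanSpace.single j 1)

/-- `g` is the weak gradient of the (periodic) function `u`: integration by parts holds against
all smooth periodic functions, without boundary terms. -/
def IsWeakGradient (u : P.H) (g : Fin 2 → P.H) : Prop :=
  ∀ φ : Plane → ℂ, P.IsPeriodicTest φ → ∀ j : Fin 2,
    ∫ x in P.Ω, u x * partialDeriv j φ x = -∫ x in P.Ω, g j x * φ x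

lemma volume_Ω_lt_top : volume P.Ω < ⊤ := by
  have : VAddInvariantMeasure (Submodule.span ℤ (Set.range P.period)) Plane volume :=
    (inferInstance : VAddInvariantMeasure
      (Submodule.span ℤ (Set.range P.period)).toAddSubgroup Plane volume)
  have h := P.cell.measure_eq (ZSpan.isAddFundamentalDomain P.period volume)
  have h2 : volume (ZSpan.fundamentalDomain P.period) < ⊤ :=
    (ZSpan.fundamentalDomain_isBounded P.period).measure_lt_top
  unfold Ω
  rw [h]
  exact h2

instance : IsFiniteMeasure (volume.restrict P.Ω) :=
  ⟨by simpa using P.volume_Ω_lt_top⟩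

lemma exists_bound_of_periodic {f : Plane → ℂ} (hf : Continuous f)
    (hper : ∀ (i : Fin 2) (x : Plane), f (x + P.period i) = f x) : ∃ C, ∀ x, ‖f x‖ ≤ C := by
  have hlat : ∀ v ∈ Submodule.span ℤ (Set.range P.period), ∀ x, f (x + v) = f x := by
    intro v hv
    induction hv using Submodule.span_induction with
    | mem v hv => obtain ⟨i, rfl⟩ := hv; exact hper i
    | zero => simp
    | add v w _ _ h1 h2 => intro x; rw [← add_assoc, h2, h1]
    | smul n v _ h =>
      intro x
      exact (Function.Periodic.zsmul (show Function.Periodic f v from h) n) x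
  have hK : IsCompact (closure (ZSpan.fundamentalDomain P.period)) :=
    (ZSpan.fundamentalDomain_isBounded P.period).isCompact_closure
  obtain ⟨C, hC⟩ := hK.exists_bound_of_continuousOn hf.continuousOn
  refine ⟨C, fun x => ?_⟩
  have h1 : f (ZSpan.fract P.period x) = f x := by
    rw [ZSpan.fract_apply, sub_eq_add_neg]
    exact hlat _ (neg_mem (ZSpan.floor P.period x).2) x
  rw [← h1]
  exact hC _ (subset_closure (ZSpan.fract_mem_fundamentalDomain P.period x))

lemma integrable_mul_of_periodic (u : P.H) {f : Plane → ℂ} (hf : Continuous f)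
    (hper : ∀ (i : Fin 2) (x : Plane), f (x + P.period i) = f x) :
    Integrable (fun x => u x * f x) (volume.restrict P.Ω) := by
  obtain ⟨C, hC⟩ := P.exists_bound_of_periodic hf hper
  have hu : Integrable (fun x => u x) (volume.restrict P.Ω) :=
    (Lp.memLp u).integrable (by norm_num)
  exact hu.mul_bdd hf.aestronglyMeasurable (Eventually.of_forall hC)

variable {P} in
lemma IsPeriodicTest.continuous_partialDeriv {φ : Plane → ℂ} (h : P.IsPeriodicTest φ)
    (j : Fin 2) : Continuous (partialDeriv j φ) :=
  (h.smooth.continuous_fderiv (by simp)).clm_apply continuous_const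

variable {P} in
lemma IsPeriodicTest.periodic_partialDeriv {φ : Plane → ℂ} (h : P.IsPeriodicTest φ)
    (j i : Fin 2) (x : Plane) :
    partialDeriv j φ (x + P.period i) = partialDeriv j φ x := by
  have h1 : (fun y => φ (y + P.period i)) = φ := funext (h.periodic i)
  unfold partialDeriv
  conv_rhs => rw [← h1]
  rw [fderiv_comp_add_right]

/-- The space `V = H¹_per(Ω)`: the elements are the functions `u ∈ L²(Ω)` that have a weak
gradient in `L²(Ω)` in the periodic sense, stored together with this (unique) gradient. -/
def V : Submodule ℂ (P.H × (Fin 2 → P.H)) where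
  carrier := {p | P.IsWeakGradient p.1 p.2}
  zero_mem' := by
    intro φ _ j
    have h0 : ∀ᵐ x ∂(volume.restrict P.Ω), (0 : P.H) x = 0 := by
      filter_upwards [Lp.coeFn_zero ℂ 2 (volume.restrict P.Ω)] with x hx using hx
    have h1 : ∀ f : Plane → ℂ, ∫ x in P.Ω, (0 : P.H) x * f x = 0 := fun f =>
      integral_eq_zero_of_ae (by filter_upwards [h0] with x hx; rw [hx, zero_mul]; rfl)
    change ∫ x in P.Ω, (0 : P.H) x * partialDeriv j φ x = -∫ x in P.Ω, (0 : P.H) x * φ x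
    rw [h1, h1, neg_zero]
  add_mem' := by
    rintro ⟨u, g⟩ ⟨u', g'⟩ h h' φ hφ j
    have key : ∀ (a b : P.H) (f : Plane → ℂ), Continuous f →
        (∀ (i : Fin 2) (x : Plane), f (x + P.period i) = f x) →
        ∫ x in P.Ω, (a + b : P.H) x * f x =
          (∫ x in P.Ω, a x * f x) + ∫ x in P.Ω, b x * f x := by
      intro a b f hf hp
      rw [← integral_add (P.integrable_mul_of_periodic a hf hp)
        (P.integrable_mul_of_periodic b hf hp)]
      refine integral_congr_ae ?_
      filter_upwards [Lp.coeFn_add a b] with x hx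
      rw [hx, Pi.add_apply, add_mul]
    have e1 := key u u' _ (hφ.continuous_partialDeriv j) (hφ.periodic_partialDeriv j)
    have e2 := key (g j) (g' j) φ hφ.smooth.continuous hφ.periodic
    have i1 := h φ hφ j
    have i2 := h' φ hφ j
    simp only [Prod.mk_add_mk, Pi.add_apply] at *
    rw [e1, e2, i1, i2]
    ring
  smul_mem' := by
    rintro c ⟨u, g⟩ h φ hφ j
    have key : ∀ (a : P.H) (f : Plane → ℂ),
        ∫ x in P.Ω, (c • a : P.H) x * f x = c * ∫ x in P.Ω, a x * f x := by
      intro a f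
      rw [← integral_const_mul]
      refine integral_congr_ae ?_
      filter_upwards [Lp.coeFn_smul c a] with x hx
      rw [hx, Pi.smul_apply, smul_eq_mul, mul_assoc]
    have i1 := h φ hφ j
    simp only [Prod.smul_mk, Pi.smul_apply] at *
    rw [key, key, i1]
    ring

variable {P} in
/-- The function `u ∈ L²(Ω)` underlying an element of `V`. -/
def fn (u : P.V) : P.H := u.1.1

variable {P} in
/-- The weak partial derivatives of an element of `V`. -/
def grad (u : P.V) (j : Fin 2) : P.H := u.1.2 j

/-- The space `X` of all `v ∈ L²(Ω)` that vanish on `Ω₁`. -/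
def X : Submodule ℂ P.H where
  carrier := {v | ∀ᵐ x ∂(volume.restrict P.Ω₁), v x = 0}
  zero_mem' :=
    ae_mono (Measure.restrict_mono Set.subset_union_left le_rfl)
      (Lp.coeFn_zero ℂ 2 (volume.restrict P.Ω))
  add_mem' := by
    intro a b ha hb
    have h := ae_mono (Measure.restrict_mono Set.subset_union_left le_rfl) (Lp.coeFn_add a b)
    filter_upwards [ha, hb, h] with x h1 h2 h3
    rw [h3, Pi.add_apply, h1, h2, add_zero]
  smul_mem' := by
    intro c a ha
    have h := ae_mono (Measure.restrict_mono Set.subset_union_left le_rfl) (Lp.coeFn_smul c a)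
    filter_upwards [ha, h] with x h1 h2
    rw [h2, Pi.smul_apply, h1, smul_zero]

/-- The space on which the linearised problem is posed: pairs `[u; x]` with `u ∈ V`
and `x = [x_1; …; x_L] ∈ X^L`. -/
abbrev Ext : Type := P.V × (Fin L → P.X)

/-- `∫_{Ω₁} u v̄`, the form of `I₁`. -/
def form₁ (u v : P.H) : ℂ := ∫ x in P.Ω₁, u x * conj (v x)

/-- `∫_{Ω₂} u v̄`. On `V × V` this is the form of `I₂`, on `X × X` it is the inner product of `X`,
and on `X × V` it is the form of the embedding of `X` into the dual of `V`. -/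
def form₂ (u v : P.H) : ℂ := ∫ x in P.Ω₂, u x * conj (v x)

/-- The form `α₁ ∫_{Ω₁} u v̄ + α₂ ∫_{Ω₂} u v̄` of the weighted embedding. -/
def formα (u v : P.H) : ℂ := P.α₁ * P.form₁ u v + P.α₂ * P.form₂ u v

/-- The shifted gradient `∇u + i k u`. -/
def shiftedGrad (u : P.V) (j : Fin 2) (x : Plane) : ℂ :=
  grad u j x + Complex.I * (P.k j : ℂ) * fn u x

/-- The form `∫_Ω (∇ + i k) u · conj ((∇ + i k) v)` of the shifted Laplacian. -/
def formLaplace (u v : P.V) : ℂ :=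
  ∫ x in P.Ω, ∑ j : Fin 2, P.shiftedGrad u j x * conj (P.shiftedGrad v j x)

/-- `Ξ = ∑ ℓ, ξ_ℓ²`. -/
def Xi : ℝ := ∑ ℓ, P.ξ ℓ ^ 2

/-- The vector `b = (ξ_ℓ η_ℓ)_ℓ` of the realization. -/
def b (ℓ : Fin L) : ℝ := P.ξ ℓ * P.η ℓ

/-- The matrix `A = diag(η_ℓ²)` of the realization. -/
def A : Matrix (Fin L) (Fin L) ℝ := Matrix.diagonal fun ℓ => P.η ℓ ^ 2

/-- `(u, lam)` is an eigenpair of the nonlinear problem: `u ∈ V` is non-zero, `lam` is real and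
not a pole (so that `A - lam I` is invertible), and
`A_k u + Ξ I₂ u = lam I_α u + b^* (A - lam I)⁻¹ b I₂ u` in the dual space of `V`. -/
def IsNonlinearEigenpair (u : P.V) (lam : ℝ) : Prop :=
  fn u ≠ 0 ∧ IsUnit (P.A - lam • (1 : Matrix (Fin L) (Fin L) ℝ)) ∧
    ∀ v : P.V,
      P.formLaplace u v + P.Xi * P.form₂ (fn u) (fn v) =
        lam * P.formα (fn u) (fn v) +
          ((P.b ⬝ᵥ (P.A - lam • (1 : Matrix (Fin L) (Fin L) ℝ))⁻¹.mulVec P.b : ℝ) : ℂ) *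
            P.form₂ (fn u) (fn v)

/-- The form of the left-hand side operator of the linearised problem
`[[A_k + Ξ I₂, -b^*], [-b, A]]`. -/
def extForm (z w : P.Ext) : ℂ :=
  P.formLaplace z.1 w.1 + P.Xi * P.form₂ (fn z.1) (fn w.1)
    - ∑ ℓ, P.b ℓ * P.form₂ (z.2 ℓ) (fn w.1)
    - ∑ ℓ, P.b ℓ * P.form₂ (fn z.1) (w.2 ℓ)
    + ∑ ℓ, ∑ m, P.A ℓ m * P.form₂ (z.2 m) (w.2 ℓ)

/-- The form of the right-hand side operator `diag(I_α, I)` of the linearised problem. -/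
def extInner (z w : P.Ext) : ℂ :=
  P.formα (fn z.1) (fn w.1) + ∑ ℓ, P.form₂ (z.2 ℓ) (w.2 ℓ)

/-- The shifted form. -/
def extShifted (β : ℝ) (z w : P.Ext) : ℂ := P.extForm z w + β * P.extInner z w

/-- The norm induced by `extInner`. -/
def extNorm (z : P.Ext) : ℝ := Real.sqrt (P.extInner z z).re

/-- The Rayleigh quotient of the shifted problem. -/
def rayleigh (β : ℝ) (z : P.Ext) : ℝ := (P.extShifted β z z).re / (P.extInner z z).re

/-- The normalisation `z / ‖z‖` in the norm induced by `extInner`. -/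
def normalized (z : P.Ext) : P.Ext := (((P.extNorm z)⁻¹ : ℝ) : ℂ) • z

/-- `z` is a sequence generated by the inverse power iteration for the shifted linearised problem
with starting value `z₀`. -/
def IsInversePowerIteration (β : ℝ) (z₀ : P.Ext) (z : ℕ → P.Ext) : Prop :=
  z 0 = z₀ ∧ ∀ (j : ℕ) (w : P.Ext),
    P.extShifted β (z (j + 1)) w = P.rayleigh β (z j) * P.extInner (P.normalized (z j)) w

end TMCrystal

end

/-!
The starting value is transported to the pivot space `Pivot`, a product of copies of `L²(Ω)` on
which `extInner` is the ordinary inner product. The shifted form is the inner product of the range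
of `energy`, a closed subspace of a larger product, so the problem with a given right-hand side is
solved by a bounded positive operator `T` (`exists_solutionOperator`), and up to positive factors
the iterates are `T ^ n y` (`toPivot_iterate`).

`T` is not compact, because the components `x_ℓ ∈ L²(Ω₂)` gain no regularity. Since the norms
`‖T ^ n y‖` are logarithmically convex, they have a growth rate `σ`, and the normalised iterates are
approximate eigenvectors of `T` for `σ` (`PowerIteration.exists_growth_rate`). It remains to
extract a convergent subsequence and to show that its limit, an eigenvector of the linearised
problem for `lam = σ⁻¹ - β`, yields a solution of the nonlinear problem.

* If `lam` is not a pole `η_ℓ² ≠ 0`, the functions `u` converge along a subsequence by Rellich's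
  theorem, and they determine the `x_ℓ` through `(η_ℓ² - lam) x_ℓ = b_ℓ u + o(1)` on `Ω₂`
  (`exists_subseq_tendsto_of_forall_ne`).
* If `lam` is a pole, the eigenvalues of the linearised problem may accumulate at `lam` from below,
  but not from above. The iterates lie in the closure of the vectors of growth rate at most `σ`,
  where `‖T‖ ≤ σ`, so they only involve the spectrum above `lam`. An explicit computation of the
  quadratic form of `(1 - (lam + β) T) (1 - (lam + δ + β) T)` (`SolvesSource.re_inner_eq`) shows
  that the spectral subspace of the interval from `lam` to `lam + δ` embeds into a space of
  functions `u` whose gradient is bounded by `u`, which is finite-dimensional by Rellich's theorem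
  (`finiteDimensional_of_re_inner_nonpos`, `exists_subseq_tendsto_of_pole`).

The conditions on the starting value define a closed invariant subspace `coupled`. In this subspace
no pole is an eigenvalue: the equation for `x_ℓ` at a non-zero pole forces `u = 0` on `Ω₂`, and then
`u` and the coupling term vanish by unique continuation. After elimination of the `x_ℓ` the
eigenvalue equation is the nonlinear problem (`isNonlinearEigenpair_of_solvesSource`).

Unique continuation has an elementary proof for the periodic Laplacian (`unique_continuation`). The
second derivatives of `u` are square integrable by a comparison of Fourier coefficients, and weak
gradients vanish almost everywhere on zero sets (`grad_ae_eq_zero`). So the equation holds without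
its right-hand side supported on `Ω₂`, whence `u` is a trigonometric polynomial. The differential
operators that remove single frequencies preserve its vanishing on `Ω₂`, which reduces the claim to
single exponentials; these have no zeros. Fourier series on the cell, an arbitrary measurable
fundamental domain, are obtained from those on the torus by translation invariance.
-/

noncomputable section

namespace TMCrystal

variable {L : ℕ} (P : TMCrystal L)

/-! ### The pivot space and the energy space as Hilbert spaces -/

lemma measurableSet_Ω : MeasurableSet P.Ω := P.measurable₁.union P.measurable₂

lemma inner_eq (v u : P.H) : inner ℂ v u = ∫ x in P.Ω, u x * conj (v x) := by
  rw [MeasureTheory.L2.inner_def]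
  simp only [RCLike.inner_apply]

/-- The function that agrees with `u` on `Ω₂` and vanishes on `Ω₁`. -/
def cutoff (u : P.H) : P.H :=
  MemLp.toLp (P.Ω₂.indicator fun x => u x) (MemLp.indicator P.measurable₂ (Lp.memLp u))

lemma coeFn_cutoff (u : P.H) :
    P.cutoff u =ᵐ[volume.restrict P.Ω] P.Ω₂.indicator (fun x => u x) :=
  MemLp.coeFn_toLp _

/-- Multiplication by the indicator function of `Ω₂`. -/
def chi : P.H →L[ℂ] P.H :=
  LinearMap.mkContinuous
    { toFun := P.cutoff
      map_add' := fun u v => by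
        refine Lp.ext ?_
        filter_upwards [Lp.coeFn_add u v, Lp.coeFn_add (P.cutoff u) (P.cutoff v),
          P.coeFn_cutoff u, P.coeFn_cutoff v, P.coeFn_cutoff (u + v)] with x h1 h2 h3 h4 h5
        rw [h5, h2, Pi.add_apply, h3, h4]
        by_cases h : x ∈ P.Ω₂
        · simp only [Set.indicator_of_mem h, h1, Pi.add_apply]
        · simp only [Set.indicator_of_notMem h, add_zero]
      map_smul' := fun c u => by
        rw [RingHom.id_apply]
        refine Lp.ext ?_
        filter_upwards [Lp.coeFn_smul c u, Lp.coeFn_smul c (P.cutoff u),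
          P.coeFn_cutoff u, P.coeFn_cutoff (c • u)] with x h1 h2 h3 h4
        rw [h4, h2, Pi.smul_apply, h3]
        by_cases h : x ∈ P.Ω₂
        · simp only [Set.indicator_of_mem h, h1, Pi.smul_apply]
        · simp only [Set.indicator_of_notMem h, smul_zero] } 1
    (fun u => by
      refine (Lp.norm_le_norm_of_ae_le ?_).trans_eq (one_mul _).symm
      filter_upwards [P.coeFn_cutoff u] with x hx
      change ‖P.cutoff u x‖ ≤ _
      rw [hx]
      exact norm_indicator_le_norm_self _ _)

lemma coeFn_chi (u : P.H) :
    P.chi u =ᵐ[volume.restrict P.Ω] P.Ω₂.indicator (fun x => u x) :=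
  P.coeFn_cutoff u

lemma setIntegral_Ω₂ (f : Plane → ℂ) :
    ∫ x in P.Ω₂, f x = ∫ x in P.Ω, P.Ω₂.indicator f x := by
  rw [integral_indicator P.measurable₂, Measure.restrict_restrict P.measurable₂]
  congr 2
  exact (Set.inter_eq_self_of_subset_left Set.subset_union_right).symm

lemma form₂_eq (u v : P.H) : P.form₂ u v = inner ℂ v (P.chi u) := by
  rw [form₂, inner_eq, setIntegral_Ω₂]
  refine integral_congr_ae ?_
  filter_upwards [P.coeFn_chi u] with x hx
  rw [hx]
  by_cases h : x ∈ P.Ω₂ <;> simp [h]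

lemma integrable_mul_conj (u v : P.H) :
    Integrable (fun x => u x * conj (v x)) (volume.restrict P.Ω) := by
  have := MeasureTheory.L2.integrable_inner (𝕜 := ℂ) v u
  simpa only [RCLike.inner_apply] using this

lemma form₁_eq (u v : P.H) : P.form₁ u v = inner ℂ v (u - P.chi u) := by
  have h : P.form₁ u v + P.form₂ u v = inner ℂ v u := by
    rw [form₁, form₂, inner_eq]
    exact (setIntegral_union P.disjoint P.measurable₂
      (IntegrableOn.mono_set (P.integrable_mul_conj u v) Set.subset_union_left)
      (IntegrableOn.mono_set (P.integrable_mul_conj u v) Set.subset_union_right)).symm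
  rw [inner_sub_right, ← form₂_eq, ← h]
  ring

lemma inner_chi_left (u v : P.H) : inner ℂ (P.chi v) u = inner ℂ v (P.chi u) := by
  rw [inner_eq, inner_eq]
  refine integral_congr_ae ?_
  filter_upwards [P.coeFn_chi u, P.coeFn_chi v] with x hx hx'
  rw [hx, hx']
  by_cases h : x ∈ P.Ω₂ <;> simp [h]

@[simp] lemma chi_chi (u : P.H) : P.chi (P.chi u) = P.chi u := by
  refine Lp.ext ?_
  filter_upwards [P.coeFn_chi u, P.coeFn_chi (P.chi u)] with x hx hx'
  rw [hx']
  by_cases h : x ∈ P.Ω₂ <;> simp [h, hx]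

lemma mem_X_iff (u : P.H) : u ∈ P.X ↔ P.chi u = u := by
  have h1 : u ∈ P.X ↔ ∀ᵐ x ∂(volume.restrict P.Ω), x ∈ P.Ω₁ → u x = 0 := by
    have : (volume.restrict P.Ω₁) = (volume.restrict P.Ω).restrict P.Ω₁ := by
      rw [Measure.restrict_restrict P.measurable₁]
      congr 1
      exact (Set.inter_eq_self_of_subset_left Set.subset_union_left).symm
    change (∀ᵐ x ∂(volume.restrict P.Ω₁), u x = 0) ↔ _
    rw [this, ae_restrict_iff' P.measurable₁]
  have hΩ : ∀ᵐ x ∂(volume.restrict P.Ω), x ∈ P.Ω := ae_restrict_mem P.measurableSet_Ω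
  rw [h1]
  constructor
  · intro h
    refine Lp.ext ?_
    filter_upwards [P.coeFn_chi u, h, hΩ] with x hx h0 hm
    rw [hx]
    by_cases h2 : x ∈ P.Ω₂
    · simp [h2]
    · simp only [h2, not_false_eq_true, Set.indicator_of_notMem]
      exact (h0 (hm.resolve_right h2)).symm
  · intro h
    filter_upwards [P.coeFn_chi u] with x hx h0
    rw [← h, hx]
    exact Set.indicator_of_notMem (Set.disjoint_left.1 P.disjoint h0) _

@[simp] lemma chi_coe (x : P.X) : P.chi (x : P.H) = x := (P.mem_X_iff _).1 x.2

lemma isClosed_X : IsClosed (P.X : Set P.H) := by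
  have : (P.X : Set P.H) = {u | P.chi u = u} := Set.ext fun u => P.mem_X_iff u
  rw [this]
  exact isClosed_eq P.chi.continuous continuous_id

instance : CompleteSpace P.X := P.isClosed_X.completeSpace_coe

/-- A continuous periodic function as an element of `L²(Ω)`. -/
def toH (f : Plane → ℂ) (hf : Continuous f)
    (hper : ∀ (i : Fin 2) (x : Plane), f (x + P.period i) = f x) : P.H :=
  (MemLp.of_bound hf.aestronglyMeasurable (P.exists_bound_of_periodic hf hper).choose
    (Eventually.of_forall (P.exists_bound_of_periodic hf hper).choose_spec)).toLp f

lemma coeFn_toH (f : Plane → ℂ) (hf : Continuous f)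
    (hper : ∀ (i : Fin 2) (x : Plane), f (x + P.period i) = f x) :
    P.toH f hf hper =ᵐ[volume.restrict P.Ω] f := MemLp.coeFn_toLp _

lemma inner_toH (f : Plane → ℂ) (hf : Continuous f)
    (hper : ∀ (i : Fin 2) (x : Plane), f (x + P.period i) = f x) (u : P.H) :
    inner ℂ (P.toH f hf hper) u = ∫ x in P.Ω, u x * conj (f x) := by
  rw [inner_eq]
  refine integral_congr_ae ?_
  filter_upwards [P.coeFn_toH f hf hper] with x hx
  rw [hx]

lemma continuous_integral_mul {f : Plane → ℂ} (hf : Continuous f)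
    (hper : ∀ (i : Fin 2) (x : Plane), f (x + P.period i) = f x) :
    Continuous fun u : P.H => ∫ x in P.Ω, u x * f x := by
  have h : ∀ u : P.H, ∫ x in P.Ω, u x * f x =
      inner ℂ (P.toH (fun x => conj (f x)) (Complex.continuous_conj.comp hf)
        (fun i x => by rw [hper])) u := by
    intro u
    rw [inner_toH]
    simp
  simp_rw [h]
  fun_prop

lemma isClosed_V : IsClosed (P.V : Set (P.H × (Fin 2 → P.H))) := by
  have : (P.V : Set (P.H × (Fin 2 → P.H))) = ⋂ (φ : Plane → ℂ) (_ : P.IsPeriodicTest φ)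
      (j : Fin 2), {p | ∫ x in P.Ω, p.1 x * partialDeriv j φ x = -∫ x in P.Ω, p.2 j x * φ x} := by
    ext p
    simp only [Set.mem_iInter, Set.mem_ofPred_eq]
    exact Iff.rfl
  rw [this]
  refine isClosed_iInter fun φ => isClosed_iInter fun hφ => isClosed_iInter fun j => ?_
  refine isClosed_eq ?_ ?_
  · exact (P.continuous_integral_mul (hφ.continuous_partialDeriv j)
      (hφ.periodic_partialDeriv j)).comp continuous_fst
  · exact ((P.continuous_integral_mul hφ.smooth.continuous hφ.periodic).comp
      ((continuous_apply j).comp continuous_snd)).neg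

instance : CompleteSpace P.V := P.isClosed_V.completeSpace_coe

/-- The embedding of `V` into `L²(Ω)`. -/
def emb : P.V →L[ℂ] P.H := (ContinuousLinearMap.fst ℂ P.H (Fin 2 → P.H)).comp P.V.subtypeL

/-- The `j`-th component of the shifted gradient `u ↦ ∂_j u + i k_j u`. -/
def shiftedD (j : Fin 2) : P.V →L[ℂ] P.H :=
  (ContinuousLinearMap.proj (R := ℂ) (φ := fun _ : Fin 2 => P.H) j).comp
      ((ContinuousLinearMap.snd ℂ P.H (Fin 2 → P.H)).comp P.V.subtypeL)
    + (Complex.I * (P.k j : ℂ)) • P.emb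

lemma shiftedD_apply (j : Fin 2) (u : P.V) :
    P.shiftedD j u = grad u j + (Complex.I * (P.k j : ℂ)) • fn u := rfl

lemma coeFn_shiftedD (j : Fin 2) (u : P.V) :
    P.shiftedD j u =ᵐ[volume.restrict P.Ω] P.shiftedGrad u j := by
  rw [shiftedD_apply]
  filter_upwards [Lp.coeFn_add (grad u j) ((Complex.I * (P.k j : ℂ)) • fn u),
    Lp.coeFn_smul (Complex.I * (P.k j : ℂ)) (fn u)] with x h1 h2
  rw [h1, Pi.add_apply, h2]
  rfl

lemma formLaplace_eq (u v : P.V) :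
    P.formLaplace u v = ∑ j, inner ℂ (P.shiftedD j v) (P.shiftedD j u) := by
  simp_rw [inner_eq]
  rw [formLaplace, ← integral_finsetSum _ fun j _ => P.integrable_mul_conj _ _]
  refine integral_congr_ae ?_
  have h : ∀ᵐ x ∂(volume.restrict P.Ω), ∀ (w : Bool) (j : Fin 2),
      P.shiftedD j (bif w then u else v) x = P.shiftedGrad (bif w then u else v) j x :=
    ae_all_iff.2 fun w => ae_all_iff.2 fun j => P.coeFn_shiftedD j _
  filter_upwards [h] with x hx
  refine Finset.sum_congr rfl fun j _ => ?_
  have h1 := hx true j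
  have h2 := hx false j
  simp only [cond_true, cond_false] at h1 h2
  rw [h1, h2]

lemma ext_V {u v : P.V} (h : fn u = fn v) (h' : ∀ j, grad u j = grad v j) : u = v :=
  Subtype.ext (Prod.ext h (funext h'))

lemma norm_V_le (u : P.V) : ‖u‖ ≤
    (1 + ‖P.k 0‖ + ‖P.k 1‖) * ‖fn u‖ + ‖P.shiftedD 0 u‖ + ‖P.shiftedD 1 u‖ := by
  have hg : ∀ j, ‖grad u j‖ ≤ ‖P.shiftedD j u‖ + ‖P.k j‖ * ‖fn u‖ := by
    intro j
    have : grad u j = P.shiftedD j u - (Complex.I * (P.k j : ℂ)) • fn u := by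
      rw [shiftedD_apply]; abel
    rw [this]
    refine (norm_sub_le _ _).trans ?_
    rw [norm_smul, norm_mul, Complex.norm_I, one_mul, Complex.norm_real]
  have h0 := hg 0
  have h1 := hg 1
  have e0 := norm_nonneg (fn u)
  have e1 := norm_nonneg (P.shiftedD 0 u)
  have e2 := norm_nonneg (P.shiftedD 1 u)
  have e3 := mul_nonneg (norm_nonneg (P.k 0)) e0
  have e4 := mul_nonneg (norm_nonneg (P.k 1)) e0
  change max ‖fn u‖ ‖u.1.2‖ ≤ _
  refine max_le (by nlinarith) ((pi_norm_le_iff_of_nonneg (by nlinarith)).2 fun j => ?_)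
  change ‖grad u j‖ ≤ _
  fin_cases j
  · simp only [Fin.zero_eta]; nlinarith
  · simp only [Fin.mk_one]; nlinarith

end TMCrystal

namespace TMCrystal

open scoped Pointwise

variable {L : ℕ} (P : TMCrystal L)

/-! ### Fourier series on the periodicity cell -/

/-- The lattice of periods. -/
abbrev Lat : Submodule ℤ Plane := Submodule.span ℤ (Set.range P.period)

instance : VAddInvariantMeasure P.Lat Plane volume :=
  (inferInstance : VAddInvariantMeasure P.Lat.toAddSubgroup Plane volume)

lemma cell' : IsAddFundamentalDomain P.Lat P.Ω volume := P.cell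

variable {P} in
lemma add_lattice_of_periodic {E : Type*} {f : Plane → E}
    (hper : ∀ (i : Fin 2) (x : Plane), f (x + P.period i) = f x) {v : Plane} (hv : v ∈ P.Lat)
    (x : Plane) : f (x + v) = f x := by
  induction hv using Submodule.span_induction generalizing x with
  | mem v hv => obtain ⟨i, rfl⟩ := hv; exact hper i x
  | zero => simp
  | add v w _ _ h1 h2 => rw [← add_assoc, h2, h1]
  | smul n v _ h => exact (Function.Periodic.zsmul (show Function.Periodic f v from h) n) x

/-- The integral of a periodic function over the cell is invariant under translations, although
the cell is an arbitrary measurable fundamental domain. -/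
lemma setIntegral_translate {f : Plane → ℂ}
    (hper : ∀ (i : Fin 2) (x : Plane), f (x + P.period i) = f x) (y : Plane) :
    ∫ x in P.Ω, f (x + y) = ∫ x in P.Ω, f x := by
  have h1 : IsAddFundamentalDomain P.Lat (y +ᵥ P.Ω) volume := P.cell'.vadd_of_comm y
  have h2 := h1.setIntegral_eq P.cell' (f := f) (fun g x => by
    rw [Submodule.vadd_def, vadd_eq_add, add_comm]
    exact add_lattice_of_periodic hper g.2 x)
  rw [← h2]
  have h3 := (measurePreserving_vadd y (volume : Measure Plane)).setIntegral_image_emb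
    (measurableEmbedding_const_vadd y) f P.Ω
  rw [Set.image_vadd] at h3
  rw [h3]
  simp only [vadd_eq_add, add_comm]

/-- The linear phase `x ↦ κ · (coordinates of x in the lattice basis)`. -/
def phase (κ : Fin 2 → ℤ) : Plane →L[ℝ] ℝ :=
  LinearMap.toContinuousLinearMap (∑ i, (κ i : ℝ) • P.period.coord i)

lemma phase_apply (κ : Fin 2 → ℤ) (x : Plane) :
    P.phase κ x = ∑ i, (κ i : ℝ) * P.period.repr x i := by
  simp [phase]

lemma phase_period (κ : Fin 2 → ℤ) (i : Fin 2) : P.phase κ (P.period i) = κ i := by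
  rw [phase_apply]
  simp [Finsupp.single_apply]

/-- The periodic exponential `x ↦ exp (2 π i κ · (coordinates of x))`. -/
def expo (κ : Fin 2 → ℤ) (x : Plane) : ℂ :=
  Complex.exp ((2 * Real.pi * P.phase κ x : ℝ) * Complex.I)

lemma norm_expo (κ : Fin 2 → ℤ) (x : Plane) : ‖P.expo κ x‖ = 1 :=
  Complex.norm_exp_ofReal_mul_I _

lemma expo_add (κ : Fin 2 → ℤ) (x y : Plane) :
    P.expo κ (x + y) = P.expo κ x * P.expo κ y := by
  rw [expo, expo, expo, ← Complex.exp_add, map_add]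
  congr 1
  push_cast
  ring

lemma expo_period (κ : Fin 2 → ℤ) (i : Fin 2) (x : Plane) :
    P.expo κ (x + P.period i) = P.expo κ x := by
  rw [expo_add]
  have : P.expo κ (P.period i) = 1 := by
    rw [expo, phase_period]
    refine Complex.exp_eq_one_iff.2 ⟨κ i, ?_⟩
    push_cast
    ring
  rw [this, mul_one]

lemma phase_sub (κ κ' : Fin 2 → ℤ) (x : Plane) :
    P.phase (κ - κ') x = P.phase κ x - P.phase κ' x := by
  simp_rw [phase_apply, ← Finset.sum_sub_distrib]
  refine Finset.sum_congr rfl fun i _ => ?_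
  simp [sub_mul]

lemma expo_mul_conj (κ κ' : Fin 2 → ℤ) (x : Plane) :
    P.expo κ x * conj (P.expo κ' x) = P.expo (κ - κ') x := by
  rw [expo, expo, expo, ← Complex.exp_conj, ← Complex.exp_add, phase_sub]
  congr 1
  rw [map_mul, Complex.conj_I, Complex.conj_ofReal]
  push_cast
  ring

lemma expo_zero (x : Plane) : P.expo 0 x = 1 := by
  rw [expo, phase_apply]
  simp

lemma contDiff_expo (κ : Fin 2 → ℤ) : ContDiff ℝ ∞ (P.expo κ) := by
  unfold expo
  refine ContDiff.cexp (ContDiff.mul ?_ contDiff_const)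
  exact Complex.ofRealCLM.contDiff.comp (contDiff_const.mul (P.phase κ).contDiff)

lemma isPeriodicTest_expo (κ : Fin 2 → ℤ) : P.IsPeriodicTest (P.expo κ) :=
  ⟨P.contDiff_expo κ, P.expo_period κ⟩

/-- The `j`-th component of the dual lattice vector with index `κ`. -/
def freq (κ : Fin 2 → ℤ) (j : Fin 2) : ℝ := 2 * Real.pi * P.phase κ (EuclideanSpace.single j 1)

lemma partialDeriv_expo (κ : Fin 2 → ℤ) (j : Fin 2) (x : Plane) :
    partialDeriv j (P.expo κ) x = P.freq κ j * Complex.I * P.expo κ x := by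
  have h1 : HasFDerivAt (fun x => (2 * Real.pi * P.phase κ x : ℝ))
      ((2 * Real.pi) • P.phase κ) x := (P.phase κ).hasFDerivAt.const_mul _
  have h2 := ((Complex.ofRealCLM.hasFDerivAt.comp x h1).mul_const Complex.I).cexp
  have h3 : HasFDerivAt (P.expo κ) _ x := h2
  rw [partialDeriv, h3.fderiv]
  simp only [freq, expo, Function.comp_apply, smul_apply,
    ContinuousLinearMap.comp_apply, Complex.ofRealCLM_apply, smul_eq_mul]
  ring

lemma integral_expo {κ : Fin 2 → ℤ} (hκ : κ ≠ 0) : ∫ x in P.Ω, P.expo κ x = 0 := by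
  obtain ⟨i, hi⟩ := Function.ne_iff.1 hκ
  have hi' : (κ i : ℝ) ≠ 0 := by exact_mod_cast hi
  -- Along this translation the exponential changes its sign.
  have hy : P.expo κ ((2 * (κ i : ℝ))⁻¹ • P.period i) = -1 := by
    rw [expo, map_smul, phase_period, smul_eq_mul, ← Complex.exp_pi_mul_I]
    congr 3
    field_simp
  have h := P.setIntegral_translate (P.expo_period κ) ((2 * (κ i : ℝ))⁻¹ • P.period i)
  simp_rw [expo_add, hy, mul_neg, mul_one] at h
  rw [integral_neg] at h
  linear_combination (-1 / 2 : ℂ) * h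

lemma volume_Ω_pos : 0 < volume P.Ω := by
  have h := P.cell'.measure_eq (ZSpan.isAddFundamentalDomain P.period volume)
  rw [h]
  exact pos_iff_ne_zero.2 (ZSpan.measure_fundamentalDomain_ne_zero P.period)

/-- The normalised exponentials as elements of `L²(Ω)`. -/
def fourierVec (κ : Fin 2 → ℤ) : P.H :=
  (((Real.sqrt (volume.real P.Ω))⁻¹ : ℝ) : ℂ) •
    P.toH (P.expo κ) (P.contDiff_expo κ).continuous (P.expo_period κ)

lemma volume_real_Ω_pos : 0 < volume.real P.Ω :=
  ENNReal.toReal_pos P.volume_Ω_pos.ne' P.volume_Ω_lt_top.ne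

lemma inner_fourierVec (κ : Fin 2 → ℤ) (u : P.H) :
    inner ℂ (P.fourierVec κ) u =
      (((Real.sqrt (volume.real P.Ω))⁻¹ : ℝ) : ℂ) * ∫ x in P.Ω, u x * conj (P.expo κ x) := by
  rw [fourierVec, inner_smul_left, inner_toH, Complex.conj_ofReal]

lemma orthonormal_fourierVec : Orthonormal ℂ P.fourierVec := by
  rw [orthonormal_iff_ite]
  intro κ κ'
  have h1 : ∫ x in P.Ω, P.toH (P.expo κ') (P.contDiff_expo κ').continuous (P.expo_period κ') x *
      conj (P.expo κ x) = ∫ x in P.Ω, P.expo (κ' - κ) x := by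
    refine integral_congr_ae ?_
    filter_upwards [P.coeFn_toH (P.expo κ') (P.contDiff_expo κ').continuous (P.expo_period κ')]
      with x hx
    rw [hx, expo_mul_conj]
  have h0 := Real.sq_sqrt P.volume_real_Ω_pos.le
  have h0' : (Real.sqrt (volume.real P.Ω)) ≠ 0 := (Real.sqrt_pos.2 P.volume_real_Ω_pos).ne'
  rw [inner_fourierVec]
  conv_lhs => rw [fourierVec]
  have h2 : ∀ u : P.H, ∀ c : ℂ, ∫ x in P.Ω, (c • u : P.H) x * conj (P.expo κ x) =
      c * ∫ x in P.Ω, u x * conj (P.expo κ x) := by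
    intro u c
    rw [← P.inner_toH (P.expo κ) (P.contDiff_expo κ).continuous (P.expo_period κ),
      ← P.inner_toH (P.expo κ) (P.contDiff_expo κ).continuous (P.expo_period κ),
      inner_smul_right]
  rw [h2, h1]
  split_ifs with h
  · subst h
    simp_rw [sub_self, expo_zero]
    rw [setIntegral_const, Complex.real_smul, mul_one, ← Complex.ofReal_mul, ← Complex.ofReal_mul,
      ← Complex.ofReal_one]
    congr 1
    field_simp
    exact h0.symm
  · rw [P.integral_expo (sub_ne_zero.2 (Ne.symm h)), mul_zero, mul_zero]

/-- The projection of the plane onto the torus `ℝ²/ℤ²` given by the coordinates in the lattice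
basis. -/
def toTorus (x : Plane) : UnitAddTorus (Fin 2) := fun i => ((P.period.repr x i : ℝ) : UnitAddCircle)

lemma continuous_toTorus : Continuous P.toTorus := by
  refine continuous_pi fun i => ?_
  have : Continuous fun x => P.period.repr x i :=
    (LinearMap.toContinuousLinearMap (P.period.coord i)).continuous
  exact (AddCircle.continuous_mk' 1).comp this

lemma mFourier_toTorus (κ : Fin 2 → ℤ) (x : Plane) :
    UnitAddTorus.mFourier κ (P.toTorus x) = P.expo κ x := by
  simp only [UnitAddTorus.mFourier, toTorus, ContinuousMap.coe_mk, fourier_coe_apply, expo,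
    phase_apply]
  rw [← Complex.exp_sum]
  congr 1
  push_cast
  rw [Finset.mul_sum, Finset.sum_mul]
  refine Finset.sum_congr rfl fun i _ => ?_
  ring

/-- A measurable section of `toTorus`. -/
def ofTorus (t : UnitAddTorus (Fin 2)) : Plane :=
  ∑ i, (UnitAddTorus.measurableEquivPiIoc (0 : Fin 2 → ℝ) t).1 i • P.period i

lemma measurable_ofTorus : Measurable P.ofTorus := by
  refine Finset.measurable_sum _ fun i _ => Measurable.smul_const ?_ _
  exact (measurable_pi_apply i).comp
    (measurable_subtype_coe.comp (UnitAddTorus.measurableEquivPiIoc (0 : Fin 2 → ℝ)).measurable)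

lemma ofTorus_toTorus_sub_mem (x : Plane) : P.ofTorus (P.toTorus x) - x ∈ P.Lat := by
  have hx : x = ∑ i, P.period.repr x i • P.period i := (P.period.sum_repr x).symm
  have h : P.ofTorus (P.toTorus x) - x = ∑ i,
      ((UnitAddTorus.measurableEquivPiIoc (0 : Fin 2 → ℝ) (P.toTorus x)).1 i
        - P.period.repr x i) • P.period i := by
    simp_rw [sub_smul]
    rw [Finset.sum_sub_distrib, ← hx, ofTorus]
  rw [h]
  refine Submodule.sum_mem _ fun i _ => ?_
  have h1 : (((UnitAddTorus.measurableEquivPiIoc (0 : Fin 2 → ℝ) (P.toTorus x)).1 i : ℝ) :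
      UnitAddCircle) = ((P.period.repr x i : ℝ) : UnitAddCircle) := by
    have h2 := (UnitAddTorus.measurableEquivPiIoc (0 : Fin 2 → ℝ)).symm_apply_apply (P.toTorus x)
    rw [UnitAddTorus.coe_symm_measurableEquivPiIoc] at h2
    exact congrFun h2 i
  rw [← sub_eq_zero, ← AddCircle.coe_sub, AddCircle.coe_eq_zero_iff] at h1
  obtain ⟨n, hn⟩ := h1
  rw [← hn, zsmul_eq_mul, mul_one, Int.cast_smul_eq_zsmul]
  exact Submodule.smul_mem _ n (Submodule.subset_span ⟨i, rfl⟩)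

/-- An integrable function that annihilates all continuous functions of `q` has integral zero over
all sets defined in terms of `q`: the two finite measures obtained by pushing forward its positive
and negative parts agree. -/
lemma setIntegral_preimage_eq_zero {α T : Type*} [MeasurableSpace α] [MeasurableSpace T]
    [TopologicalSpace T] [HasOuterApproxClosed T] [BorelSpace T] {μ : Measure α} {q : α → T}
    (hq : Measurable q) {f : α → ℝ} (hf : Integrable f μ)
    (h : ∀ g : BoundedContinuousFunction T ℝ, ∫ x, f x * g (q x) ∂μ = 0)
    {B : Set T} (hB : MeasurableSet B) : ∫ x in q ⁻¹' B, f x ∂μ = 0 := by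
  have fin : ∀ s : α → ℝ, Integrable s μ →
      IsFiniteMeasure (μ.withDensity fun x => ENNReal.ofReal (s x)) := fun s hs =>
    isFiniteMeasure_withDensity_ofReal hs.2
  have := fin f hf
  have := fin (fun x => -f x) hf.neg
  have meas : ∀ s : α → ℝ, Integrable s μ → AEMeasurable (fun x => (s x).toNNReal) μ :=
    fun s hs => hs.1.aemeasurable.real_toNNReal
  have key : ∀ (s : α → ℝ), Integrable s μ → ∀ g : BoundedContinuousFunction T ℝ,
      ∫ t, g t ∂((μ.withDensity fun x => ENNReal.ofReal (s x)).map q) =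
        ∫ x, max (s x) 0 * g (q x) ∂μ := by
    intro s hs g
    rw [integral_map hq.aemeasurable g.continuous.measurable.aestronglyMeasurable]
    change ∫ x, g (q x) ∂(μ.withDensity fun x => (((s x).toNNReal : NNReal) : ENNReal)) = _
    rw [integral_withDensity_eq_integral_smul₀ (meas s hs)]
    refine integral_congr_ae (Eventually.of_forall fun x => ?_)
    simp [NNReal.smul_def, Real.coe_toNNReal']
  have intg : ∀ (s : α → ℝ), Integrable s μ → ∀ g : BoundedContinuousFunction T ℝ,
      Integrable (fun x => max (s x) 0 * g (q x)) μ := fun s hs g =>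
    hs.pos_part.mul_bdd (c := ‖g‖)
      (g.continuous.measurable.comp hq).aestronglyMeasurable
      (Eventually.of_forall fun x => g.norm_coe_le_norm _)
  have heq : (μ.withDensity fun x => ENNReal.ofReal (f x)).map q =
      (μ.withDensity fun x => ENNReal.ofReal (-f x)).map q := by
    refine ext_of_forall_integral_eq_of_IsFiniteMeasure fun g => ?_
    rw [key f hf, key (fun x => -f x) hf.neg, ← sub_eq_zero,
      ← integral_sub (intg f hf g) (intg (fun x => -f x) hf.neg g)]
    refine Eq.trans ?_ (h g)
    refine integral_congr_ae (Eventually.of_forall fun x => ?_)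
    have : max (f x) 0 - max (-f x) 0 = f x := by
      rcases le_total 0 (f x) with h0 | h0
      · rw [max_eq_left h0, max_eq_right (by linarith)]; ring
      · rw [max_eq_right h0, max_eq_left (by linarith)]; ring
    simp only
    rw [← sub_mul, this]
  have hval : ∀ s : α → ℝ, Integrable s μ →
      ((μ.withDensity fun x => ENNReal.ofReal (s x)).map q B).toReal =
        ∫ x in q ⁻¹' B, max (s x) 0 ∂μ := by
    intro s hs
    have hs' : Integrable (fun x => max (s x) 0) μ := hs.pos_part
    rw [Measure.map_apply hq hB, withDensity_apply _ (hq hB),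
      integral_eq_lintegral_of_nonneg_ae (f := fun x => max (s x) 0)
        (Eventually.of_forall fun x => le_max_right _ _) hs'.1.restrict]
    congr 1
    refine lintegral_congr fun x => ?_
    rcases le_total 0 (s x) with h0 | h0
    · rw [max_eq_left h0]
    · rw [max_eq_right h0, ENNReal.ofReal_of_nonpos h0, ENNReal.ofReal_zero]
  have h2 := hval f hf
  rw [heq, hval (fun x => -f x) hf.neg] at h2
  have h3 : ∫ x in q ⁻¹' B, f x ∂μ =
      (∫ x in q ⁻¹' B, max (f x) 0 ∂μ) - ∫ x in q ⁻¹' B, max (-f x) 0 ∂μ := by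
    have hf1 : Integrable (fun x => max (f x) 0) μ := hf.pos_part
    have hf2 : Integrable (fun x => max (-f x) 0) μ := hf.neg.pos_part
    rw [← integral_sub hf1.integrableOn hf2.integrableOn]
    refine integral_congr_ae (Eventually.of_forall fun x => ?_)
    simp only
    rcases le_total 0 (f x) with h0 | h0
    · rw [max_eq_left h0, max_eq_right (by linarith)]; ring
    · rw [max_eq_right h0, max_eq_left (by linarith)]; ring
  rw [h3, ← h2, sub_self]

/-- A function on the cell that annihilates all continuous functions on the torus vanishes: up to
null sets, every measurable subset of the cell is cut out by a subset of the torus. -/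
lemma ae_eq_zero_of_integral_toTorus {f : Plane → ℝ} (hf : Integrable f (volume.restrict P.Ω))
    (h : ∀ g : BoundedContinuousFunction (UnitAddTorus (Fin 2)) ℝ,
      ∫ x in P.Ω, f x * g (P.toTorus x) = 0) : f =ᵐ[volume.restrict P.Ω] 0 := by
  refine hf.ae_eq_zero_of_forall_setIntegral_eq_zero fun A hA _ => ?_
  -- The union `S` of the lattice translates of `A ∩ Ω` agrees with `A` on `Ω` up to a null set, and
  -- it is a preimage under `toTorus`.
  set S : Set Plane := ⋃ v : P.Lat, v +ᵥ (A ∩ P.Ω) with hS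
  have hSm : MeasurableSet S :=
    MeasurableSet.iUnion fun v => (hA.inter P.measurableSet_Ω).const_vadd v
  have hSinv : ∀ x y : Plane, y - x ∈ P.Lat → x ∈ S → y ∈ S := by
    intro x y hxy hx
    obtain ⟨v, hv⟩ := Set.mem_iUnion.1 hx
    obtain ⟨a, ha, rfl⟩ := hv
    refine Set.mem_iUnion.2 ⟨⟨_, hxy⟩ + v, a, ha, ?_⟩
    simp only [vadd_eq_add, Submodule.coe_add]
    abel
  have hpre : P.toTorus ⁻¹' (P.ofTorus ⁻¹' S) = S := by
    ext x
    constructor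
    · intro hx
      refine hSinv _ _ ?_ hx
      rw [← neg_sub]
      exact neg_mem (P.ofTorus_toTorus_sub_mem x)
    · exact hSinv _ _ (P.ofTorus_toTorus_sub_mem x)
  have h1 := setIntegral_preimage_eq_zero P.continuous_toTorus.measurable hf h
    (P.measurable_ofTorus hSm)
  rw [hpre] at h1
  rw [← h1]
  refine setIntegral_congr_set ?_
  have hΩ : ∀ᵐ x ∂(volume.restrict P.Ω), x ∈ P.Ω := ae_restrict_mem P.measurableSet_Ω
  have hnull : ∀ᵐ x ∂(volume.restrict P.Ω), ∀ v : P.Lat, v ≠ 0 → x ∉ v +ᵥ P.Ω := by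
    refine ae_all_iff.2 fun v => ?_
    by_cases hv : v = 0
    · exact Eventually.of_forall fun x h => absurd hv h
    · have h2 : volume ((v +ᵥ P.Ω) ∩ P.Ω) = 0 := by
        have := P.cell'.aedisjoint hv
        simpa [Function.onFun, AEDisjoint, zero_vadd] using this
      have h3 : (volume.restrict P.Ω) (v +ᵥ P.Ω) = 0 := by
        rw [Measure.restrict_apply (P.measurableSet_Ω.const_vadd v), h2]
      filter_upwards [measure_eq_zero_iff_ae_notMem.1 h3] with x hx _ using hx
  filter_upwards [hΩ, hnull] with x hx hx'
  refine propext ⟨fun hxA => ?_, fun hxS => ?_⟩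
  · exact Set.mem_iUnion.2 ⟨0, x, ⟨hxA, hx⟩, zero_vadd _ _⟩
  · obtain ⟨v, hv⟩ := Set.mem_iUnion.1 hxS
    obtain ⟨a, ha, rfl⟩ := hv
    by_cases h0 : v = 0
    · subst h0
      change ((0 : P.Lat) +ᵥ a) ∈ A
      rw [zero_vadd]
      exact ha.1
    · exact absurd ⟨a, ha.2, rfl⟩ (hx' v h0)

lemma eq_zero_of_inner_fourierVec {u : P.H} (h : ∀ κ, inner ℂ (P.fourierVec κ) u = 0) :
    u = 0 := by
  have hu : Integrable (fun x => u x) (volume.restrict P.Ω) :=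
    (Lp.memLp u).integrable (by norm_num)
  have hint : ∀ g : C(UnitAddTorus (Fin 2), ℂ),
      Integrable (fun x => u x * g (P.toTorus x)) (volume.restrict P.Ω) := fun g =>
    hu.mul_bdd (g.continuous.comp P.continuous_toTorus).aestronglyMeasurable
      (Eventually.of_forall fun x => g.norm_coe_le_norm _)
  -- This functional vanishes on the exponentials, which span a dense subspace.
  let Φ : C(UnitAddTorus (Fin 2), ℂ) →L[ℂ] ℂ :=
    LinearMap.mkContinuous
      { toFun := fun g => ∫ x in P.Ω, u x * g (P.toTorus x)
        map_add' := fun g g' => by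
          rw [← integral_add (hint g) (hint g')]
          simp [mul_add]
        map_smul' := fun c g => by
          rw [RingHom.id_apply, smul_eq_mul, ← integral_const_mul]
          refine integral_congr_ae (Eventually.of_forall fun x => ?_)
          simp only [ContinuousMap.smul_apply, smul_eq_mul]
          ring } (∫ x in P.Ω, ‖u x‖)
      (fun g => by
        refine (norm_integral_le_integral_norm _).trans ?_
        rw [← integral_mul_const]
        refine integral_mono (hint g).norm (hu.norm.mul_const _) fun x => ?_
        simp only [norm_mul]
        exact mul_le_mul_of_nonneg_left (g.norm_coe_le_norm _) (norm_nonneg _))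
  have hΦ : ∀ g, Φ g = 0 := by
    have h1 : Submodule.span ℂ (Set.range (UnitAddTorus.mFourier (d := Fin 2))) ≤
        LinearMap.ker Φ.toLinearMap := by
      rw [Submodule.span_le]
      rintro _ ⟨κ, rfl⟩
      change ∫ x in P.Ω, u x * UnitAddTorus.mFourier κ (P.toTorus x) = 0
      simp_rw [mFourier_toTorus]
      have h2 := h (-κ)
      rw [inner_fourierVec] at h2
      have h3 : (((Real.sqrt (volume.real P.Ω))⁻¹ : ℝ) : ℂ) ≠ 0 := by
        exact_mod_cast (inv_pos.2 (Real.sqrt_pos.2 P.volume_real_Ω_pos)).ne'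
      rw [← (mul_eq_zero.1 h2).resolve_left h3]
      refine integral_congr_ae (Eventually.of_forall fun x => ?_)
      have h4 := P.expo_mul_conj 0 (-κ) x
      rw [expo_zero, one_mul, zero_sub, neg_neg] at h4
      simp only [h4]
    have h2 := Submodule.topologicalClosure_minimal _ h1 Φ.isClosed_ker
    rw [UnitAddTorus.span_mFourier_closure_eq_top] at h2
    exact fun g => h2 (Submodule.mem_top (x := g))
  have hreal : ∀ g : BoundedContinuousFunction (UnitAddTorus (Fin 2)) ℝ,
      ∫ x in P.Ω, u x * (g (P.toTorus x) : ℂ) = 0 := fun g =>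
    hΦ ⟨fun t => (g t : ℂ), Complex.continuous_ofReal.comp g.continuous⟩
  have hintr : ∀ g : BoundedContinuousFunction (UnitAddTorus (Fin 2)) ℝ,
      Integrable (fun x => u x * (g (P.toTorus x) : ℂ)) (volume.restrict P.Ω) := fun g =>
    hint ⟨fun t => (g t : ℂ), Complex.continuous_ofReal.comp g.continuous⟩
  have hre := P.ae_eq_zero_of_integral_toTorus (f := fun x => (u x).re) hu.re fun g => by
    have h1 := integral_re (hintr g)
    rw [hreal g] at h1
    simpa using h1
  have him := P.ae_eq_zero_of_integral_toTorus (f := fun x => (u x).im) hu.im fun g => by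
    have h1 := integral_im (hintr g)
    rw [hreal g] at h1
    simpa using h1
  refine Lp.ext ?_
  filter_upwards [hre, him, Lp.coeFn_zero ℂ 2 (volume.restrict P.Ω)] with x h1 h2 h3
  rw [h3]
  exact Complex.ext h1 h2

/-- The Fourier basis of `L²(Ω)`. -/
def fourierBasis : HilbertBasis (Fin 2 → ℤ) ℂ P.H :=
  HilbertBasis.mkOfOrthogonalEqBot P.orthonormal_fourierVec (by
    rw [Submodule.eq_bot_iff]
    intro u hu
    refine P.eq_zero_of_inner_fourierVec fun κ => ?_
    exact (Submodule.mem_orthogonal _ _).1 hu _ (Submodule.subset_span ⟨κ, rfl⟩))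

lemma fourierBasis_apply (κ : Fin 2 → ℤ) : P.fourierBasis κ = P.fourierVec κ :=
  congrFun (HilbertBasis.coe_mkOfOrthogonalEqBot _ _) κ

/-- The Fourier coefficients of an element of `L²(Ω)`. -/
def coef (u : P.H) (κ : Fin 2 → ℤ) : ℂ := P.fourierBasis.repr u κ

lemma coef_eq (u : P.H) (κ : Fin 2 → ℤ) : P.coef u κ = inner ℂ (P.fourierVec κ) u := by
  rw [coef, HilbertBasis.repr_apply_apply, fourierBasis_apply]

lemma ext_coef {u v : P.H} (h : ∀ κ, P.coef u κ = P.coef v κ) : u = v :=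
  P.fourierBasis.repr.injective (lp.ext (funext h))

end TMCrystal

namespace TMCrystal

variable {L : ℕ} (P : TMCrystal L)

/-! ### Fourier characterisation of the energy space -/

variable {P} in
lemma IsPeriodicTest.bound {ψ : Plane → ℂ} (hψ : P.IsPeriodicTest ψ) : ∃ C, ∀ x, ‖ψ x‖ ≤ C :=
  P.exists_bound_of_periodic hψ.smooth.continuous hψ.periodic

variable {P} in
lemma IsPeriodicTest.bound_partialDeriv {ψ : Plane → ℂ} (hψ : P.IsPeriodicTest ψ) (j : Fin 2) :
    ∃ C, ∀ x, ‖partialDeriv j ψ x‖ ≤ C :=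
  P.exists_bound_of_periodic (hψ.continuous_partialDeriv j) (hψ.periodic_partialDeriv j)

lemma hasDerivAt_line {ψ : Plane → ℂ} (hψ : Differentiable ℝ ψ) (j : Fin 2) (x : Plane) (t : ℝ) :
    HasDerivAt (fun t : ℝ => ψ (x + t • EuclideanSpace.single j 1))
      (partialDeriv j ψ (x + t • EuclideanSpace.single j 1)) t := by
  have h1 : HasDerivAt (fun t : ℝ => x + t • (EuclideanSpace.single j 1 : Plane))
      (EuclideanSpace.single j 1) t := by
    simpa using ((hasDerivAt_id t).smul_const (EuclideanSpace.single j 1 : Plane)).const_add x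
  exact (hψ _).hasFDerivAt.comp_hasDerivAt t h1

/-- The derivative of a periodic function has integral zero over the cell: differentiate the
constant function `t ↦ ∫ ψ (x + t e_j)`. -/
lemma integral_partialDeriv {ψ : Plane → ℂ} (hψ : P.IsPeriodicTest ψ) (j : Fin 2) :
    ∫ x in P.Ω, partialDeriv j ψ x = 0 := by
  obtain ⟨C₀, hC₀⟩ := hψ.bound
  obtain ⟨C, hC⟩ := hψ.bound_partialDeriv j
  have h := hasDerivAt_integral_of_dominated_loc_of_deriv_le (μ := volume.restrict P.Ω)
    (F := fun (t : ℝ) x => ψ (x + t • EuclideanSpace.single j 1))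
    (F' := fun (t : ℝ) x => partialDeriv j ψ (x + t • EuclideanSpace.single j 1))
    (x₀ := 0) (bound := fun _ => C) (s := Set.univ) univ_mem
    (Eventually.of_forall fun t => (hψ.smooth.continuous.comp
      (continuous_add_const (t • EuclideanSpace.single j (1 : ℝ)))).aestronglyMeasurable)
    (Integrable.of_bound (hψ.smooth.continuous.comp
      (continuous_add_const ((0 : ℝ) • EuclideanSpace.single j (1 : ℝ)))).aestronglyMeasurable C₀
      (Eventually.of_forall fun x => hC₀ _))
    ((hψ.continuous_partialDeriv j).comp
      (continuous_add_const ((0 : ℝ) • EuclideanSpace.single j (1 : ℝ)))).aestronglyMeasurable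
    (Eventually.of_forall fun x t _ => hC _) (integrable_const C)
    (Eventually.of_forall fun x t _ =>
      hasDerivAt_line (hψ.smooth.differentiable (by simp)) j x t)
  have h2 := h.2
  simp_rw [P.setIntegral_translate hψ.periodic] at h2
  have h3 := h2.unique (hasDerivAt_const (0 : ℝ) _)
  simpa using h3

variable {P} in
lemma IsPeriodicTest.mul {φ ψ : Plane → ℂ} (hφ : P.IsPeriodicTest φ) (hψ : P.IsPeriodicTest ψ) :
    P.IsPeriodicTest (fun x => φ x * ψ x) :=
  ⟨hφ.smooth.mul hψ.smooth, fun i x => by simp only [hφ.periodic, hψ.periodic]⟩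

variable {P} in
lemma IsPeriodicTest.integral_by_parts {φ ψ : Plane → ℂ} (hφ : P.IsPeriodicTest φ)
    (hψ : P.IsPeriodicTest ψ) (j : Fin 2) :
    ∫ x in P.Ω, ψ x * partialDeriv j φ x = -∫ x in P.Ω, partialDeriv j ψ x * φ x := by
  have h := P.integral_partialDeriv (hψ.mul hφ) j
  have h1 : ∀ x, partialDeriv j (fun x => ψ x * φ x) x =
      ψ x * partialDeriv j φ x + partialDeriv j ψ x * φ x := by
    intro x
    have e1 := (hψ.smooth.differentiable (by simp) x).hasFDerivAt
    have e2 := (hφ.smooth.differentiable (by simp) x).hasFDerivAt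
    have e3 := (e1.mul e2).fderiv
    rw [partialDeriv]
    change fderiv ℝ (ψ * φ) x _ = _
    rw [e3]
    simp only [add_apply, smul_apply, smul_eq_mul, partialDeriv]
    ring
  simp_rw [h1] at h
  have intg : ∀ f g : Plane → ℂ, Continuous f → Continuous g → (∃ C, ∀ x, ‖f x‖ ≤ C) →
      (∃ C, ∀ x, ‖g x‖ ≤ C) → Integrable (fun x => f x * g x) (volume.restrict P.Ω) := by
    rintro f g hf hg ⟨C, hC⟩ ⟨C', hC'⟩
    exact (Integrable.of_bound hf.aestronglyMeasurable C (Eventually.of_forall hC)).mul_bdd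
      hg.aestronglyMeasurable (Eventually.of_forall hC')
  rw [integral_add (intg _ _ hψ.smooth.continuous (hφ.continuous_partialDeriv j) hψ.bound
    (hφ.bound_partialDeriv j)) (intg _ _ (hψ.continuous_partialDeriv j) hφ.smooth.continuous
    (hψ.bound_partialDeriv j) hφ.bound)] at h
  exact eq_neg_of_add_eq_zero_left h

/-- A smooth periodic function as an element of `V`. -/
def ofTest {ψ : Plane → ℂ} (hψ : P.IsPeriodicTest ψ) : P.V :=
  ⟨(P.toH ψ hψ.smooth.continuous hψ.periodic,
    fun j => P.toH (partialDeriv j ψ) (hψ.continuous_partialDeriv j)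
      (hψ.periodic_partialDeriv j)), fun φ hφ j => by
    have h := hφ.integral_by_parts hψ j
    have h1 : ∫ x in P.Ω, P.toH ψ hψ.smooth.continuous hψ.periodic x * partialDeriv j φ x =
        ∫ x in P.Ω, ψ x * partialDeriv j φ x := by
      refine integral_congr_ae ?_
      filter_upwards [P.coeFn_toH ψ hψ.smooth.continuous hψ.periodic] with x hx
      rw [hx]
    have h2 : ∫ x in P.Ω, P.toH (partialDeriv j ψ) (hψ.continuous_partialDeriv j)
        (hψ.periodic_partialDeriv j) x * φ x = ∫ x in P.Ω, partialDeriv j ψ x * φ x := by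
      refine integral_congr_ae ?_
      filter_upwards [P.coeFn_toH (partialDeriv j ψ) (hψ.continuous_partialDeriv j)
        (hψ.periodic_partialDeriv j)] with x hx
      rw [hx]
    exact h1.trans (h.trans (congrArg Neg.neg h2.symm))⟩

lemma fn_ofTest {ψ : Plane → ℂ} (hψ : P.IsPeriodicTest ψ) :
    fn (P.ofTest hψ) = P.toH ψ hψ.smooth.continuous hψ.periodic := rfl

lemma grad_ofTest {ψ : Plane → ℂ} (hψ : P.IsPeriodicTest ψ) (j : Fin 2) :
    grad (P.ofTest hψ) j = P.toH (partialDeriv j ψ) (hψ.continuous_partialDeriv j)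
      (hψ.periodic_partialDeriv j) := rfl

lemma coef_grad (u : P.V) (j : Fin 2) (κ : Fin 2 → ℤ) :
    P.coef (grad u j) κ = Complex.I * P.freq κ j * P.coef (fn u) κ := by
  rw [coef_eq, coef_eq, inner_fourierVec, inner_fourierVec]
  have h := u.2 _ (P.isPeriodicTest_expo (-κ)) j
  have e : ∀ x, conj (P.expo κ x) = P.expo (-κ) x := by
    intro x
    have := P.expo_mul_conj 0 κ x
    rwa [expo_zero, one_mul, zero_sub] at this
  have e2 : P.freq (-κ) j = -P.freq κ j := by
    rw [freq, freq, ← zero_sub κ, phase_sub, P.phase_apply 0]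
    simp
  simp_rw [partialDeriv_expo, e2] at h
  simp_rw [e]
  have h2 : ∀ x, u.1.1 x * (((-P.freq κ j : ℝ) : ℂ) * Complex.I * P.expo (-κ) x) =
      (-(Complex.I * P.freq κ j)) * (fn u x * P.expo (-κ) x) := by
    intro x
    rw [fn]
    push_cast
    ring
  simp_rw [h2] at h
  rw [integral_const_mul] at h
  change _ = -∫ x in P.Ω, grad u j x * P.expo (-κ) x at h
  linear_combination ((((Real.sqrt (volume.real P.Ω))⁻¹ : ℝ) : ℂ)) * h

lemma hasSum_coef (u v : P.H) :
    HasSum (fun κ => conj (P.coef v κ) * P.coef u κ) (inner ℂ v u) := by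
  have h := P.fourierBasis.hasSum_inner_mul_inner v u
  have h1 : (fun κ => inner ℂ v (P.fourierBasis κ) * inner ℂ (P.fourierBasis κ) u) =
      fun κ => conj (P.coef v κ) * P.coef u κ := by
    funext κ
    rw [coef_eq, coef_eq, fourierBasis_apply, inner_conj_symm]
  rwa [h1] at h

lemma hasSum_norm_sq_coef (u : P.H) : HasSum (fun κ => ‖P.coef u κ‖ ^ 2) (‖u‖ ^ 2) := by
  have h := P.hasSum_coef u u
  rw [inner_self_eq_norm_sq_to_K] at h
  have h1 : (fun κ => conj (P.coef u κ) * P.coef u κ) =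
      fun κ => ((‖P.coef u κ‖ ^ 2 : ℝ) : ℂ) := by
    funext κ
    rw [mul_comm, Complex.mul_conj, Complex.normSq_eq_norm_sq]
  rw [h1] at h
  refine Complex.hasSum_ofReal.1 ?_
  convert h using 1
  simp

/-- An element of `L²(Ω)` whose Fourier coefficients, multiplied by the frequencies, are those of
functions in `L²(Ω)` belongs to `V`. -/
def mkV (u : P.H) (g : Fin 2 → P.H)
    (h : ∀ j κ, P.coef (g j) κ = Complex.I * P.freq κ j * P.coef u κ) : P.V :=
  ⟨(u, g), fun φ hφ j => by
    have hc : P.IsPeriodicTest fun x => conj (φ x) :=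
      ⟨Complex.conjCLE.contDiff.comp hφ.smooth, fun i x => by simp only [hφ.periodic]⟩
    have hd : ∀ x, partialDeriv j (fun x => conj (φ x)) x = conj (partialDeriv j φ x) := by
      intro x
      have e1 := (hφ.smooth.differentiable (by simp) x).hasFDerivAt
      have e2 : HasFDerivAt (fun x => conj (φ x)) _ x := Complex.conjCLE.hasFDerivAt.comp x e1
      rw [partialDeriv, e2.fderiv]
      rfl
    have h1 := P.hasSum_coef u (grad (P.ofTest hc) j)
    have h2 := (P.hasSum_coef (g j) (fn (P.ofTest hc))).neg
    have h3 : (fun κ => conj (P.coef (grad (P.ofTest hc) j) κ) * P.coef u κ) =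
        fun κ => -(conj (P.coef (fn (P.ofTest hc)) κ) * P.coef (g j) κ) := by
      funext κ
      rw [coef_grad, h, map_mul, map_mul, Complex.conj_I, Complex.conj_ofReal]
      ring
    rw [h3] at h1
    have h4 := h1.unique h2
    rw [grad_ofTest, fn_ofTest, inner_toH, inner_toH] at h4
    simp_rw [hd, Complex.conj_conj] at h4
    exact h4⟩

lemma coef_add (u v : P.H) (κ : Fin 2 → ℤ) : P.coef (u + v) κ = P.coef u κ + P.coef v κ := by
  simp_rw [coef_eq, inner_add_right]

lemma coef_sub (u v : P.H) (κ : Fin 2 → ℤ) : P.coef (u - v) κ = P.coef u κ - P.coef v κ := by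
  simp_rw [coef_eq, inner_sub_right]

lemma coef_smul (c : ℂ) (u : P.H) (κ : Fin 2 → ℤ) : P.coef (c • u) κ = c * P.coef u κ := by
  simp_rw [coef_eq, inner_smul_right]

lemma coef_zero (κ : Fin 2 → ℤ) : P.coef 0 κ = 0 := by
  rw [coef_eq, inner_zero_right]

lemma coef_sum {ι : Type*} (s : Finset ι) (f : ι → P.H) (κ : Fin 2 → ℤ) :
    P.coef (∑ i ∈ s, f i) κ = ∑ i ∈ s, P.coef (f i) κ := by
  simp_rw [coef_eq, inner_sum]

lemma coef_fourierVec (κ κ' : Fin 2 → ℤ) :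
    P.coef (P.fourierVec κ') κ = if κ = κ' then 1 else 0 := by
  rw [coef_eq, orthonormal_iff_ite.1 P.orthonormal_fourierVec]

/-- The gradient of an element of `V` is determined by its underlying function. -/
lemma fn_injective {u v : P.V} (h : fn u = fn v) : u = v :=
  P.ext_V h fun j => P.ext_coef fun κ => by rw [coef_grad, coef_grad, h]

/-- The normalised exponentials as elements of `V`. -/
def expoV (κ : Fin 2 → ℤ) : P.V :=
  P.mkV (P.fourierVec κ) (fun j => (Complex.I * P.freq κ j) • P.fourierVec κ) fun j κ' => by
    rw [coef_smul, coef_fourierVec]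
    split_ifs with h
    · rw [h]
    · simp

lemma fn_expoV (κ : Fin 2 → ℤ) : fn (P.expoV κ) = P.fourierVec κ := rfl

lemma grad_expoV (κ : Fin 2 → ℤ) (j : Fin 2) :
    grad (P.expoV κ) j = (Complex.I * P.freq κ j) • P.fourierVec κ := rfl

lemma freq_eq_sum (κ : Fin 2 → ℤ) (x : Plane) :
    2 * Real.pi * P.phase κ x = ∑ j, x j * P.freq κ j := by
  have hx : x = ∑ j, x j • (EuclideanSpace.single j 1 : Plane) := by
    have := (EuclideanSpace.basisFun (Fin 2) ℝ).sum_repr x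
    simpa using this.symm
  conv_lhs => rw [hx]
  rw [map_sum, Finset.mul_sum]
  refine Finset.sum_congr rfl fun j _ => ?_
  rw [map_smul, freq, smul_eq_mul]
  ring

lemma freq_injective {κ κ' : Fin 2 → ℤ} (h : ∀ j, P.freq κ j = P.freq κ' j) : κ = κ' := by
  funext i
  have h1 := P.freq_eq_sum κ (P.period i)
  have h2 := P.freq_eq_sum κ' (P.period i)
  simp_rw [h] at h1
  rw [← h2, phase_period, phase_period] at h1
  have h3 := mul_left_cancel₀ (by positivity : (2 * Real.pi) ≠ 0) h1
  exact_mod_cast h3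

lemma finite_freq_le (R : ℝ) : {κ : Fin 2 → ℤ | ∀ j, |P.freq κ j| ≤ R}.Finite := by
  have hb : ∀ i, ∃ N : ℤ, ∀ κ : Fin 2 → ℤ, (∀ j, |P.freq κ j| ≤ R) → |κ i| ≤ N := by
    intro i
    obtain ⟨N, hN⟩ := exists_nat_ge ((∑ j, |P.period i j| * R) / (2 * Real.pi))
    refine ⟨N, fun κ hκ => ?_⟩
    have h1 := P.freq_eq_sum κ (P.period i)
    rw [phase_period] at h1
    have h2 : 2 * Real.pi * |(κ i : ℝ)| ≤ ∑ j, |P.period i j| * R := by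
      calc 2 * Real.pi * |(κ i : ℝ)| = |2 * Real.pi * (κ i : ℝ)| := by
            rw [abs_mul, abs_of_pos (by positivity : (0 : ℝ) < 2 * Real.pi)]
        _ ≤ ∑ j, |P.period i j * P.freq κ j| := by
            rw [h1]; exact Finset.abs_sum_le_sum_abs _ _
        _ ≤ ∑ j, |P.period i j| * R := Finset.sum_le_sum fun j _ => by
            rw [abs_mul]; exact mul_le_mul_of_nonneg_left (hκ j) (abs_nonneg _)
    have h3 : |(κ i : ℝ)| ≤ N := by
      refine le_trans ?_ hN
      rw [le_div_iff₀ (by positivity)]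
      linarith
    exact_mod_cast h3
  choose N hN using hb
  refine (Set.Finite.pi' fun i => Set.finite_Icc (-N i) (N i)).subset fun κ hκ i => ?_
  exact abs_le.1 (hN i κ hκ)

/-! ### Compactness of the embedding -/

/-- The truncation of Fourier series to a finite set of frequencies. -/
def truncation (S : Finset (Fin 2 → ℤ)) : P.H →L[ℂ] P.H :=
  ∑ κ ∈ S, (innerSL ℂ (P.fourierVec κ)).smulRight (P.fourierVec κ)

lemma truncation_apply (S : Finset (Fin 2 → ℤ)) (u : P.H) :
    P.truncation S u = ∑ κ ∈ S, P.coef u κ • P.fourierVec κ := by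
  simp [truncation, coef_eq]

open Classical in
lemma coef_truncation (S : Finset (Fin 2 → ℤ)) (u : P.H) (κ : Fin 2 → ℤ) :
    P.coef (P.truncation S u) κ = if κ ∈ S then P.coef u κ else 0 := by
  rw [truncation_apply, coef_sum]
  simp_rw [coef_smul, coef_fourierVec, mul_ite, mul_one, mul_zero]
  rw [Finset.sum_ite_eq]

lemma isCompactOperator_truncation (S : Finset (Fin 2 → ℤ)) :
    IsCompactOperator (P.truncation S) := by
  have h : P.truncation S ∈ compactOperator (RingHom.id ℂ) P.H P.H := by
    refine Submodule.sum_mem _ fun κ _ => ?_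
    have h1 : IsCompactOperator (ContinuousLinearMap.toSpanSingleton ℂ (P.fourierVec κ)) :=
      isCompactOperator_of_locallyCompactSpace_rng _
    exact h1.comp_clm (innerSL ℂ (P.fourierVec κ))
  exact h

/-- High frequencies of elements of `V` are controlled by the gradient. -/
lemma norm_sub_truncation_le {R : ℝ} (hR : 0 < R) (u : P.V) :
    ‖fn u - P.truncation (P.finite_freq_le R).toFinset (fn u)‖ ≤ 2 * ‖u‖ / R := by
  set v := fn u - P.truncation (P.finite_freq_le R).toFinset (fn u) with hv
  have h0 := P.hasSum_norm_sq_coef v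
  have h1 := (P.hasSum_norm_sq_coef (grad u 0)).add (P.hasSum_norm_sq_coef (grad u 1))
  have h2 := hasSum_le (fun κ => ?_) (h0.mul_left (R ^ 2)) h1
  · have hg : ∀ j, ‖grad u j‖ ≤ ‖u‖ := fun j =>
      (norm_le_pi_norm u.1.2 j).trans (le_max_right _ _)
    have hg0 := pow_le_pow_left₀ (norm_nonneg _) (hg 0) 2
    have hg1 := pow_le_pow_left₀ (norm_nonneg _) (hg 1) 2
    rw [le_div_iff₀ hR]
    refine (abs_le_of_sq_le_sq' (b := 2 * ‖u‖) ?_ (by positivity)).2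
    nlinarith [sq_nonneg ‖u‖]
  · rw [hv, coef_sub, coef_truncation]
    split_ifs with hκ
    · rw [sub_self, norm_zero, zero_pow two_ne_zero, mul_zero]; positivity
    · have : ∃ j, R < |P.freq κ j| := by
        by_contra! hcon
        exact hκ ((P.finite_freq_le R).mem_toFinset.2 hcon)
      obtain ⟨j, hj⟩ := this
      have hj2 : R ^ 2 ≤ P.freq κ j ^ 2 := by
        rw [← sq_abs (P.freq κ j)]
        exact pow_le_pow_left₀ hR.le hj.le 2
      have hjs : P.freq κ j ^ 2 ≤ P.freq κ 0 ^ 2 + P.freq κ 1 ^ 2 := by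
        fin_cases j
        · simpa using sq_nonneg (P.freq κ 1)
        · simpa using sq_nonneg (P.freq κ 0)
      rw [sub_zero, coef_grad, coef_grad]
      simp only [norm_mul, Complex.norm_I, one_mul, Complex.norm_real, mul_pow, Real.norm_eq_abs,
        sq_abs]
      rw [← add_mul]
      exact mul_le_mul_of_nonneg_right (hj2.trans hjs) (sq_nonneg _)

/-- Rellich's theorem: `V` is compactly embedded in `L²(Ω)`. -/
theorem isCompactOperator_emb : IsCompactOperator P.emb := by
  refine isCompactOperator_of_tendsto (l := (atTop : Filter ℕ))
    (F := fun n => (P.truncation (P.finite_freq_le ((n : ℝ) + 1)).toFinset).comp P.emb) ?_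
    (Eventually.of_forall fun n => (P.isCompactOperator_truncation _).comp_clm _)
  rw [tendsto_iff_norm_sub_tendsto_zero]
  refine squeeze_zero (fun _ => norm_nonneg _) (g := fun n : ℕ => 2 * (1 / ((n : ℝ) + 1))) ?_ ?_
  · intro n
    refine ContinuousLinearMap.opNorm_le_bound _ (by positivity) fun u => ?_
    rw [sub_apply, norm_sub_rev]
    refine (P.norm_sub_truncation_le (by positivity : (0 : ℝ) < (n : ℝ) + 1) u).trans_eq ?_
    ring
  · simpa using (tendsto_one_div_add_atTop_nhds_zero_nat (𝕜 := ℝ)).const_mul 2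

/-- Bounded sequences in `V` have subsequences that converge in `L²(Ω)`. -/
lemma exists_subseq_tendsto_of_bounded {u : ℕ → P.V} {C : ℝ} (hu : ∀ n, ‖u n‖ ≤ C) :
    ∃ (v : P.H) (s : ℕ → ℕ), StrictMono s ∧ Tendsto (fun n => fn (u (s n))) atTop (𝓝 v) := by
  obtain ⟨K, hK, hKsub⟩ := P.isCompactOperator_emb.image_closedBall_subset_compact (𝕜₁ := ℂ) C
  obtain ⟨v, _, s, hs, hlim⟩ := hK.tendsto_subseq (x := fun n => fn (u n)) fun n =>
    hKsub ⟨u n, by simpa using hu n, rfl⟩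
  exact ⟨v, s, hs, hlim⟩

end TMCrystal

namespace TMCrystal

variable {L : ℕ} (P : TMCrystal L)

/-! ### Weak gradients vanish on level sets -/

/-- A bounded smooth map of the complex plane whose real differential is the identity at `0`
and decays at infinity. -/
def damp (z : ℂ) : ℂ := z / (1 + z * conj z)

/-- The real differential of `damp` at `z` in the direction `h`. -/
def dampDeriv (z h : ℂ) : ℂ :=
  h / (1 + z * conj z) - z * (h * conj z + z * conj h) / (1 + z * conj z) ^ 2

lemma one_add_mul_conj (z : ℂ) : 1 + z * conj z = ((1 + ‖z‖ ^ 2 : ℝ) : ℂ) := by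
  rw [Complex.mul_conj, Complex.normSq_eq_norm_sq]
  push_cast
  rfl

lemma norm_one_add_mul_conj (z : ℂ) : ‖1 + z * conj z‖ = 1 + ‖z‖ ^ 2 := by
  rw [one_add_mul_conj, Complex.norm_real, Real.norm_of_nonneg (by positivity)]

lemma one_add_mul_conj_ne_zero (z : ℂ) : 1 + z * conj z ≠ 0 := by
  rw [← norm_ne_zero_iff, norm_one_add_mul_conj]
  positivity

lemma norm_damp_le (z : ℂ) : ‖damp z‖ ≤ 1 := by
  rw [damp, norm_div, norm_one_add_mul_conj, div_le_one (by positivity)]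
  nlinarith [sq_nonneg (‖z‖ - 1), norm_nonneg z]

lemma norm_dampDeriv_le (z h : ℂ) : ‖dampDeriv z h‖ ≤ 3 * ‖h‖ / (1 + ‖z‖ ^ 2) := by
  have hz : 0 < 1 + ‖z‖ ^ 2 := by positivity
  have h1 : ‖h * conj z + z * conj h‖ ≤ 2 * (‖h‖ * ‖z‖) := by
    refine (norm_add_le _ _).trans_eq ?_
    rw [norm_mul, norm_mul, RCLike.norm_conj, RCLike.norm_conj]
    ring
  refine (norm_sub_le _ _).trans ?_
  rw [norm_div, norm_div, norm_mul, norm_pow, norm_one_add_mul_conj]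
  have h2 : ‖z‖ * ‖h * conj z + z * conj h‖ / (1 + ‖z‖ ^ 2) ^ 2 ≤ 2 * ‖h‖ / (1 + ‖z‖ ^ 2) := by
    rw [div_le_div_iff₀ (by positivity) hz]
    have h3 : ‖z‖ * ‖h * conj z + z * conj h‖ ≤ 2 * ‖h‖ * (1 + ‖z‖ ^ 2) := by
      nlinarith [mul_le_mul_of_nonneg_left h1 (norm_nonneg z), norm_nonneg h]
    calc _ ≤ (2 * ‖h‖ * (1 + ‖z‖ ^ 2)) * (1 + ‖z‖ ^ 2) :=
          mul_le_mul_of_nonneg_right h3 hz.le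
      _ = _ := by ring
  calc _ ≤ ‖h‖ / (1 + ‖z‖ ^ 2) + 2 * ‖h‖ / (1 + ‖z‖ ^ 2) := by gcongr
    _ = _ := by ring

lemma norm_dampDeriv_le' (z h : ℂ) : ‖dampDeriv z h‖ ≤ 3 * ‖h‖ := by
  refine (norm_dampDeriv_le z h).trans (div_le_self (by positivity) ?_)
  nlinarith [sq_nonneg ‖z‖]

lemma dampDeriv_sub (z h h' : ℂ) : dampDeriv z (h - h') = dampDeriv z h - dampDeriv z h' := by
  simp only [dampDeriv, map_sub]
  ring

lemma dampDeriv_real_mul (z h : ℂ) (c : ℝ) : dampDeriv z (c * h) = c * dampDeriv z h := by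
  simp only [dampDeriv, map_mul, Complex.conj_ofReal]
  ring

lemma dampDeriv_zero (h : ℂ) : dampDeriv 0 h = h := by simp [dampDeriv]

lemma continuous_damp : Continuous damp :=
  Continuous.div continuous_id
    (continuous_const.add (continuous_id.mul Complex.continuous_conj)) one_add_mul_conj_ne_zero

lemma continuous_dampDeriv : Continuous fun p : ℂ × ℂ => dampDeriv p.1 p.2 := by
  have h1 : Continuous fun p : ℂ × ℂ => conj p.1 := Complex.continuous_conj.comp continuous_fst
  have h2 : Continuous fun p : ℂ × ℂ => conj p.2 := Complex.continuous_conj.comp continuous_snd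
  have h3 : Continuous fun p : ℂ × ℂ => 1 + p.1 * conj p.1 :=
    continuous_const.add (continuous_fst.mul h1)
  refine Continuous.sub (continuous_snd.div h3 fun p => one_add_mul_conj_ne_zero _) ?_
  exact Continuous.div (continuous_fst.mul ((continuous_snd.mul h1).add (continuous_fst.mul h2)))
    (h3.pow 2) fun p => pow_ne_zero 2 (one_add_mul_conj_ne_zero _)

variable {P} in
lemma IsPeriodicTest.damp {ψ : Plane → ℂ} (hψ : P.IsPeriodicTest ψ) :
    P.IsPeriodicTest fun x => damp (ψ x) := by
  refine ⟨?_, fun i x => by simp only [hψ.periodic]⟩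
  have h1 : ContDiff ℝ ∞ fun x => 1 + ψ x * conj (ψ x) :=
    contDiff_const.add (hψ.smooth.mul (Complex.conjCLE.contDiff.comp hψ.smooth))
  have h2 := hψ.smooth.mul (h1.inv fun x => one_add_mul_conj_ne_zero _)
  have h3 : (fun x => TMCrystal.damp (ψ x)) = fun x => ψ x * (1 + ψ x * conj (ψ x))⁻¹ := by
    funext x
    rw [TMCrystal.damp, div_eq_mul_inv]
  rw [h3]
  exact h2

lemma partialDeriv_damp {ψ : Plane → ℂ} (hψ : P.IsPeriodicTest ψ) (j : Fin 2) (x : Plane) :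
    partialDeriv j (fun x => damp (ψ x)) x = dampDeriv (ψ x) (partialDeriv j ψ x) := by
  have h1 := hasDerivAt_line (hψ.smooth.differentiable (by simp)) j x 0
  have h2 := hasDerivAt_line (hψ.damp.smooth.differentiable (by simp)) j x 0
  have h3 : HasDerivAt (fun t : ℝ => conj (ψ (x + t • EuclideanSpace.single j 1)))
      (conj (partialDeriv j ψ (x + (0 : ℝ) • EuclideanSpace.single j 1))) 0 :=
    Complex.conjCLE.hasFDerivAt.comp_hasDerivAt 0 h1
  have h4 := h1.div ((h1.mul h3).const_add 1) (one_add_mul_conj_ne_zero _)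
  have h5 := h2.unique h4
  simp only [zero_smul, add_zero, Pi.mul_apply] at h5
  rw [h5, dampDeriv]
  have := one_add_mul_conj_ne_zero (ψ x)
  field_simp

lemma hasSum_expoV (u : P.V) : HasSum (fun κ => P.coef (fn u) κ • P.expoV κ) u := by
  have h : ∀ w : P.H, HasSum (fun κ => P.coef w κ • P.fourierVec κ) w := by
    intro w
    have := P.fourierBasis.hasSum_repr w
    simp_rw [fourierBasis_apply] at this
    exact this
  refine (Topology.IsInducing.hasSum_iff (g := P.V.subtype)
    Topology.IsInducing.subtypeVal _ _).1 ?_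
  refine (h (fn u)).prodMk (Pi.hasSum.2 fun j => ?_)
  have h2 := h (grad u j)
  simp_rw [coef_grad] at h2
  have h3 : (fun κ => (Complex.I * P.freq κ j * P.coef (fn u) κ) • P.fourierVec κ) =
      fun κ => P.coef (fn u) κ • (Complex.I * P.freq κ j) • P.fourierVec κ := by
    funext κ
    rw [smul_smul, mul_comm]
  rw [h3] at h2
  exact h2

lemma fn_smul (c : ℂ) (u : P.V) : fn (c • u) = c • fn u := rfl

/-- An element of `V` that is represented by a smooth periodic function. -/
lemma eq_ofTest {ψ : Plane → ℂ} (hψ : P.IsPeriodicTest ψ) {u : P.V}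
    (hu : fn u =ᵐ[volume.restrict P.Ω] ψ) : u = P.ofTest hψ := by
  refine P.fn_injective (Lp.ext ?_)
  rw [fn_ofTest]
  filter_upwards [hu, P.coeFn_toH ψ hψ.smooth.continuous hψ.periodic] with x h1 h2
  rw [h1, h2]

lemma coeFn_ofTest {ψ : Plane → ℂ} (hψ : P.IsPeriodicTest ψ) :
    fn (P.ofTest hψ) =ᵐ[volume.restrict P.Ω] ψ :=
  P.coeFn_toH ψ hψ.smooth.continuous hψ.periodic

/-- The smooth periodic functions as a subspace of `V`. -/
def testSubmodule : Submodule ℂ P.V where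
  carrier := {v | ∃ (ψ : Plane → ℂ) (hψ : P.IsPeriodicTest ψ), v = P.ofTest hψ}
  zero_mem' := by
    have h : P.IsPeriodicTest fun _ => 0 := ⟨contDiff_const, fun _ _ => rfl⟩
    exact ⟨_, h, P.eq_ofTest h (Lp.coeFn_zero ℂ 2 (volume.restrict P.Ω))⟩
  add_mem' := by
    rintro _ _ ⟨ψ, hψ, rfl⟩ ⟨φ, hφ, rfl⟩
    have h : P.IsPeriodicTest fun x => ψ x + φ x :=
      ⟨hψ.smooth.add hφ.smooth, fun i x => by simp only [hψ.periodic, hφ.periodic]⟩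
    refine ⟨_, h, P.eq_ofTest h ?_⟩
    filter_upwards [Lp.coeFn_add (fn (P.ofTest hψ)) (fn (P.ofTest hφ)),
      P.coeFn_ofTest hψ, P.coeFn_ofTest hφ] with x h1 h2 h3
    exact h1.trans (congrArg₂ (· + ·) h2 h3)
  smul_mem' := by
    rintro c _ ⟨ψ, hψ, rfl⟩
    have h : P.IsPeriodicTest fun x => c * ψ x :=
      ⟨contDiff_const.mul hψ.smooth, fun i x => by simp only [hψ.periodic]⟩
    refine ⟨_, h, P.eq_ofTest h ?_⟩
    filter_upwards [Lp.coeFn_smul c (fn (P.ofTest hψ)), P.coeFn_ofTest hψ] with x h1 h2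
    exact h1.trans (congrArg (c * ·) h2)

lemma expoV_mem_testSubmodule (κ : Fin 2 → ℤ) : P.expoV κ ∈ P.testSubmodule := by
  have h : P.expoV κ = (((Real.sqrt (volume.real P.Ω))⁻¹ : ℝ) : ℂ) •
      P.ofTest (P.isPeriodicTest_expo κ) := by
    refine P.fn_injective ?_
    rw [fn_smul, fn_expoV, fourierVec, fn_ofTest]
  rw [h]
  exact P.testSubmodule.smul_mem _ ⟨_, _, rfl⟩

/-- Every element of `V` is a limit of smooth periodic functions. -/
lemma exists_seq_ofTest (u : P.V) : ∃ (ψ : ℕ → Plane → ℂ) (hψ : ∀ n, P.IsPeriodicTest (ψ n)),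
    Tendsto (fun n => P.ofTest (hψ n)) atTop (𝓝 u) := by
  have h : u ∈ closure (P.testSubmodule : Set P.V) :=
    mem_closure_of_tendsto (P.hasSum_expoV u) (Eventually.of_forall fun S =>
      P.testSubmodule.sum_mem fun κ _ =>
        P.testSubmodule.smul_mem _ (P.expoV_mem_testSubmodule κ))
  obtain ⟨v, hv, hlim⟩ := mem_closure_iff_seq_limit.1 h
  choose ψ hψ hvψ using hv
  refine ⟨ψ, hψ, ?_⟩
  simp_rw [← hvψ]
  exact hlim

lemma integrable_coe (u : P.H) : Integrable (fun x => u x) (volume.restrict P.Ω) :=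
  (Lp.memLp u).integrable (by norm_num)

lemma integral_norm_le (u : P.H) :
    ∫ x in P.Ω, ‖u x‖ ≤ ‖u‖ * (volume P.Ω ^ (1 / 2 : ℝ)).toReal := by
  have h := eLpNorm_le_eLpNorm_mul_rpow_measure_univ (μ := volume.restrict P.Ω)
    (p := 1) (q := 2) (by norm_num) (Lp.aestronglyMeasurable u)
  rw [eLpNorm_one_eq_lintegral_enorm, Measure.restrict_apply_univ] at h
  rw [integral_norm_eq_lintegral_enorm (Lp.aestronglyMeasurable u), Lp.norm_def,
    ← ENNReal.toReal_mul]
  have h2 : (1 / ENNReal.toReal 1 - 1 / ENNReal.toReal 2 : ℝ) = 1 / 2 := by norm_num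
  rw [h2] at h
  refine ENNReal.toReal_mono (ENNReal.mul_ne_top (Lp.eLpNorm_ne_top u) ?_) h
  exact ENNReal.rpow_ne_top_of_nonneg (by norm_num) P.volume_Ω_lt_top.ne

/-- The chain rule for `damp` in `V`, by approximation with smooth functions. -/
lemma integral_damp (u : P.V) {φ : Plane → ℂ} (hφ : P.IsPeriodicTest φ) (j : Fin 2) :
    ∫ x in P.Ω, damp (fn u x) * partialDeriv j φ x =
      -∫ x in P.Ω, dampDeriv (fn u x) (grad u j x) * φ x := by
  obtain ⟨ψ, hψ, hlim⟩ := P.exists_seq_ofTest u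
  have hfn : Tendsto (fun n => fn (P.ofTest (hψ n))) atTop (𝓝 (fn u)) :=
    (P.emb.continuous.tendsto u).comp hlim
  have hgr : Tendsto (fun n => grad (P.ofTest (hψ n)) j) atTop (𝓝 (grad u j)) := by
    have : Continuous fun v : P.V => grad v j :=
      (continuous_apply j).comp (continuous_snd.comp continuous_subtype_val)
    exact (this.tendsto u).comp hlim
  obtain ⟨s, hs, hae⟩ := (tendstoInMeasure_of_tendsto_Lp hfn).exists_seq_tendsto_ae
  obtain ⟨C, hC⟩ := hφ.bound
  obtain ⟨C', hC'⟩ := hφ.bound_partialDeriv j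
  have hC0 : 0 ≤ C := (norm_nonneg _).trans (hC 0)
  have meas : ∀ w : P.H, AEStronglyMeasurable (fun x => w x) (volume.restrict P.Ω) :=
    fun w => Lp.aestronglyMeasurable w
  have measD : ∀ w g : P.H, AEStronglyMeasurable (fun x => dampDeriv (w x) (g x) * φ x)
      (volume.restrict P.Ω) := fun w g =>
    (continuous_dampDeriv.comp_aestronglyMeasurable ((meas w).prodMk (meas g))).mul
      hφ.smooth.continuous.aestronglyMeasurable
  have boundD : ∀ (w g : P.H) (x : Plane), ‖dampDeriv (w x) (g x) * φ x‖ ≤ 3 * C * ‖g x‖ := by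
    intro w g x
    rw [norm_mul]
    calc _ ≤ (3 * ‖g x‖) * C :=
          mul_le_mul (norm_dampDeriv_le' _ _) (hC x) (norm_nonneg _) (by positivity)
      _ = _ := by ring
  have intD : ∀ w g : P.H, Integrable (fun x => dampDeriv (w x) (g x) * φ x)
      (volume.restrict P.Ω) := fun w g =>
    ((P.integrable_coe g).norm.const_mul (3 * C)).mono' (measD w g)
      (Eventually.of_forall (boundD w g))
  have hn : ∀ n, ∫ x in P.Ω, damp (fn (P.ofTest (hψ (s n))) x) * partialDeriv j φ x =
      -∫ x in P.Ω, dampDeriv (fn (P.ofTest (hψ (s n))) x) (grad (P.ofTest (hψ (s n))) j x)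
        * φ x := by
    intro n
    have h1 := hφ.integral_by_parts (hψ (s n)).damp j
    simp_rw [P.partialDeriv_damp (hψ (s n))] at h1
    have e1 := P.coeFn_toH _ (hψ (s n)).smooth.continuous (hψ (s n)).periodic
    have e2 := P.coeFn_toH _ ((hψ (s n)).continuous_partialDeriv j)
      ((hψ (s n)).periodic_partialDeriv j)
    rw [fn_ofTest, grad_ofTest]
    refine Eq.trans (integral_congr_ae ?_) (h1.trans (congrArg Neg.neg (integral_congr_ae ?_)))
    · filter_upwards [e1] with x hx
      rw [hx]
    · filter_upwards [e1, e2] with x hx hx'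
      rw [hx, hx']
  have lim1 : Tendsto (fun n => ∫ x in P.Ω, damp (fn (P.ofTest (hψ (s n))) x) *
      partialDeriv j φ x) atTop (𝓝 (∫ x in P.Ω, damp (fn u x) * partialDeriv j φ x)) := by
    refine tendsto_integral_of_dominated_convergence (fun _ => C')
      (fun n => (continuous_damp.comp_aestronglyMeasurable (meas _)).mul
        (hφ.continuous_partialDeriv j).aestronglyMeasurable) (integrable_const C')
      (fun n => Eventually.of_forall fun x => ?_) ?_
    · rw [norm_mul]
      calc _ ≤ 1 * C' := mul_le_mul (norm_damp_le _) (hC' x) (norm_nonneg _) zero_le_one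
        _ = _ := one_mul _
    · filter_upwards [hae] with x hx
      exact ((continuous_damp.tendsto _).comp hx).mul_const _
  have lim2 : Tendsto (fun n => ∫ x in P.Ω, dampDeriv (fn (P.ofTest (hψ (s n))) x)
      (grad u j x) * φ x) atTop (𝓝 (∫ x in P.Ω, dampDeriv (fn u x) (grad u j x) * φ x)) := by
    refine tendsto_integral_of_dominated_convergence (fun x => 3 * C * ‖grad u j x‖)
      (fun n => measD _ _) ((P.integrable_coe (grad u j)).norm.const_mul (3 * C))
      (fun n => Eventually.of_forall (boundD _ _)) ?_
    filter_upwards [hae] with x hx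
    exact ((continuous_dampDeriv.tendsto (fn u x, grad u j x)).comp
      (hx.prodMk_nhds tendsto_const_nhds)).mul_const _
  -- The gradients converge in norm only, so their error is estimated separately.
  have lim3 : Tendsto (fun n => ∫ x in P.Ω, dampDeriv (fn (P.ofTest (hψ (s n))) x)
      ((grad (P.ofTest (hψ (s n))) j - grad u j : P.H) x) * φ x) atTop (𝓝 0) := by
    have hz : Tendsto (fun n => 3 * C * (‖grad (P.ofTest (hψ (s n))) j - grad u j‖ *
        (volume P.Ω ^ (1 / 2 : ℝ)).toReal)) atTop (𝓝 0) := by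
      have := (tendsto_iff_norm_sub_tendsto_zero.1 (hgr.comp hs.tendsto_atTop))
      simpa using ((this.mul_const (volume P.Ω ^ (1 / 2 : ℝ)).toReal).const_mul (3 * C))
    refine squeeze_zero_norm (fun n => ?_) hz
    refine (norm_integral_le_integral_norm _).trans ?_
    refine (integral_mono (intD _ _).norm ((P.integrable_coe _).norm.const_mul (3 * C))
      (boundD _ _)).trans ?_
    rw [integral_const_mul]
    exact mul_le_mul_of_nonneg_left (P.integral_norm_le _) (by positivity)
  have lim4 := lim3.add lim2
  rw [zero_add] at lim4
  have hsum : ∀ n, (∫ x in P.Ω, dampDeriv (fn (P.ofTest (hψ (s n))) x)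
      ((grad (P.ofTest (hψ (s n))) j - grad u j : P.H) x) * φ x) +
      (∫ x in P.Ω, dampDeriv (fn (P.ofTest (hψ (s n))) x) (grad u j x) * φ x) =
      ∫ x in P.Ω, dampDeriv (fn (P.ofTest (hψ (s n))) x) (grad (P.ofTest (hψ (s n))) j x)
        * φ x := by
    intro n
    rw [← integral_add (intD _ _) (intD _ _)]
    refine integral_congr_ae ?_
    filter_upwards [Lp.coeFn_sub (grad (P.ofTest (hψ (s n))) j) (grad u j)] with x hx
    rw [hx, Pi.sub_apply, dampDeriv_sub]
    ring
  simp_rw [hsum] at lim4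
  simp_rw [hn] at lim1
  exact tendsto_nhds_unique lim1 lim4.neg

lemma tendsto_dampDeriv_nat_mul {z : ℂ} (hz : z ≠ 0) (h : ℂ) :
    Tendsto (fun n : ℕ => dampDeriv (n * z) h) atTop (𝓝 0) := by
  have h1 : Tendsto (fun n : ℕ => 3 * ‖h‖ / (1 + ((n : ℝ) * ‖z‖) ^ 2)) atTop (𝓝 0) := by
    refine tendsto_const_nhds.div_atTop (tendsto_atTop_add_const_left _ _ ?_)
    exact (tendsto_pow_atTop two_ne_zero).comp
      (tendsto_natCast_atTop_atTop.atTop_mul_const (norm_pos_iff.2 hz))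
  refine squeeze_zero_norm (fun n => ?_) h1
  refine (norm_dampDeriv_le _ _).trans_eq ?_
  rw [norm_mul, Complex.norm_natCast]

/-- The weak gradient of an element of `V` vanishes almost everywhere on its zero set. Its
restriction to this set is the limit of the gradients of `damp (n u) / n`, and these functions tend
to zero uniformly. -/
lemma grad_ae_eq_zero (u : P.V) (j : Fin 2) :
    ∀ᵐ x ∂(volume.restrict P.Ω), fn u x = 0 → grad u j x = 0 := by
  set Z : Set Plane := {x | fn u x = 0} with hZ
  have hZm : MeasurableSet Z :=
    (Lp.stronglyMeasurable (fn u)).measurable (measurableSet_singleton 0)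
  have hw : MemLp (Z.indicator fun x => grad u j x) 2 (volume.restrict P.Ω) :=
    (Lp.memLp (grad u j)).indicator hZm
  have hint : ∀ φ : Plane → ℂ, P.IsPeriodicTest φ →
      ∫ x in P.Ω, Z.indicator (fun x => grad u j x) x * φ x = 0 := by
    intro φ hφ
    obtain ⟨C, hC⟩ := hφ.bound
    obtain ⟨C', hC'⟩ := hφ.bound_partialDeriv j
    have hC0 : 0 ≤ C := (norm_nonneg _).trans (hC 0)
    have hC'0 : 0 ≤ C' := (norm_nonneg _).trans (hC' 0)
    have meas : ∀ w : P.H, AEStronglyMeasurable (fun x => w x) (volume.restrict P.Ω) :=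
      fun w => Lp.aestronglyMeasurable w
    have hn : ∀ n : ℕ, ∫ x in P.Ω, damp (fn ((n : ℂ) • u) x) * partialDeriv j φ x =
        -((n : ℂ) * ∫ x in P.Ω, dampDeriv (n * fn u x) (grad u j x) * φ x) := by
      intro n
      rw [P.integral_damp _ hφ, ← integral_const_mul]
      congr 1
      refine integral_congr_ae ?_
      filter_upwards [Lp.coeFn_smul (n : ℂ) (fn u), Lp.coeFn_smul (n : ℂ) (grad u j)]
        with x h1 h2
      change dampDeriv (((n : ℂ) • fn u : P.H) x) (((n : ℂ) • grad u j : P.H) x) * φ x = _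
      rw [h1, h2, Pi.smul_apply, Pi.smul_apply, smul_eq_mul, smul_eq_mul]
      have := dampDeriv_real_mul (n * fn u x) (grad u j x) n
      push_cast at this
      rw [this, mul_assoc]
    have hbd : ∀ n : ℕ, ‖∫ x in P.Ω, damp (fn ((n : ℂ) • u) x) * partialDeriv j φ x‖ ≤
        C' * volume.real P.Ω := by
      intro n
      refine (norm_setIntegral_le_of_norm_le_const P.volume_Ω_lt_top fun x _ => ?_)
      rw [norm_mul]
      calc _ ≤ 1 * C' := mul_le_mul (norm_damp_le _) (hC' x) (norm_nonneg _) zero_le_one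
        _ = _ := one_mul _
    have lim0 : Tendsto (fun n : ℕ => ∫ x in P.Ω, dampDeriv (n * fn u x) (grad u j x) * φ x)
        atTop (𝓝 0) := by
      refine squeeze_zero_norm' (a := fun n : ℕ => (C' * volume.real P.Ω) / n) ?_
        (tendsto_const_nhds.div_atTop tendsto_natCast_atTop_atTop)
      filter_upwards [eventually_gt_atTop 0] with n hpos
      have h1 := hbd n
      rw [hn, norm_neg, norm_mul, Complex.norm_natCast] at h1
      rw [le_div_iff₀ (by exact_mod_cast hpos)]
      linarith
    have lim1 : Tendsto (fun n : ℕ => ∫ x in P.Ω, dampDeriv (n * fn u x) (grad u j x) * φ x)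
        atTop (𝓝 (∫ x in P.Ω, Z.indicator (fun x => grad u j x) x * φ x)) := by
      refine tendsto_integral_of_dominated_convergence (fun x => 3 * C * ‖grad u j x‖)
        (fun n => (continuous_dampDeriv.comp_aestronglyMeasurable
          (((meas (fn u)).const_mul _).prodMk (meas _))).mul
            hφ.smooth.continuous.aestronglyMeasurable)
        ((P.integrable_coe (grad u j)).norm.const_mul (3 * C))
        (fun n => Eventually.of_forall fun x => ?_) (Eventually.of_forall fun x => ?_)
      · rw [norm_mul]
        calc _ ≤ (3 * ‖grad u j x‖) * C :=
              mul_le_mul (norm_dampDeriv_le' _ _) (hC x) (norm_nonneg _) (by positivity)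
          _ = _ := by ring
      · refine Tendsto.mul_const _ ?_
        by_cases hx : fn u x = 0
        · rw [Set.indicator_of_mem (show x ∈ Z from hx), hx]
          simp only [mul_zero, dampDeriv_zero]
          exact tendsto_const_nhds
        · rw [Set.indicator_of_notMem (show x ∉ Z from hx)]
          exact tendsto_dampDeriv_nat_mul hx _
    exact tendsto_nhds_unique lim1 lim0
  have hzero : hw.toLp _ = (0 : P.H) := by
    refine P.eq_zero_of_inner_fourierVec fun κ => ?_
    rw [inner_fourierVec]
    have h1 := hint (fun x => conj (P.expo κ x))
      ⟨Complex.conjCLE.contDiff.comp (P.contDiff_expo κ), fun i x => by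
        simp only [P.expo_period]⟩
    have h2 : ∫ x in P.Ω, (hw.toLp _ : P.H) x * conj (P.expo κ x) =
        ∫ x in P.Ω, Z.indicator (fun x => grad u j x) x * conj (P.expo κ x) := by
      refine integral_congr_ae ?_
      filter_upwards [hw.coeFn_toLp] with x hx
      rw [hx]
    rw [h2, h1, mul_zero]
  have h3 := hw.coeFn_toLp
  rw [hzero] at h3
  filter_upwards [h3, Lp.coeFn_zero ℂ 2 (volume.restrict P.Ω)] with x h4 h5 hx
  rw [h5, Pi.zero_apply, Set.indicator_of_mem (show x ∈ Z from hx)] at h4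
  exact h4.symm

lemma chi_eq_zero_iff (u : P.H) :
    P.chi u = 0 ↔ ∀ᵐ x ∂(volume.restrict P.Ω), x ∈ P.Ω₂ → u x = 0 := by
  have h0 := Lp.coeFn_zero ℂ 2 (volume.restrict P.Ω)
  constructor
  · intro h
    have h1 := P.coeFn_chi u
    rw [h] at h1
    filter_upwards [h1, h0] with x h2 h3 hx
    rw [h3, Set.indicator_of_mem hx] at h2
    exact h2.symm
  · intro h
    refine Lp.ext ?_
    filter_upwards [P.coeFn_chi u, h0, h] with x h1 h2 h3
    rw [h1, h2]
    by_cases hx : x ∈ P.Ω₂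
    · rw [Set.indicator_of_mem hx, h3 hx]; rfl
    · rw [Set.indicator_of_notMem hx]; rfl

lemma chi_shiftedD_eq_zero {u : P.V} (h : P.chi (fn u) = 0) (j : Fin 2) :
    P.chi (P.shiftedD j u) = 0 := by
  rw [shiftedD_apply, map_add, map_smul, h, smul_zero, add_zero, chi_eq_zero_iff]
  filter_upwards [P.grad_ae_eq_zero u j, (P.chi_eq_zero_iff _).1 h] with x h1 h2 hx
  exact h1 (h2 hx)

end TMCrystal

namespace TMCrystal

variable {L : ℕ} (P : TMCrystal L)

/-! ### Unique continuation from the second material -/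

/-- The real number `q` such that the shifted derivative `∂_j + i k_j` acts on the exponential with
index `κ` as multiplication by `i q`. -/
def shiftedFreq (κ : Fin 2 → ℤ) (j : Fin 2) : ℝ := P.freq κ j + P.k j

lemma coef_shiftedD (u : P.V) (j : Fin 2) (κ : Fin 2 → ℤ) :
    P.coef (P.shiftedD j u) κ = Complex.I * P.shiftedFreq κ j * P.coef (fn u) κ := by
  rw [shiftedD_apply, coef_add, coef_smul, coef_grad, shiftedFreq]
  push_cast
  ring

lemma exists_coef_eq {c : (Fin 2 → ℤ) → ℂ} (hc : Summable fun κ => ‖c κ‖ ^ 2) :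
    ∃ w : P.H, ∀ κ, P.coef w κ = c κ := by
  have h : Memℓp c 2 := memℓp_gen (by simpa using hc)
  refine ⟨P.fourierBasis.repr.symm ⟨c, h⟩, fun κ => ?_⟩
  rw [coef, LinearIsometryEquiv.apply_symm_apply]

lemma shiftedD_expoV (κ : Fin 2 → ℤ) (j : Fin 2) :
    P.shiftedD j (P.expoV κ) = (Complex.I * P.shiftedFreq κ j) • P.fourierVec κ := by
  rw [shiftedD_apply, grad_expoV, fn_expoV, ← add_smul, shiftedFreq]
  push_cast
  rw [mul_add]

/-- A trigonometric polynomial that vanishes on `Ω₂` is zero. For each of its frequencies `κ₁` the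
functions `∂_j f - i freq κ₁ j f` have one frequency less and vanish on `Ω₂` as well, so that `f` is
a multiple of a single exponential. -/
lemma eq_zero_of_finite_frequencies (hΩ₂ : 0 < volume P.Ω₂) (S : Finset (Fin 2 → ℤ)) :
    ∀ f : P.H, (∀ κ ∉ S, P.coef f κ = 0) → P.chi f = 0 → f = 0 := by
  classical
  induction S using Finset.induction_on with
  | empty =>
    intro f hf _
    exact P.ext_coef fun κ => by rw [hf κ (Finset.notMem_empty κ), coef_zero]
  | insert κ₁ S hκ₁ ih =>
    intro f hf hχ
    have hsum : ∀ c : (Fin 2 → ℤ) → ℂ, Summable fun κ => ‖c κ * P.coef f κ‖ ^ 2 := fun c =>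
      summable_of_hasFiniteSupport ((insert κ₁ S).finite_toSet.subset fun κ hκ => by
        by_contra h
        exact hκ (by simp [hf κ h]))
    choose g hg using fun j => P.exists_coef_eq (hsum fun κ => Complex.I * P.freq κ j)
    let u : P.V := P.mkV f g hg
    have hχu : P.chi (fn u) = 0 := hχ
    have hdiff : ∀ j κ, (P.shiftedFreq κ j - P.shiftedFreq κ₁ j : ℂ) * P.coef f κ = 0 := by
      intro j
      have h0 : P.shiftedD j u - (Complex.I * P.shiftedFreq κ₁ j) • fn u = 0 := by
        refine ih _ (fun κ hκ => ?_) ?_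
        · rw [coef_sub, coef_smul, coef_shiftedD]
          change _ * P.coef f κ - _ * P.coef f κ = 0
          by_cases h : κ = κ₁
          · rw [h, sub_self]
          · rw [hf κ (by simp [h, hκ]), mul_zero, mul_zero, sub_zero]
        · rw [map_sub, map_smul, P.chi_shiftedD_eq_zero hχu, hχu, smul_zero, sub_zero]
      intro κ
      have h1 := congrArg (fun w => P.coef w κ) h0
      simp only [coef_sub, coef_smul, coef_shiftedD, coef_zero] at h1
      change _ * P.coef f κ - _ * P.coef f κ = 0 at h1
      have h2 : Complex.I * ((P.shiftedFreq κ j - P.shiftedFreq κ₁ j : ℂ) * P.coef f κ) = 0 := by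
        linear_combination h1
      exact (mul_eq_zero.1 h2).resolve_left Complex.I_ne_zero
    have hone : f = P.coef f κ₁ • P.fourierVec κ₁ := by
      refine P.ext_coef fun κ => ?_
      rw [coef_smul, coef_fourierVec]
      split_ifs with h
      · rw [h, mul_one]
      · rw [mul_zero]
        by_contra hne
        refine h (P.freq_injective fun j => ?_)
        have h1 := (mul_eq_zero.1 (hdiff j κ)).resolve_right hne
        have h2 : P.shiftedFreq κ j = P.shiftedFreq κ₁ j := by
          exact_mod_cast sub_eq_zero.1 h1
        simpa [shiftedFreq] using h2
    -- A non-zero multiple of an exponential has no zeros, while `Ω₂` has positive measure.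
    by_contra hf0
    have hc : P.coef f κ₁ ≠ 0 := fun h => hf0 (by rw [hone, h, zero_smul])
    have hs : (((Real.sqrt (volume.real P.Ω))⁻¹ : ℝ) : ℂ) ≠ 0 := by
      exact_mod_cast (inv_pos.2 (Real.sqrt_pos.2 P.volume_real_Ω_pos)).ne'
    rw [hone, map_smul, smul_eq_zero, or_iff_right hc, fourierVec, map_smul, smul_eq_zero,
      or_iff_right hs, chi_eq_zero_iff] at hχ
    have hnot : ∀ᵐ x ∂(volume.restrict P.Ω), x ∉ P.Ω₂ := by
      filter_upwards [hχ, P.coeFn_toH (P.expo κ₁) (P.contDiff_expo κ₁).continuous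
        (P.expo_period κ₁)] with x h1 h2 hx
      have h3 := P.norm_expo κ₁ x
      rw [← h2, h1 hx, norm_zero] at h3
      exact zero_ne_one h3
    have hnull := measure_eq_zero_iff_ae_notMem.2 hnot
    rw [Measure.restrict_apply P.measurable₂,
      Set.inter_eq_self_of_subset_left (show P.Ω₂ ⊆ P.Ω from Set.subset_union_right)] at hnull
    exact hΩ₂.ne' hnull

/-- Unique continuation: if `u` vanishes on `Ω₂` and the shifted Laplacian of `u` equals `c u` up to
a function supported on `Ω₂`, then `u` and that function are zero. By periodic elliptic regularity
`u` has second derivatives in `L²(Ω)`, and these vanish on `Ω₂` with `u`, hence the equation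
holds without the extra function; its solutions are trigonometric polynomials. -/
theorem unique_continuation (hΩ₂ : 0 < volume P.Ω₂) {u : P.V} {f : P.H} {c : ℝ}
    (hu : P.chi (fn u) = 0) (hf : P.chi f = f)
    (h : ∀ v : P.V, ∑ j, inner ℂ (P.shiftedD j v) (P.shiftedD j u) =
      c * inner ℂ (fn v) (fn u) + inner ℂ (fn v) f) : u = 0 ∧ f = 0 := by
  set F : P.H := (c : ℂ) • fn u + f with hF
  have hcoef : ∀ κ, ((∑ j, P.shiftedFreq κ j ^ 2 : ℝ) : ℂ) * P.coef (fn u) κ = P.coef F κ := by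
    intro κ
    have h1 := h (P.expoV κ)
    simp_rw [shiftedD_expoV, inner_smul_left, fn_expoV, ← coef_eq, coef_shiftedD] at h1
    rw [hF, coef_add, coef_smul, ← h1]
    push_cast
    rw [Finset.sum_mul]
    refine Finset.sum_congr rfl fun j _ => ?_
    rw [map_mul, Complex.conj_I, Complex.conj_ofReal]
    linear_combination ((P.shiftedFreq κ j : ℂ) ^ 2 * P.coef (fn u) κ) * Complex.I_sq
  have hsum : ∀ i j, Summable fun κ =>
      ‖-((P.shiftedFreq κ i * P.shiftedFreq κ j : ℝ) : ℂ) * P.coef (fn u) κ‖ ^ 2 := by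
    intro i j
    refine Summable.of_nonneg_of_le (fun _ => by positivity) (fun κ => ?_)
      (P.hasSum_norm_sq_coef F).summable
    refine pow_le_pow_left₀ (norm_nonneg _) ?_ 2
    rw [← hcoef, norm_mul, norm_mul, norm_neg, Complex.norm_real, Complex.norm_real]
    refine mul_le_mul_of_nonneg_right ?_ (norm_nonneg _)
    rw [Real.norm_eq_abs, Real.norm_eq_abs, abs_mul, Fin.sum_univ_two,
      abs_of_nonneg (add_nonneg (sq_nonneg (P.shiftedFreq κ 0)) (sq_nonneg (P.shiftedFreq κ 1)))]
    have a0 := sq_abs (P.shiftedFreq κ 0)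
    have a1 := sq_abs (P.shiftedFreq κ 1)
    have a2 := sq_nonneg (|P.shiftedFreq κ 0| - |P.shiftedFreq κ 1|)
    have a3 := sq_nonneg (|P.shiftedFreq κ 0|)
    have a4 := sq_nonneg (|P.shiftedFreq κ 1|)
    fin_cases i <;> fin_cases j <;> simp only [Fin.zero_eta, Fin.mk_one] <;> nlinarith
  -- `w i j` is the second derivative of `u` in the directions `i` and `j`.
  choose w hw using fun i j => P.exists_coef_eq (hsum i j)
  -- The shifted derivatives of `u` belong to `V` again.
  let d : Fin 2 → P.V := fun j => P.mkV (P.shiftedD j u)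
    (fun i => w i j - (Complex.I * (P.k i : ℂ)) • P.shiftedD j u) fun i κ => by
      rw [coef_sub, coef_smul, hw, coef_shiftedD, shiftedFreq, shiftedFreq]
      push_cast
      linear_combination (-((P.freq κ i : ℂ) + P.k i) * (P.freq κ j + P.k j) *
        P.coef (fn u) κ) * Complex.I_sq
  have hd : ∀ i j, P.shiftedD i (d j) = w i j := by
    intro i j
    rw [shiftedD_apply]
    change w i j - (Complex.I * (P.k i : ℂ)) • P.shiftedD j u
      + (Complex.I * (P.k i : ℂ)) • P.shiftedD j u = w i j
    abel
  have hχw : ∀ i j, P.chi (w i j) = 0 := by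
    intro i j
    rw [← hd]
    exact P.chi_shiftedD_eq_zero (u := d j) (P.chi_shiftedD_eq_zero hu j) i
  have hFw : F = -∑ j, w j j := by
    refine P.ext_coef fun κ => ?_
    rw [← neg_one_smul ℂ, coef_smul, coef_sum, ← hcoef]
    simp_rw [hw]
    push_cast
    rw [Finset.sum_mul, Finset.mul_sum]
    refine Finset.sum_congr rfl fun j _ => ?_
    ring
  have hf0 : f = 0 := by
    have h1 : P.chi F = 0 := by
      rw [hFw, map_neg, map_sum]
      simp [hχw]
    rw [hF, map_add, map_smul, hu, smul_zero, zero_add, hf] at h1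
    exact h1
  refine ⟨?_, hf0⟩
  -- The frequencies of `u` lie on a circle, so there are finitely many of them.
  have hcoef' : ∀ κ, P.coef (fn u) κ ≠ 0 → ∑ j, P.shiftedFreq κ j ^ 2 = c := by
    intro κ hκ
    have h1 := hcoef κ
    rw [hF, hf0, add_zero, coef_smul] at h1
    exact_mod_cast mul_right_cancel₀ hκ h1
  refine P.fn_injective (P.eq_zero_of_finite_frequencies hΩ₂
    (P.finite_freq_le (Real.sqrt c + |P.k 0| + |P.k 1|)).toFinset _ (fun κ hκ => ?_) hu)
  by_contra hne
  refine hκ ((P.finite_freq_le _).mem_toFinset.2 fun j => ?_)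
  have h1 := hcoef' κ hne
  have h2 : |P.shiftedFreq κ j| ≤ Real.sqrt c := by
    refine Real.abs_le_sqrt ?_
    rw [← h1]
    exact Finset.single_le_sum (f := fun j => P.shiftedFreq κ j ^ 2)
      (fun _ _ => sq_nonneg _) (Finset.mem_univ j)
  have h3 : |P.k j| ≤ |P.k 0| + |P.k 1| := by
    fin_cases j
    · simp
    · simp
  have h4 : P.freq κ j = P.shiftedFreq κ j - P.k j := by rw [shiftedFreq]; ring
  rw [h4]
  refine (abs_sub _ _).trans ?_
  linarith

end TMCrystal

namespace PowerIteration

/-! ### Power iteration for a positive operator -/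

/-- The quotients of consecutive terms of a logarithmically convex sequence increase. -/
lemma ratio_mono_of_logConvex {a : ℕ → ℝ}
    (h : ∀ n, a (n + 1) ^ 2 ≤ a n * a (n + 2)) {ρ : ℝ} (hρ : 0 < ρ) (ha : 0 < a 0)
    (h1 : ρ * a 0 ≤ a 1) : ∀ n, 0 < a n ∧ ρ * a n ≤ a (n + 1) := by
  intro n
  induction n with
  | zero => exact ⟨ha, h1⟩
  | succ n ih =>
    have hpos : 0 < a (n + 1) := lt_of_lt_of_le (mul_pos hρ ih.1) ih.2
    refine ⟨hpos, ?_⟩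
    have h2 := h n
    have h3 : ρ * a n * a (n + 1) ≤ a (n + 1) ^ 2 := by
      rw [sq]; exact mul_le_mul_of_nonneg_right ih.2 hpos.le
    have h4 : a n * (ρ * a (n + 1)) ≤ a n * a (n + 2) := by nlinarith
    exact le_of_mul_le_mul_left h4 ih.1

variable {K : Type*} [NormedAddCommGroup K] [InnerProductSpace ℂ K]

lemma norm_sq_apply_le {T : K →L[ℂ] K} (hT : T.IsPositive) (x : K) :
    ‖T x‖ ^ 2 ≤ ‖x‖ * ‖T (T x)‖ := by
  have h1 : inner ℂ (T x) (T x) = inner ℂ x (T (T x)) := hT.isSymmetric x (T x)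
  rw [inner_self_eq_norm_sq_to_K] at h1
  have h2 := norm_inner_le_norm (𝕜 := ℂ) x (T (T x))
  rw [← h1] at h2
  simpa using h2

lemma pow_succ_apply' (T : K →L[ℂ] K) (n : ℕ) (x : K) : (T ^ (n + 1)) x = T ((T ^ n) x) := by
  rw [pow_succ']
  rfl

lemma logConvex_norm_pow {T : K →L[ℂ] K} (hT : T.IsPositive) (x : K) (n : ℕ) :
    ‖(T ^ (n + 1)) x‖ ^ 2 ≤ ‖(T ^ n) x‖ * ‖(T ^ (n + 2)) x‖ := by
  rw [pow_succ_apply' T (n + 1), pow_succ_apply' T n]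
  exact norm_sq_apply_le hT _

lemma mul_norm_le_norm_add {T : K →L[ℂ] K} (hT : T.IsPositive) {σ : ℝ} (hσ : 0 ≤ σ) (w : K) :
    σ * ‖w‖ ≤ ‖T w + (σ : ℂ) • w‖ := by
  have h1 : ‖T w + (σ : ℂ) • w‖ ^ 2 =
      ‖T w‖ ^ 2 + 2 * (σ * RCLike.re (inner ℂ (T w) w)) + (σ * ‖w‖) ^ 2 := by
    rw [norm_add_sq (𝕜 := ℂ), inner_smul_right, norm_smul, Complex.norm_real,
      Real.norm_of_nonneg hσ]
    congr 3
    exact Complex.re_ofReal_mul _ _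
  have h2 : 0 ≤ RCLike.re (inner ℂ (T w) w) := hT.re_inner_nonneg_left w
  refine abs_le_of_sq_le_sq' (b := ‖T w + (σ : ℂ) • w‖) ?_ (norm_nonneg _) |>.2
  rw [h1]
  nlinarith [sq_nonneg ‖T w‖, mul_nonneg hσ h2]

/-- The growth rate `σ` of the iterates of a positive operator is the limit of the increasing
sequence of the quotients `‖T ^ (n + 1) y‖ / ‖T ^ n y‖`. The normalised iterates are approximate
eigenvectors of `T ^ 2` for `σ ^ 2`, hence of `T` for `σ`, because `T + σ` is bounded below by
`σ`. -/
lemma exists_growth_rate {T : K →L[ℂ] K} (hT : T.IsPositive) {y : K} (hy : ∀ n, (T ^ n) y ≠ 0) :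
    ∃ σ : ℝ, 0 < σ ∧ (∀ n, ‖(T ^ n) y‖ ≤ σ ^ n * ‖y‖) ∧
      Tendsto (fun n => T (((‖(T ^ n) y‖⁻¹ : ℝ) : ℂ) • (T ^ n) y) -
        (σ : ℂ) • (((‖(T ^ n) y‖⁻¹ : ℝ) : ℂ) • (T ^ n) y)) atTop (𝓝 0) := by
  set a : ℕ → ℝ := fun n => ‖(T ^ n) y‖ with ha
  have hapos : ∀ n, 0 < a n := fun n => norm_pos_iff.2 (hy n)
  have hlog : ∀ n, a (n + 1) ^ 2 ≤ a n * a (n + 2) := logConvex_norm_pow hT y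
  set r : ℕ → ℝ := fun n => a (n + 1) / a n with hr
  have hmono : Monotone r := monotone_nat_of_le_succ fun n => by
    rw [hr, div_le_div_iff₀ (hapos n) (hapos (n + 1))]
    nlinarith [hlog n]
  have hbdd : BddAbove (Set.range r) := by
    refine ⟨‖T‖, ?_⟩
    rintro _ ⟨n, rfl⟩
    rw [hr, div_le_iff₀ (hapos n), ha]
    simp only [pow_succ_apply']
    exact T.le_opNorm _
  set σ := ⨆ n, r n with hσ
  have hle : ∀ n, r n ≤ σ := le_ciSup hbdd
  have hlim : Tendsto r atTop (𝓝 σ) := tendsto_atTop_ciSup hmono hbdd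
  have hσpos : 0 < σ := lt_of_lt_of_le (div_pos (hapos 1) (hapos 0)) (hle 0)
  refine ⟨σ, hσpos, fun n => ?_, ?_⟩
  · induction n with
    | zero => simp
    | succ n ih =>
      have h1 := hle n
      rw [hr, div_le_iff₀ (hapos n)] at h1
      calc a (n + 1) ≤ σ * a n := h1
        _ ≤ σ * (σ ^ n * ‖y‖) := mul_le_mul_of_nonneg_left ih hσpos.le
        _ = σ ^ (n + 1) * ‖y‖ := by ring
  · set e : ℕ → K := fun n => ((‖(T ^ n) y‖⁻¹ : ℝ) : ℂ) • (T ^ n) y with he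
    have hTe : ∀ n, T (e n) = (r n : ℂ) • e (n + 1) := by
      intro n
      simp only [he, map_smul, ← pow_succ_apply', smul_smul]
      congr 1
      rw [← Complex.ofReal_mul]
      congr 1
      change (a n)⁻¹ = a (n + 1) / a n * (a (n + 1))⁻¹
      field_simp [(hapos n).ne', (hapos (n + 1)).ne']
    have hnorm : ∀ n, ‖e n‖ = 1 := by
      intro n
      rw [he, norm_smul, Complex.norm_real, norm_inv, norm_norm]
      exact inv_mul_cancel₀ (hapos n).ne'
    have hrpos : ∀ n, 0 < r n := fun n => div_pos (hapos _) (hapos _)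
    have hnT : ∀ n, ‖T (e n)‖ = r n := by
      intro n
      rw [hTe, norm_smul, hnorm, mul_one, Complex.norm_real, Real.norm_of_nonneg (hrpos n).le]
    have hnTT : ∀ n, ‖T (T (e n))‖ = r n * r (n + 1) := by
      intro n
      rw [hTe, map_smul, norm_smul, hnT, Complex.norm_real, Real.norm_of_nonneg (hrpos n).le]
    have hsq : ∀ n, ‖T (T (e n)) - ((σ ^ 2 : ℝ) : ℂ) • e n‖ ^ 2 =
        (r n * r (n + 1)) ^ 2 - 2 * σ ^ 2 * r n ^ 2 + σ ^ 4 := by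
      intro n
      have h1 : inner ℂ (T (T (e n))) (e n) = ((r n ^ 2 : ℝ) : ℂ) := by
        have h2 : inner ℂ (T (T (e n))) (e n) = inner ℂ (T (e n)) (T (e n)) :=
          hT.isSymmetric (T (e n)) (e n)
        rw [h2, inner_self_eq_norm_sq_to_K, hnT]
        norm_cast
      rw [norm_sub_sq (𝕜 := ℂ), inner_smul_right, h1, hnTT, norm_smul, hnorm, Complex.norm_real,
        Real.norm_of_nonneg (sq_nonneg σ), ← Complex.ofReal_mul]
      change _ - 2 * (σ ^ 2 * r n ^ 2) + _ = _
      ring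
    have hlim2 : Tendsto (fun n => ‖T (T (e n)) - ((σ ^ 2 : ℝ) : ℂ) • e n‖ ^ 2) atTop (𝓝 0) := by
      simp_rw [hsq]
      have h1 := hlim.comp (tendsto_add_atTop_nat 1)
      have h2 := (((hlim.mul h1).pow 2).sub ((hlim.pow 2).const_mul (2 * σ ^ 2))).add_const (σ ^ 4)
      have h3 : (σ * σ) ^ 2 - 2 * σ ^ 2 * σ ^ 2 + σ ^ 4 = 0 := by ring
      rw [h3] at h2
      exact h2
    have hlim3 : Tendsto (fun n => ‖T (T (e n)) - ((σ ^ 2 : ℝ) : ℂ) • e n‖) atTop (𝓝 0) := by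
      have h1 := hlim2.sqrt
      simpa [Real.sqrt_sq (norm_nonneg _)] using h1
    refine squeeze_zero_norm (a := fun n => σ⁻¹ * ‖T (T (e n)) - ((σ ^ 2 : ℝ) : ℂ) • e n‖)
      (fun n => ?_) (by simpa using hlim3.const_mul σ⁻¹)
    rw [← div_eq_inv_mul, le_div_iff₀ hσpos, mul_comm]
    refine (mul_norm_le_norm_add hT hσpos.le _).trans_eq ?_
    congr 1
    have hv : ∀ v : K, T (T v - (σ : ℂ) • v) + (σ : ℂ) • (T v - (σ : ℂ) • v) =
        T (T v) - ((σ ^ 2 : ℝ) : ℂ) • v := by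
      intro v
      rw [map_sub, map_smul, smul_sub, smul_smul]
      push_cast
      rw [sq]
      abel
    exact hv (e n)

/-- The vectors whose iterates grow at most like `σ ^ n`. -/
def growthSubmodule (T : K →L[ℂ] K) (σ : ℝ) : Submodule ℂ K where
  carrier := {z | ∃ C : ℝ, ∀ n, ‖(T ^ n) z‖ ≤ C * σ ^ n}
  zero_mem' := ⟨0, fun n => by simp⟩
  add_mem' := by
    rintro z w ⟨C, hC⟩ ⟨D, hD⟩
    refine ⟨C + D, fun n => ?_⟩
    rw [map_add, add_mul]
    exact (norm_add_le _ _).trans (add_le_add (hC n) (hD n))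
  smul_mem' := by
    rintro c z ⟨C, hC⟩
    refine ⟨‖c‖ * C, fun n => ?_⟩
    rw [map_smul, norm_smul, mul_assoc]
    exact mul_le_mul_of_nonneg_left (hC n) (norm_nonneg _)

lemma apply_mem_growthSubmodule {T : K →L[ℂ] K} {σ : ℝ} {z : K} (hz : z ∈ growthSubmodule T σ) :
    T z ∈ growthSubmodule T σ := by
  obtain ⟨C, hC⟩ := hz
  refine ⟨C * σ, fun n => ?_⟩
  have h := hC (n + 1)
  rw [pow_succ, pow_succ] at h
  calc ‖(T ^ n) (T z)‖ ≤ C * (σ ^ n * σ) := h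
    _ = C * σ * σ ^ n := by ring

/-- On vectors whose iterates grow at most like `σ ^ n` a positive operator is bounded by `σ`, since
the norms of the iterates are logarithmically convex. -/
lemma norm_apply_le_of_mem_growthSubmodule {T : K →L[ℂ] K} (hT : T.IsPositive) {σ : ℝ}
    (hσ : 0 < σ) {z : K} (hz : z ∈ growthSubmodule T σ) : ‖T z‖ ≤ σ * ‖z‖ := by
  obtain ⟨C, hC⟩ := hz
  by_contra! hcon
  have hz0 : 0 < ‖z‖ := norm_pos_iff.2 fun h => by simp [h] at hcon
  obtain ⟨ρ, hρ1, hρ2⟩ := exists_between ((lt_div_iff₀ hz0).2 hcon)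
  rw [lt_div_iff₀ hz0] at hρ2
  have h := ratio_mono_of_logConvex (a := fun n => ‖(T ^ n) z‖)
    (logConvex_norm_pow hT z) (hσ.trans hρ1) (by simpa using hz0) (by simpa using hρ2.le)
  have hgrow : ∀ n, ρ ^ n * ‖z‖ ≤ ‖(T ^ n) z‖ := by
    intro n
    induction n with
    | zero => simp
    | succ n ih =>
      calc ρ ^ (n + 1) * ‖z‖ = ρ * (ρ ^ n * ‖z‖) := by ring
        _ ≤ ρ * ‖(T ^ n) z‖ := mul_le_mul_of_nonneg_left ih (hσ.trans hρ1).le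
        _ ≤ _ := (h n).2
  obtain ⟨n, hn⟩ := pow_unbounded_of_one_lt (C / ‖z‖) ((one_lt_div hσ).2 hρ1)
  rw [div_pow, div_lt_div_iff₀ hz0 (pow_pos hσ n)] at hn
  exact absurd ((hgrow n).trans (hC n)) (not_le.2 hn)

/-- Suppose that all subspaces on which the quadratic form of `(1 - T / σ) (1 - T / σ')` is
non-positive are finite-dimensional, where `σ` is an upper bound of `T`. Then approximate
eigenvectors for `σ` have convergent subsequences: up to a null sequence they lie in the range of
`max 0 (T - σ')`, which is such a subspace. -/
lemma exists_subseq_tendsto_of_finiteDimensional [CompleteSpace K] {T : K →L[ℂ] K}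
    (hT : T.IsPositive) {σ σ' : ℝ} (hσ' : 0 < σ') (hσσ' : σ' < σ) (hnorm : ∀ z, ‖T z‖ ≤ σ * ‖z‖)
    (hfin : ∀ N : Submodule ℂ K, (∀ w ∈ N, (inner ℂ (w - ((σ⁻¹ : ℝ) : ℂ) • T w)
      (w - ((σ'⁻¹ : ℝ) : ℂ) • T w)).re ≤ 0) → FiniteDimensional ℂ N)
    {y : ℕ → K} {C : ℝ} (hy : ∀ n, ‖y n‖ ≤ C)
    (hlim : Tendsto (fun n => T (y n) - (σ : ℂ) • y n) atTop (𝓝 0)) :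
    ∃ (y' : K) (s : ℕ → ℕ), StrictMono s ∧ Tendsto (fun n => y (s n)) atTop (𝓝 y') := by
  have hσ : 0 < σ := hσ'.trans hσσ'
  have hsa : IsSelfAdjoint T := hT.isSelfAdjoint
  have hspec : ∀ t ∈ spectrum ℝ T, 0 ≤ t ∧ t ≤ σ := by
    intro t ht
    have h0 : 0 ≤ t := spectrum_nonneg_of_nonneg (T.nonneg_iff_isPositive.2 hT) ht
    have h1 := spectrum.norm_le_norm_mul_of_mem ht
    have h2 : ‖(1 : K →L[ℂ] K)‖ ≤ 1 := ContinuousLinearMap.norm_id_le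
    have h3 : ‖T‖ ≤ σ := T.opNorm_le_bound hσ.le hnorm
    rw [Real.norm_of_nonneg h0] at h1
    exact ⟨h0, h1.trans (by nlinarith [norm_nonneg T])⟩
  set g : ℝ → ℝ := fun t => max 0 (t - σ') with hg
  set h : ℝ → ℝ := fun t => (σ - σ') / (σ - min t σ') with hh
  have hgc : Continuous g := by fun_prop
  have hden : ∀ t : ℝ, σ - min t σ' ≠ 0 := fun t => by
    have := min_le_right t σ'
    linarith
  have hhc : Continuous h := continuous_const.div (by fun_prop) hden
  -- `g` is supported where the form is non-positive, and `(σ - σ') - g t = h t * (σ - t)`.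
  set G : K →L[ℂ] K := cfc g T with hG
  have hpoly : ∀ τ : ℝ, cfc (fun t : ℝ => 1 - τ * t) T = 1 - ((τ : ℝ) : ℂ) • T := by
    intro τ
    rw [cfc_sub .., cfc_const_one .., cfc_const_mul_id ..]
    rfl
  have hpoly' : cfc (fun t : ℝ => σ - t) T = ((σ : ℝ) : ℂ) • 1 - T := by
    rw [cfc_sub .., cfc_const .., cfc_id' .., Algebra.algebraMap_eq_smul_one]
    rfl
  have hQ : ∀ τ : ℝ, (1 - ((τ : ℝ) : ℂ) • T) * G = cfc (fun t => (1 - τ * t) * g t) T := by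
    intro τ
    rw [← hpoly, hG, ← cfc_mul _ _ T]
  have hfin1 : FiniteDimensional ℂ (LinearMap.range G.toLinearMap) := by
    refine hfin _ ?_
    rintro _ ⟨v, rfl⟩
    have h2 : cfc (fun t => (1 - σ⁻¹ * t) * g t * ((1 - σ'⁻¹ * t) * g t)) T ≤ 0 := by
      refine cfc_nonpos _ _ fun t ht => ?_
      obtain ⟨ht0, ht1⟩ := hspec t ht
      rcases le_total t σ' with h3 | h3
      · have : g t = 0 := max_eq_left (by linarith)
        simp [this]
      · have e1 : 0 ≤ 1 - σ⁻¹ * t := by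
          rw [sub_nonneg, ← div_eq_inv_mul, div_le_one hσ]
          exact ht1
        have e2 : 1 - σ'⁻¹ * t ≤ 0 := by
          rw [sub_nonpos, ← div_eq_inv_mul, one_le_div hσ']
          exact h3
        have e3 : 0 ≤ g t := le_max_left _ _
        exact mul_nonpos_of_nonneg_of_nonpos (mul_nonneg e1 e3)
          (mul_nonpos_of_nonpos_of_nonneg e2 e3)
    rw [cfc_mul (fun t => (1 - σ⁻¹ * t) * g t) (fun t => (1 - σ'⁻¹ * t) * g t) T] at h2
    have h3 : IsSelfAdjoint (cfc (fun t => (1 - σ⁻¹ * t) * g t) T) := cfc_predicate _ T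
    have h4 := ((ContinuousLinearMap.nonneg_iff_isPositive _).1
      (neg_nonneg.2 h2)).re_inner_nonneg_right v
    rw [neg_apply, inner_neg_right, map_neg, neg_nonneg] at h4
    have h5 := h3.isSymmetric v (cfc (fun t => (1 - σ'⁻¹ * t) * g t) T v)
    rw [← hQ, ← hQ] at h4 h5
    have h6 : inner ℂ (((1 - ((σ⁻¹ : ℝ) : ℂ) • T) * G) v)
        (((1 - ((σ'⁻¹ : ℝ) : ℂ) • T) * G) v) = _ := h5
    change (inner ℂ (((1 - ((σ⁻¹ : ℝ) : ℂ) • T) * G) v)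
        (((1 - ((σ'⁻¹ : ℝ) : ℂ) • T) * G) v)).re ≤ 0
    rw [h6]
    exact h4
  have hdiff : ∀ v, ((σ - σ' : ℝ) : ℂ) • v - G v = -cfc h T (T v - (σ : ℂ) • v) := by
    intro v
    have h1 : ((σ - σ' : ℝ) : ℂ) • (1 : K →L[ℂ] K) - G = cfc h T * (((σ : ℝ) : ℂ) • 1 - T) := by
      rw [← hpoly', ← cfc_mul h _ T]
      have h2 : (fun t => h t * (σ - t)) = fun t => (σ - σ') - g t := by
        funext t
        rw [hh, hg]
        rcases le_total t σ' with h3 | h3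
        · have h4 := hden t
          rw [min_eq_left h3] at h4
          simp only [min_eq_left h3, max_eq_left (sub_nonpos.2 h3)]
          rw [div_mul_cancel₀ _ h4, sub_zero]
        · have h4 := hden t
          rw [min_eq_right h3] at h4
          simp only [min_eq_right h3, max_eq_right (sub_nonneg.2 h3)]
          rw [div_self h4]
          ring
      rw [h2, cfc_sub _ _ T, cfc_const _ T, Algebra.algebraMap_eq_smul_one]
      rfl
    have h2 := congrArg (fun A : K →L[ℂ] K => A v) h1
    change ((σ - σ' : ℝ) : ℂ) • v - G v = cfc h T ((σ : ℂ) • v - T v) at h2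
    rw [h2, ← map_neg, neg_sub]
  have hc : ((σ - σ' : ℝ) : ℂ) ≠ 0 := by exact_mod_cast (sub_pos.2 hσσ').ne'
  have : ProperSpace (LinearMap.range G.toLinearMap) := FiniteDimensional.proper ℂ _
  obtain ⟨z, -, s, hs, hz⟩ := tendsto_subseq_of_bounded (x := fun n =>
      (⟨G (y n), LinearMap.mem_range_self _ _⟩ : LinearMap.range G.toLinearMap))
    (s := Metric.closedBall 0 (‖G‖ * C)) Metric.isBounded_closedBall fun n => by
      rw [mem_closedBall_zero_iff]
      exact (G.le_opNorm _).trans (mul_le_mul_of_nonneg_left (hy n) (norm_nonneg _))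
  have hz' : Tendsto (fun n => G (y (s n))) atTop (𝓝 (z : K)) :=
    (continuous_subtype_val.tendsto z).comp hz
  refine ⟨(((σ - σ' : ℝ) : ℂ))⁻¹ • (z : K), s, hs, ?_⟩
  have h1 := (((cfc h T).continuous.tendsto 0).comp (hlim.comp hs.tendsto_atTop)).neg.add hz'
  rw [map_zero, neg_zero, zero_add] at h1
  refine (h1.const_smul (((σ - σ' : ℝ) : ℂ))⁻¹).congr fun n => ?_
  simp only [Function.comp_apply]
  rw [← hdiff, sub_add_cancel, inv_smul_smul₀ hc]

end PowerIteration

namespace TMCrystal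

variable {L : ℕ} (P : TMCrystal L)

/-! ### The linearised problem as a bounded positive operator -/

/-- Multiplication by the square root of `α`, where `α = α₁` on `Ω₁` and `α = α₂` on `Ω₂`. -/
def sqrtα : P.H →L[ℂ] P.H :=
  (Real.sqrt P.α₁ : ℂ) • (ContinuousLinearMap.id ℂ P.H - P.chi) + (Real.sqrt P.α₂ : ℂ) • P.chi

/-- The inverse of `sqrtα`. -/
def sqrtαInv : P.H →L[ℂ] P.H :=
  (Real.sqrt P.α₁ : ℂ)⁻¹ • (ContinuousLinearMap.id ℂ P.H - P.chi) + (Real.sqrt P.α₂ : ℂ)⁻¹ • P.chi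

lemma sqrtα_apply (u : P.H) :
    P.sqrtα u = (Real.sqrt P.α₁ : ℂ) • (u - P.chi u) + (Real.sqrt P.α₂ : ℂ) • P.chi u := rfl

lemma sqrtαInv_sqrtα (u : P.H) : P.sqrtαInv (P.sqrtα u) = u := by
  have h1 : (Real.sqrt P.α₁ : ℂ) ≠ 0 := by exact_mod_cast (Real.sqrt_pos.2 P.α₁_pos).ne'
  have h2 : (Real.sqrt P.α₂ : ℂ) ≠ 0 := by exact_mod_cast (Real.sqrt_pos.2 P.α₂_pos).ne'
  have h3 : P.chi (P.sqrtα u) = (Real.sqrt P.α₂ : ℂ) • P.chi u := by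
    rw [sqrtα_apply, map_add, map_smul, map_smul, map_sub, chi_chi, sub_self, smul_zero, zero_add]
  change (Real.sqrt P.α₁ : ℂ)⁻¹ • (P.sqrtα u - P.chi (P.sqrtα u))
    + (Real.sqrt P.α₂ : ℂ)⁻¹ • P.chi (P.sqrtα u) = u
  rw [h3, sqrtα_apply, add_sub_cancel_right, inv_smul_smul₀ h1, inv_smul_smul₀ h2, sub_add_cancel]

lemma inner_sqrtα_left (u v : P.H) : inner ℂ (P.sqrtα v) u = inner ℂ v (P.sqrtα u) := by
  simp only [sqrtα_apply, inner_add_left, inner_add_right, inner_smul_left, inner_smul_right,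
    inner_sub_left, inner_sub_right, inner_chi_left, Complex.conj_ofReal]

lemma formα_eq (u v : P.H) : P.formα u v = inner ℂ (P.sqrtα v) (P.sqrtα u) := by
  have h1 : (Real.sqrt P.α₁ : ℂ) * Real.sqrt P.α₁ = P.α₁ := by
    exact_mod_cast Real.mul_self_sqrt P.α₁_pos.le
  have h2 : (Real.sqrt P.α₂ : ℂ) * Real.sqrt P.α₂ = P.α₂ := by
    exact_mod_cast Real.mul_self_sqrt P.α₂_pos.le
  rw [inner_sqrtα_left, formα, form₁_eq, form₂_eq, ← h1, ← h2]
  simp only [sqrtα_apply, inner_add_right, inner_smul_right, inner_sub_right, map_add, map_sub,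
    map_smul, chi_chi]
  ring

/-- The pivot space of the linearised problem: the component `none` holds `√α u`, the component
`some ℓ` holds `x_ℓ`. -/
abbrev Pivot : Type := PiLp 2 fun _ : Option (Fin L) => P.H

/-- The components of the embedding of the linearised problem into its pivot space. -/
def toPivotAux : (o : Option (Fin L)) → P.Ext →L[ℂ] P.H
  | none => P.sqrtα.comp (P.emb.comp (ContinuousLinearMap.fst ℂ P.V (Fin L → P.X)))
  | some ℓ => P.X.subtypeL.comp
      ((ContinuousLinearMap.proj (R := ℂ) (φ := fun _ : Fin L => P.X) ℓ).comp
        (ContinuousLinearMap.snd ℂ P.V (Fin L → P.X)))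

/-- The embedding `[u; x] ↦ (√α u, x)`, which is isometric with respect to `extInner`. -/
def toPivot : P.Ext →L[ℂ] P.Pivot :=
  (PiLp.continuousLinearEquiv 2 ℂ (fun _ : Option (Fin L) => P.H)).symm.toContinuousLinearMap.comp
    (ContinuousLinearMap.pi P.toPivotAux)

@[simp] lemma toPivot_none (z : P.Ext) : P.toPivot z none = P.sqrtα (fn z.1) := rfl

@[simp] lemma toPivot_some (z : P.Ext) (ℓ : Fin L) : P.toPivot z (some ℓ) = z.2 ℓ := rfl

lemma extInner_eq (z w : P.Ext) : P.extInner z w = inner ℂ (P.toPivot w) (P.toPivot z) := by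
  rw [PiLp.inner_apply, Fintype.sum_option, extInner, formα_eq]
  simp [form₂_eq]

lemma extNorm_eq (z : P.Ext) : P.extNorm z = ‖P.toPivot z‖ := by
  rw [extNorm, extInner_eq, inner_self_eq_norm_sq_to_K]
  norm_cast
  exact Real.sqrt_sq (norm_nonneg _)

lemma toPivot_injective_iff (z : P.Ext) : P.toPivot z = 0 ↔ z = 0 := by
  refine ⟨fun h => ?_, fun h => by rw [h, map_zero]⟩
  have h1 : fn z.1 = 0 := by
    rw [← P.sqrtαInv_sqrtα (fn z.1), ← toPivot_none, h]
    simp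
  have h2 : ∀ ℓ, (z.2 ℓ : P.H) = 0 := fun ℓ => by
    rw [← toPivot_some, h]
    rfl
  exact Prod.ext (P.fn_injective h1) (funext fun ℓ => Subtype.ext (h2 ℓ))

lemma extForm_eq (z w : P.Ext) : P.extForm z w =
    ∑ j, inner ℂ (P.shiftedD j w.1) (P.shiftedD j z.1)
      + P.Xi * inner ℂ (fn w.1) (P.chi (fn z.1))
      - ∑ ℓ, (P.b ℓ : ℂ) * inner ℂ (fn w.1) (z.2 ℓ : P.H)
      - ∑ ℓ, (P.b ℓ : ℂ) * inner ℂ (w.2 ℓ : P.H) (P.chi (fn z.1))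
      + ∑ ℓ, ((P.η ℓ ^ 2 : ℝ) : ℂ) * inner ℂ (w.2 ℓ : P.H) (z.2 ℓ : P.H) := by
  rw [extForm, formLaplace_eq]
  simp only [form₂_eq, chi_coe, A, Matrix.diagonal_apply]
  congr 1
  refine Finset.sum_congr rfl fun ℓ _ => ?_
  rw [Finset.sum_eq_single ℓ (fun m _ hm => by simp [hm.symm]) (by simp)]
  simp

/-- The components of the energy embedding. -/
def energyAux (β : ℝ) : (o : (Fin 2 ⊕ Fin L) ⊕ Option (Fin L)) → P.Ext →L[ℂ] P.H
  | .inl (.inl j) => (P.shiftedD j).comp (ContinuousLinearMap.fst ℂ P.V (Fin L → P.X))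
  | .inl (.inr ℓ) =>
      (P.ξ ℓ : ℂ) • P.chi.comp (P.emb.comp (ContinuousLinearMap.fst ℂ P.V (Fin L → P.X)))
        - (P.η ℓ : ℂ) • P.toPivotAux (some ℓ)
  | .inr o => (Real.sqrt β : ℂ) • P.toPivotAux o

/-- The map `[u; x] ↦ (∇u + i k u, (ξ_ℓ u - η_ℓ x_ℓ)_ℓ, √β (√α u, x))`. The shifted form is the
pullback of the inner product under this map. -/
def energy (β : ℝ) : P.Ext →L[ℂ] PiLp 2 fun _ : (Fin 2 ⊕ Fin L) ⊕ Option (Fin L) => P.H :=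
  (PiLp.continuousLinearEquiv 2 ℂ
    (fun _ : (Fin 2 ⊕ Fin L) ⊕ Option (Fin L) => P.H)).symm.toContinuousLinearMap.comp
    (ContinuousLinearMap.pi (P.energyAux β))

lemma energy_grad (β : ℝ) (z : P.Ext) (j : Fin 2) :
    P.energy β z (.inl (.inl j)) = P.shiftedD j z.1 := rfl

lemma energy_coupling (β : ℝ) (z : P.Ext) (ℓ : Fin L) :
    P.energy β z (.inl (.inr ℓ)) =
      (P.ξ ℓ : ℂ) • P.chi (fn z.1) - (P.η ℓ : ℂ) • (z.2 ℓ : P.H) := rfl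

lemma energy_pivot (β : ℝ) (z : P.Ext) (o : Option (Fin L)) :
    P.energy β z (.inr o) = (Real.sqrt β : ℂ) • P.toPivot z o := by
  cases o <;> rfl

lemma extShifted_eq {β : ℝ} (hβ : 0 < β) (z w : P.Ext) :
    P.extShifted β z w = inner ℂ (P.energy β w) (P.energy β z) := by
  have h1 : (Real.sqrt β : ℂ) * Real.sqrt β = β := by
    exact_mod_cast Real.mul_self_sqrt hβ.le
  rw [PiLp.inner_apply, Fintype.sum_sum_type, Fintype.sum_sum_type, extShifted, extForm_eq,
    extInner_eq, PiLp.inner_apply, Finset.mul_sum]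
  congr 1
  · simp only [energy_grad, energy_coupling, Xi, b]
    have h2 : ∀ ℓ, inner ℂ ((P.ξ ℓ : ℂ) • P.chi (fn w.1) - (P.η ℓ : ℂ) • (w.2 ℓ : P.H))
        ((P.ξ ℓ : ℂ) • P.chi (fn z.1) - (P.η ℓ : ℂ) • (z.2 ℓ : P.H)) =
        (P.ξ ℓ : ℂ) ^ 2 * inner ℂ (fn w.1) (P.chi (fn z.1))
        - (P.ξ ℓ * P.η ℓ : ℂ) * inner ℂ (fn w.1) (z.2 ℓ : P.H)
        - (P.ξ ℓ * P.η ℓ : ℂ) * inner ℂ (w.2 ℓ : P.H) (P.chi (fn z.1))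
        + (P.η ℓ : ℂ) ^ 2 * inner ℂ (w.2 ℓ : P.H) (z.2 ℓ : P.H) := by
      intro ℓ
      simp only [inner_sub_left, inner_sub_right, inner_smul_left, inner_smul_right,
        Complex.conj_ofReal, inner_chi_left, chi_chi, chi_coe]
      ring
    simp_rw [h2, Finset.sum_add_distrib, Finset.sum_sub_distrib, ← Finset.sum_mul]
    push_cast
    ring
  · refine Finset.sum_congr rfl fun o _ => ?_
    rw [energy_pivot, energy_pivot, inner_smul_left, inner_smul_right, Complex.conj_ofReal,
      ← mul_assoc, h1]

lemma exists_norm_le_energy {β : ℝ} (hβ : 0 < β) :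
    ∃ C : NNReal, ∀ z : P.Ext, ‖z‖ ≤ C * ‖P.energy β z‖ := by
  have hs : 0 < Real.sqrt β := Real.sqrt_pos.2 hβ
  set c := (Real.sqrt β)⁻¹ with hc
  have hc0 : 0 < c := inv_pos.2 hs
  have hp : ∀ (z : P.Ext) o, ‖P.toPivot z o‖ ≤ c * ‖P.energy β z‖ := by
    intro z o
    have h1 := PiLp.norm_apply_le (P.energy β z) (.inr o)
    rw [energy_pivot, norm_smul, Complex.norm_real, Real.norm_of_nonneg hs.le] at h1
    rw [hc, ← div_eq_inv_mul, le_div_iff₀ hs, mul_comm]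
    exact h1
  set C : ℝ := (1 + ‖P.k 0‖ + ‖P.k 1‖) * (‖P.sqrtαInv‖ * c) + 1 + 1 + c with hC
  have hC0 : 0 ≤ C := by positivity
  refine ⟨⟨C, hC0⟩, fun z => ?_⟩
  have hE := norm_nonneg (P.energy β z)
  have hu : ‖fn z.1‖ ≤ ‖P.sqrtαInv‖ * c * ‖P.energy β z‖ := by
    have h1 := P.sqrtαInv.le_opNorm (P.sqrtα (fn z.1))
    rw [sqrtαInv_sqrtα, ← toPivot_none] at h1
    refine h1.trans ?_
    rw [mul_assoc]
    exact mul_le_mul_of_nonneg_left (hp z none) (norm_nonneg _)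
  have hg : ∀ j, ‖P.shiftedD j z.1‖ ≤ ‖P.energy β z‖ := fun j =>
    PiLp.norm_apply_le (P.energy β z) (.inl (.inl j))
  change max ‖z.1‖ ‖z.2‖ ≤ C * ‖P.energy β z‖
  refine max_le ?_ ((pi_norm_le_iff_of_nonneg (by positivity)).2 fun ℓ => ?_)
  · have h1 := P.norm_V_le z.1
    have h2 : (1 + ‖P.k 0‖ + ‖P.k 1‖) * ‖fn z.1‖ ≤
        (1 + ‖P.k 0‖ + ‖P.k 1‖) * (‖P.sqrtαInv‖ * c * ‖P.energy β z‖) :=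
      mul_le_mul_of_nonneg_left hu (by positivity)
    have h3 := mul_nonneg hc0.le hE
    rw [hC]
    nlinarith [hg 0, hg 1]
  · have h1 := hp z (some ℓ)
    rw [toPivot_some] at h1
    refine h1.trans (mul_le_mul_of_nonneg_right ?_ hE)
    rw [hC]
    have : 0 ≤ (1 + ‖P.k 0‖ + ‖P.k 1‖) * (‖P.sqrtαInv‖ * c) := by positivity
    linarith

lemma isClosed_range_energy {β : ℝ} (hβ : 0 < β) :
    IsClosed (LinearMap.range (P.energy β).toLinearMap : Set
      (PiLp 2 fun _ : (Fin 2 ⊕ Fin L) ⊕ Option (Fin L) => P.H)) := by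
  obtain ⟨C, hC⟩ := P.exists_norm_le_energy hβ
  have h := ((P.energy β).antilipschitz_of_bound hC).isClosed_range
    (P.energy β).uniformContinuous
  exact h

/-- The projection from the energy space to the pivot space. -/
def energyToPivot (β : ℝ) :
    (PiLp 2 fun _ : (Fin 2 ⊕ Fin L) ⊕ Option (Fin L) => P.H) →L[ℂ] P.Pivot :=
  (PiLp.continuousLinearEquiv 2 ℂ (fun _ : Option (Fin L) => P.H)).symm.toContinuousLinearMap.comp
    (ContinuousLinearMap.pi fun o => (Real.sqrt β : ℂ)⁻¹ •
      PiLp.proj 2 (fun _ : (Fin 2 ⊕ Fin L) ⊕ Option (Fin L) => P.H) (.inr o))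

lemma energyToPivot_energy {β : ℝ} (hβ : 0 < β) (z : P.Ext) :
    P.energyToPivot β (P.energy β z) = P.toPivot z := by
  have hs : (Real.sqrt β : ℂ) ≠ 0 := by exact_mod_cast (Real.sqrt_pos.2 hβ).ne'
  ext1 o
  change (Real.sqrt β : ℂ)⁻¹ • P.energy β z (.inr o) = P.toPivot z o
  rw [energy_pivot, inv_smul_smul₀ hs]

/-- The solution operator of the shifted linearised problem on the pivot space. The shifted form
is the inner product of a closed subspace of a product of copies of `L²(Ω)`, so that the solution is
given by the orthogonal projection onto this subspace. -/
lemma exists_solutionOperator {β : ℝ} (hβ : 0 < β) :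
    ∃ T : P.Pivot →L[ℂ] P.Pivot, T.IsPositive ∧ ∀ k, ∃ z : P.Ext, P.toPivot z = T k ∧
      ∀ w, P.extShifted β z w = inner ℂ (P.toPivot w) k := by
  set R := LinearMap.range (P.energy β).toLinearMap with hR
  have : CompleteSpace R := (P.isClosed_range_energy hβ).completeSpace_coe
  set S := P.energyToPivot β
  refine ⟨S ∘L R.starProjection ∘L ContinuousLinearMap.adjoint S, ?_, fun k => ?_⟩
  · have h1 := (ContinuousLinearMap.isPositive_one (𝕜 := ℂ)).conj_starProjection R
    have h2 : R.starProjection ∘L 1 ∘L R.starProjection = R.starProjection :=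
      R.isIdempotentElem_starProjection
    rw [h2] at h1
    exact h1.conj_adjoint S
  · obtain ⟨z, hz⟩ : R.starProjection (ContinuousLinearMap.adjoint S k) ∈ R :=
      Submodule.starProjection_apply_mem _ _
    have hz' : P.energy β z = R.starProjection (ContinuousLinearMap.adjoint S k) := hz
    refine ⟨z, ?_, fun w => ?_⟩
    · rw [← P.energyToPivot_energy hβ, hz']
      rfl
    · have hw : R.starProjection (P.energy β w) = P.energy β w :=
        Submodule.starProjection_eq_self_iff.2 ⟨w, rfl⟩
      rw [P.extShifted_eq hβ, hz', ← Submodule.inner_starProjection_left_eq_right, hw,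
        ContinuousLinearMap.adjoint_inner_right, P.energyToPivot_energy hβ]

end TMCrystal

namespace TMCrystal

variable {L : ℕ} (P : TMCrystal L)

/-! ### The source problem -/

/-- `z` solves the shifted linearised problem with right-hand side `k` in the pivot space. -/
def SolvesSource (β : ℝ) (k : P.Pivot) (z : P.Ext) : Prop :=
  ∀ w, P.extShifted β z w = inner ℂ (P.toPivot w) k

variable {P} {β : ℝ} {k : P.Pivot} {z : P.Ext}

lemma inner_sqrtα_sqrtα (u v : P.H) : inner ℂ (P.sqrtα v) (P.sqrtα u) =
    P.α₁ * inner ℂ v (u - P.chi u) + P.α₂ * inner ℂ v (P.chi u) := by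
  rw [← formα_eq, formα, form₁_eq, form₂_eq]

lemma SolvesSource.first (h : P.SolvesSource β k z) (v : P.V) :
    ∑ j, inner ℂ (P.shiftedD j v) (P.shiftedD j z.1) + P.Xi * inner ℂ (fn v) (P.chi (fn z.1))
      - ∑ ℓ, (P.b ℓ : ℂ) * inner ℂ (fn v) (z.2 ℓ : P.H)
      + β * inner ℂ (P.sqrtα (fn v)) (P.sqrtα (fn z.1)) = inner ℂ (P.sqrtα (fn v)) (k none) := by
  have h1 := h (v, 0)
  rw [extShifted, extForm_eq, extInner_eq, PiLp.inner_apply, PiLp.inner_apply,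
    Fintype.sum_option, Fintype.sum_option] at h1
  simpa using h1

lemma SolvesSource.second (h : P.SolvesSource β k z) (ℓ : Fin L) :
    ((P.η ℓ ^ 2 + β : ℝ) : ℂ) • (z.2 ℓ : P.H) =
      (P.b ℓ : ℂ) • P.chi (fn z.1) + P.chi (k (some ℓ)) := by
  classical
  have key : ∀ y : P.X, inner ℂ (y : P.H) (((P.η ℓ ^ 2 + β : ℝ) : ℂ) • (z.2 ℓ : P.H) -
      ((P.b ℓ : ℂ) • P.chi (fn z.1) + P.chi (k (some ℓ)))) = 0 := by
    intro y
    have h1 := h (0, Pi.single ℓ y)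
    have hs : ∀ f : Fin L → P.H,
        ∑ m, inner ℂ ((Pi.single ℓ y : Fin L → P.X) m : P.H) (f m) = inner ℂ (y : P.H) (f ℓ) := by
      intro f
      rw [Finset.sum_eq_single ℓ (fun m _ hm => by rw [Pi.single_eq_of_ne hm]; simp) (by simp),
        Pi.single_eq_same]
    have hs' : ∀ (f : Fin L → P.H) (c : Fin L → ℂ),
        ∑ m, c m * inner ℂ ((Pi.single ℓ y : Fin L → P.X) m : P.H) (f m) =
          c ℓ * inner ℂ (y : P.H) (f ℓ) := by
      intro f c
      rw [Finset.sum_eq_single ℓ (fun m _ hm => by rw [Pi.single_eq_of_ne hm]; simp) (by simp),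
        Pi.single_eq_same]
    rw [extShifted, extForm_eq, extInner_eq, PiLp.inner_apply, PiLp.inner_apply,
      Fintype.sum_option, Fintype.sum_option] at h1
    simp only [toPivot_some, toPivot_none, hs, hs', show fn (0 : P.V) = 0 from rfl, map_zero,
      inner_zero_left, mul_zero, Finset.sum_const_zero, zero_sub, zero_add, sub_zero] at h1
    rw [inner_sub_right, inner_add_right, inner_smul_right, inner_smul_right, ← inner_chi_left _
      (k (some ℓ)), chi_coe]
    push_cast at h1 ⊢
    linear_combination h1
  set e : P.H := ((P.η ℓ ^ 2 + β : ℝ) : ℂ) • (z.2 ℓ : P.H) -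
      ((P.b ℓ : ℂ) • P.chi (fn z.1) + P.chi (k (some ℓ))) with he
  have heX : e ∈ P.X := by
    rw [mem_X_iff, he, map_sub, map_add, map_smul, map_smul, chi_chi, chi_chi, chi_coe]
  exact sub_eq_zero.1 (inner_self_eq_zero.1 (key ⟨e, heX⟩))

variable (P) in
/-- The subspace of the pivot space in which the components `x_ℓ` with `η_ℓ = 0` vanish and
those belonging to the same pole are proportional to `b_ℓ`. It is closed and invariant under the
iteration, and the poles are not eigenvalues of the linearised problem there. -/
def coupled : Submodule ℂ P.Pivot where
  carrier := {k | (∀ ℓ, P.chi (k (some ℓ)) = k (some ℓ)) ∧ (∀ ℓ, P.η ℓ = 0 → k (some ℓ) = 0) ∧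
    ∀ ℓ m, P.η ℓ ^ 2 = P.η m ^ 2 → (P.b m : ℂ) • k (some ℓ) = (P.b ℓ : ℂ) • k (some m)}
  zero_mem' := ⟨by simp, by simp, by simp⟩
  add_mem' := by
    rintro k k' ⟨h1, h2, h3⟩ ⟨h1', h2', h3'⟩
    refine ⟨fun ℓ => ?_, fun ℓ hℓ => ?_, fun ℓ m hm => ?_⟩
    · rw [PiLp.add_apply, map_add, h1, h1']
    · rw [PiLp.add_apply, h2 ℓ hℓ, h2' ℓ hℓ, add_zero]
    · rw [PiLp.add_apply, PiLp.add_apply, smul_add, smul_add, h3 ℓ m hm, h3' ℓ m hm]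
  smul_mem' := by
    rintro c k ⟨h1, h2, h3⟩
    refine ⟨fun ℓ => ?_, fun ℓ hℓ => ?_, fun ℓ m hm => ?_⟩
    · rw [PiLp.smul_apply, map_smul, h1]
    · rw [PiLp.smul_apply, h2 ℓ hℓ, smul_zero]
    · rw [PiLp.smul_apply, PiLp.smul_apply, smul_comm, h3 ℓ m hm, smul_comm]

lemma isClosed_coupled : IsClosed (P.coupled : Set P.Pivot) := by
  have hc : ∀ o, Continuous fun k : P.Pivot => k o := fun o =>
    (PiLp.proj (𝕜 := ℂ) 2 (fun _ : Option (Fin L) => P.H) o).continuous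
  have hs : ∀ (c : ℂ) o, Continuous fun k : P.Pivot => c • k o := fun c o =>
    (c • PiLp.proj (𝕜 := ℂ) 2 (fun _ : Option (Fin L) => P.H) o).continuous
  have h : (P.coupled : Set P.Pivot) =
      {k | ∀ ℓ, P.chi (k (some ℓ)) = k (some ℓ)} ∩ ({k | ∀ ℓ, P.η ℓ = 0 → k (some ℓ) = 0} ∩
        {k | ∀ ℓ m, P.η ℓ ^ 2 = P.η m ^ 2 →
          (P.b m : ℂ) • k (some ℓ) = (P.b ℓ : ℂ) • k (some m)}) := rfl
  rw [h]
  refine IsClosed.inter ?_ (IsClosed.inter ?_ ?_)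
  · simp only [Set.ofPred_forall]
    exact isClosed_iInter fun ℓ => isClosed_eq (P.chi.continuous.comp (hc _)) (hc _)
  · simp only [Set.ofPred_forall]
    exact isClosed_iInter fun ℓ => isClosed_iInter fun _ => isClosed_eq (hc _) continuous_const
  · simp only [Set.ofPred_forall]
    exact isClosed_iInter fun ℓ => isClosed_iInter fun m => isClosed_iInter fun _ =>
      isClosed_eq (hs _ _) (hs _ _)

lemma SolvesSource.toPivot_mem_coupled (hβ : 0 < β) (h : P.SolvesSource β k z)
    (hk : k ∈ P.coupled) : P.toPivot z ∈ P.coupled := by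
  obtain ⟨h1, h2, h3⟩ := hk
  have hne : ∀ ℓ, ((P.η ℓ ^ 2 + β : ℝ) : ℂ) ≠ 0 := fun ℓ => by
    exact_mod_cast (add_pos_of_nonneg_of_pos (sq_nonneg (P.η ℓ)) hβ).ne'
  refine ⟨fun ℓ => ?_, fun ℓ hℓ => ?_, fun ℓ m hm => ?_⟩
  · rw [toPivot_some, chi_coe]
  · have h4 := h.second ℓ
    have hb : P.b ℓ = 0 := by rw [b, hℓ, mul_zero]
    rw [h1, h2 ℓ hℓ, hb, Complex.ofReal_zero, zero_smul, add_zero] at h4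
    exact (smul_eq_zero.1 h4).resolve_left (hne ℓ)
  · rw [toPivot_some, toPivot_some]
    refine smul_right_injective P.H (hne ℓ) ?_
    have h4 := h.second ℓ
    have h5 := h.second m
    rw [h1] at h4 h5
    simp only
    rw [smul_comm, h4]
    conv_rhs => rw [hm, smul_comm, h5]
    rw [smul_add, smul_add, h3 ℓ m hm, smul_comm]

/-- Components that belong to one pole, are proportional to `b`, and add up to zero with the
weights `b` vanish. -/
lemma eq_zero_of_coupled_of_sum {x : Fin L → P.H} {lam : ℝ}
    (hx : ∀ ℓ m, P.η ℓ ^ 2 = P.η m ^ 2 → (P.b m : ℂ) • x ℓ = (P.b ℓ : ℂ) • x m)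
    (hb : ∀ ℓ, P.η ℓ ^ 2 = lam → P.b ℓ ≠ 0) (h0 : ∀ ℓ, P.η ℓ ^ 2 ≠ lam → x ℓ = 0)
    (hsum : ∑ ℓ, (P.b ℓ : ℂ) • x ℓ = 0) (m : Fin L) : x m = 0 := by
  classical
  by_cases hm : P.η m ^ 2 = lam
  · have h1 : ((∑ ℓ, if P.η ℓ ^ 2 = lam then P.b ℓ ^ 2 else 0 : ℝ) : ℂ) • x m = 0 := by
      have h2 := congrArg (fun y => (P.b m : ℂ) • y) hsum
      simp only [smul_zero, Finset.smul_sum] at h2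
      rw [← h2]
      push_cast
      rw [Finset.sum_smul]
      refine Finset.sum_congr rfl fun ℓ _ => ?_
      split_ifs with hℓ
      · rw [smul_comm, hx ℓ m (hℓ.trans hm.symm), smul_smul]
        push_cast
        rw [sq]
      · rw [h0 ℓ hℓ]
        simp
    refine (smul_eq_zero.1 h1).resolve_left ?_
    have h3 : 0 < ∑ ℓ, if P.η ℓ ^ 2 = lam then P.b ℓ ^ 2 else 0 := by
      refine lt_of_lt_of_le (pow_pos (abs_pos.2 (hb m hm)) 2) ?_
      rw [sq_abs]
      refine (Finset.single_le_sum (f := fun ℓ => if P.η ℓ ^ 2 = lam then P.b ℓ ^ 2 else 0)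
        (fun ℓ _ => by split_ifs <;> positivity) (Finset.mem_univ m)).trans' ?_
      simp [hm]
    exact_mod_cast h3.ne'
  · exact h0 m hm

/-- The eigenvalue of an eigenvector of the linearised problem in `coupled` is not a pole, because
at a pole the function part would vanish on `Ω₂` and hence, by unique continuation, everywhere.
For `lam = 0` the vanishing on `Ω₂` follows from the positivity of the linearised form. So the
components `x_ℓ` can be eliminated, and the function part solves the nonlinear
problem. -/
theorem isNonlinearEigenpair_of_solvesSource (hΩ₂ : 0 < volume P.Ω₂) (hξ : ∀ ℓ, P.ξ ℓ ≠ 0)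
    {lam : ℝ} (hz : P.toPivot z ∈ P.coupled) (hz0 : z ≠ 0)
    (h : P.SolvesSource β (((lam + β : ℝ) : ℂ) • P.toPivot z) z) :
    P.IsNonlinearEigenpair z.1 lam := by
  obtain ⟨hz1, hz2, hz3⟩ := hz
  simp only [toPivot_some] at hz1 hz2 hz3
  set u := z.1 with hu
  have first : ∀ v : P.V, ∑ j, inner ℂ (P.shiftedD j v) (P.shiftedD j u)
      + P.Xi * inner ℂ (fn v) (P.chi (fn u)) - ∑ ℓ, (P.b ℓ : ℂ) * inner ℂ (fn v) (z.2 ℓ : P.H) =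
      lam * inner ℂ (P.sqrtα (fn v)) (P.sqrtα (fn u)) := by
    intro v
    have h1 := h.first v
    rw [PiLp.smul_apply, toPivot_none, inner_smul_right] at h1
    push_cast at h1
    linear_combination h1
  have second : ∀ ℓ, ((P.η ℓ ^ 2 - lam : ℝ) : ℂ) • (z.2 ℓ : P.H) =
      (P.b ℓ : ℂ) • P.chi (fn u) := by
    intro ℓ
    have h1 := h.second ℓ
    rw [PiLp.smul_apply, toPivot_some, map_smul, chi_coe] at h1
    rw [← sub_eq_iff_eq_add, ← sub_smul] at h1
    rw [← h1]
    push_cast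
    congr 1
    ring
  have hzero : fn u = 0 → (∀ ℓ, (z.2 ℓ : P.H) = 0) → False := fun h1 h2 =>
    hz0 (Prod.ext (P.fn_injective h1) (funext fun ℓ => Subtype.ext (h2 ℓ)))
  have hpole : ∀ m, P.η m ^ 2 ≠ lam := by
    intro m hm
    by_cases hη : P.η m = 0
    · have hlam : lam = 0 := by rw [← hm, hη]; ring
      have hx : ∀ ℓ, (P.b ℓ : ℂ) * inner ℂ (fn u) (z.2 ℓ : P.H) =
          ((if P.η ℓ = 0 then 0 else P.ξ ℓ ^ 2 : ℝ) : ℂ) * inner ℂ (fn u) (P.chi (fn u)) := by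
        intro ℓ
        split_ifs with hℓ
        · rw [hz2 ℓ hℓ]
          simp
        · have h1 := congrArg (fun y => inner ℂ (fn u) y) (second ℓ)
          simp only [inner_smul_right, hlam, sub_zero, b] at h1
          have h2 : (P.η ℓ : ℂ) ≠ 0 := by exact_mod_cast hℓ
          rw [b]
          push_cast at h1 ⊢
          refine mul_left_cancel₀ h2 ?_
          linear_combination (P.ξ ℓ : ℂ) * h1
      have h1 := first u
      simp_rw [hx, hlam, ← Finset.sum_mul] at h1
      have h2 : (∑ j, ‖P.shiftedD j u‖ ^ 2) + (∑ ℓ, if P.η ℓ = 0 then P.ξ ℓ ^ 2 else 0) *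
          ‖P.chi (fn u)‖ ^ 2 = 0 := by
        have h3 : inner ℂ (fn u) (P.chi (fn u)) = ((‖P.chi (fn u)‖ ^ 2 : ℝ) : ℂ) := by
          have h4 : inner ℂ (fn u) (P.chi (fn u)) = inner ℂ (P.chi (fn u)) (P.chi (fn u)) := by
            rw [inner_chi_left, chi_chi]
          rw [h4, inner_self_eq_norm_sq_to_K]
          norm_cast
        have h4 : (P.Xi : ℝ) - (∑ ℓ, if P.η ℓ = 0 then 0 else P.ξ ℓ ^ 2) =
            ∑ ℓ, if P.η ℓ = 0 then P.ξ ℓ ^ 2 else 0 := by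
          rw [Xi, ← Finset.sum_sub_distrib]
          refine Finset.sum_congr rfl fun ℓ _ => ?_
          split_ifs <;> ring
        rw [← h4]
        simp_rw [h3, inner_self_eq_norm_sq_to_K] at h1
        have h5 : (((∑ j, ‖P.shiftedD j u‖ ^ 2) + (P.Xi - ∑ ℓ, if P.η ℓ = 0 then 0 else
            P.ξ ℓ ^ 2) * ‖P.chi (fn u)‖ ^ 2 : ℝ) : ℂ) = 0 := by
          push_cast
          push_cast at h1
          linear_combination h1
        exact_mod_cast h5
      have hpos : 0 < ∑ ℓ, if P.η ℓ = 0 then P.ξ ℓ ^ 2 else 0 := by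
        refine lt_of_lt_of_le (pow_pos (abs_pos.2 (hξ m)) 2) ?_
        rw [sq_abs]
        refine (Finset.single_le_sum (f := fun ℓ => if P.η ℓ = 0 then P.ξ ℓ ^ 2 else 0)
          (fun ℓ _ => by split_ifs <;> positivity) (Finset.mem_univ m)).trans' ?_
        simp [hη]
      have hD0 : 0 ≤ ∑ j, ‖P.shiftedD j u‖ ^ 2 := Finset.sum_nonneg fun _ _ => sq_nonneg _
      have hX0 : 0 ≤ ‖P.chi (fn u)‖ ^ 2 := sq_nonneg _
      have hX : ‖P.chi (fn u)‖ ^ 2 = 0 := by nlinarith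
      have hχ : P.chi (fn u) = 0 := norm_eq_zero.1 (pow_eq_zero_iff two_ne_zero |>.1 hX)
      have hD : ∑ j, ‖P.shiftedD j u‖ ^ 2 = 0 := by rw [hX] at h2; linarith
      have hDj : ∀ j, P.shiftedD j u = 0 := fun j => by
        have := (Finset.sum_eq_zero_iff_of_nonneg fun _ _ => sq_nonneg _).1 hD j
          (Finset.mem_univ j)
        exact norm_eq_zero.1 (pow_eq_zero_iff two_ne_zero |>.1 this)
      have huc := P.unique_continuation hΩ₂ (f := 0) (c := 0) hχ (map_zero _)
        (fun v => by simp [hDj])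
      refine hzero (by rw [huc.1]; rfl) fun ℓ => ?_
      by_cases hℓ : P.η ℓ = 0
      · exact hz2 ℓ hℓ
      · have h3 := second ℓ
        rw [hχ, smul_zero, hlam, sub_zero] at h3
        exact (smul_eq_zero.1 h3).resolve_left (by exact_mod_cast pow_ne_zero 2 hℓ)
    · have hb : P.b m ≠ 0 := mul_ne_zero (hξ m) hη
      have hχ : P.chi (fn u) = 0 := by
        have h1 := second m
        rw [hm, sub_self, Complex.ofReal_zero, zero_smul] at h1
        exact (smul_eq_zero.1 h1.symm).resolve_left (by exact_mod_cast hb)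
      have huc := P.unique_continuation hΩ₂ (f := ∑ ℓ, (P.b ℓ : ℂ) • (z.2 ℓ : P.H))
        (c := lam * P.α₁) hχ
        (by rw [map_sum]; exact Finset.sum_congr rfl fun ℓ _ => by rw [map_smul, chi_coe])
        (fun v => by
          have h1 := first v
          rw [inner_sqrtα_sqrtα, hχ] at h1
          rw [inner_sum]
          simp_rw [inner_smul_right]
          simp only [inner_zero_right, mul_zero, add_zero, sub_zero] at h1
          push_cast
          linear_combination h1)
      refine hzero (by rw [huc.1]; rfl) fun ℓ => ?_
      refine eq_zero_of_coupled_of_sum (x := fun ℓ => (z.2 ℓ : P.H)) (lam := lam) hz3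
        (fun ℓ hℓ => mul_ne_zero (hξ ℓ) fun h0 => hη ?_) (fun ℓ hℓ => ?_) huc.2 ℓ
      · rw [h0, ← hm] at hℓ
        exact pow_eq_zero_iff two_ne_zero |>.1 (hℓ.symm.trans (zero_pow two_ne_zero))
      · have h3 := second ℓ
        rw [hχ, smul_zero] at h3
        exact (smul_eq_zero.1 h3).resolve_left (by exact_mod_cast sub_ne_zero.2 hℓ)
  have hd : ∀ ℓ, P.η ℓ ^ 2 - lam ≠ 0 := fun ℓ => sub_ne_zero.2 (hpole ℓ)
  have hx : ∀ ℓ, (z.2 ℓ : P.H) = ((P.b ℓ / (P.η ℓ ^ 2 - lam) : ℝ) : ℂ) • P.chi (fn u) := by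
    intro ℓ
    have h1 : ((P.η ℓ ^ 2 - lam : ℝ) : ℂ) ≠ 0 := by exact_mod_cast hd ℓ
    refine smul_right_injective P.H h1 ?_
    simp only
    rw [second, smul_smul, ← Complex.ofReal_mul, mul_div_cancel₀ _ (hd ℓ)]
  have hAd : P.A - lam • (1 : Matrix (Fin L) (Fin L) ℝ) =
      Matrix.diagonal fun ℓ => P.η ℓ ^ 2 - lam := by
    ext i j
    by_cases hij : i = j
    · subst hij; simp [A]
    · simp [A, hij]
  have hunit : IsUnit (P.A - lam • (1 : Matrix (Fin L) (Fin L) ℝ)) := by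
    rw [hAd, Matrix.isUnit_iff_isUnit_det, Matrix.det_diagonal, isUnit_iff_ne_zero]
    exact Finset.prod_ne_zero_iff.2 fun ℓ _ => hd ℓ
  have hinv : (P.A - lam • (1 : Matrix (Fin L) (Fin L) ℝ))⁻¹.mulVec P.b =
      fun ℓ => P.b ℓ / (P.η ℓ ^ 2 - lam) := by
    have h1 : (P.A - lam • (1 : Matrix (Fin L) (Fin L) ℝ)).mulVec
        (fun ℓ => P.b ℓ / (P.η ℓ ^ 2 - lam)) = P.b := by
      rw [hAd]
      funext ℓ
      rw [Matrix.mulVec_diagonal, mul_div_cancel₀ _ (hd ℓ)]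
    conv_lhs => rw [← h1]
    rw [Matrix.mulVec_mulVec, Matrix.nonsing_inv_mul _
      ((Matrix.isUnit_iff_isUnit_det _).1 hunit), Matrix.one_mulVec]
  refine ⟨fun h0 => hzero h0 fun ℓ => by rw [hx, h0, map_zero, smul_zero], hunit, fun v => ?_⟩
  rw [hinv, formLaplace_eq, form₂_eq, formα_eq, ← first v]
  simp_rw [hx, inner_smul_right, dotProduct]
  push_cast
  rw [Finset.sum_mul]
  have h1 : ∀ ℓ, (P.b ℓ : ℂ) * ((P.b ℓ : ℂ) / ((P.η ℓ : ℂ) ^ 2 - lam) *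
      inner ℂ (fn v) (P.chi (fn u))) = (P.b ℓ : ℂ) * ((P.b ℓ : ℂ) / ((P.η ℓ : ℂ) ^ 2 - lam)) *
      inner ℂ (fn v) (P.chi (fn u)) := fun ℓ => by ring
  simp_rw [h1]
  ring

end TMCrystal

namespace TMCrystal

variable {L : ℕ} {P : TMCrystal L} {β : ℝ}

/-! ### The spectrum next to a pole -/

/-- A form of Rellich's theorem: a space of functions whose shifted gradient is controlled by the
function itself is finite-dimensional. -/
lemma finiteDimensional_of_shiftedD_le (M : Submodule ℂ P.H) (C : ℝ)
    (h : ∀ f ∈ M, ∃ u : P.V, fn u = f ∧ ∀ j, ‖P.shiftedD j u‖ ≤ C * ‖f‖) :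
    FiniteDimensional ℂ M := by
  by_contra hM
  obtain ⟨R, f, hR, hf, hsep⟩ := exists_seq_norm_le_one_le_norm_sub (𝕜 := ℂ) (E := M) hM
  choose u hu hD using fun n => h (f n) (f n).2
  have hC : ∀ n, C * ‖(f n : P.H)‖ ≤ |C| * R := fun n =>
    mul_le_mul (le_abs_self C) (hf n) (norm_nonneg _) (abs_nonneg C)
  have hbound : ∀ n, ‖u n‖ ≤ (1 + ‖P.k 0‖ + ‖P.k 1‖) * R + |C| * R + |C| * R := by
    intro n
    refine (P.norm_V_le (u n)).trans ?_
    rw [hu]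
    exact add_le_add (add_le_add (mul_le_mul_of_nonneg_left (hf n) (by positivity))
      ((hD n 0).trans (hC n))) ((hD n 1).trans (hC n))
  obtain ⟨v, s, hs, hlim⟩ := P.exists_subseq_tendsto_of_bounded hbound
  have hcau := hlim.cauchySeq
  obtain ⟨N, hN⟩ := Metric.cauchySeq_iff.1 hcau 1 one_pos
  have h1 := hN N le_rfl (N + 1) (Nat.le_succ N)
  have h2 := hsep (hs (Nat.lt_succ_self N)).ne
  rw [dist_eq_norm, hu, hu] at h1
  exact absurd h2 (not_le.2 h1)

/-- The quadratic form of `(1 - (lam + β) T) (1 - (lam + δ + β) T)` for the solution operator `T`,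
where the components `p` of `(1 - (lam + δ + β) T) w` replace the components of `w`. In these
variables the function part and the auxiliary components decouple. -/
lemma SolvesSource.re_inner_eq {w : P.Pivot} {z : P.Ext} (h : P.SolvesSource β w z)
    (hw : w ∈ P.coupled) {lam δ : ℝ} (hd : ∀ ℓ, P.η ℓ ^ 2 - (lam + δ) ≠ 0) :
    (inner ℂ (w - ((lam + β : ℝ) : ℂ) • P.toPivot z)
      (w - ((lam + δ + β : ℝ) : ℂ) • P.toPivot z)).re =
    ‖w none - ((lam + δ + β : ℝ) : ℂ) • P.sqrtα (fn z.1)‖ ^ 2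
      + δ * (∑ j, ‖P.shiftedD j z.1‖ ^ 2 + P.Xi * ‖P.chi (fn z.1)‖ ^ 2
        - (lam + δ) * ‖P.sqrtα (fn z.1)‖ ^ 2
        - (∑ ℓ, P.b ℓ ^ 2 / (P.η ℓ ^ 2 - (lam + δ))) * ‖P.chi (fn z.1)‖ ^ 2)
      + ∑ ℓ, (1 + δ / (P.η ℓ ^ 2 - (lam + δ))) *
        ‖w (some ℓ) - ((lam + δ + β : ℝ) : ℂ) • (z.2 ℓ : P.H)‖ ^ 2 := by
  set p := w - ((lam + δ + β : ℝ) : ℂ) • P.toPivot z with hp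
  have hp0 : p none = w none - ((lam + δ + β : ℝ) : ℂ) • P.sqrtα (fn z.1) := rfl
  have hpℓ : ∀ ℓ, p (some ℓ) = w (some ℓ) - ((lam + δ + β : ℝ) : ℂ) • (z.2 ℓ : P.H) :=
    fun ℓ => rfl
  rw [← hp0]
  simp_rw [← hpℓ]
  have hsplit : w - ((lam + β : ℝ) : ℂ) • P.toPivot z = p + (δ : ℂ) • P.toPivot z := by
    rw [hp]
    push_cast
    module
  have hsq : ∀ f : P.H, inner ℂ f f = ((‖f‖ ^ 2 : ℝ) : ℂ) := fun f => by
    rw [inner_self_eq_norm_sq_to_K]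
    norm_cast
  -- `p_ℓ = (η_ℓ² - lam - δ) x_ℓ - b_ℓ u` on `Ω₂`
  have hx : ∀ ℓ, (z.2 ℓ : P.H) = (((P.η ℓ ^ 2 - (lam + δ))⁻¹ : ℝ) : ℂ) •
      (p (some ℓ) + (P.b ℓ : ℂ) • P.chi (fn z.1)) := by
    intro ℓ
    have h1 := h.second ℓ
    rw [hw.1] at h1
    have h2 : p (some ℓ) + (P.b ℓ : ℂ) • P.chi (fn z.1) =
        ((P.η ℓ ^ 2 - (lam + δ) : ℝ) : ℂ) • (z.2 ℓ : P.H) := by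
      rw [hpℓ, sub_add_eq_add_sub, add_comm (w (some ℓ)), ← h1]
      push_cast
      module
    rw [h2, smul_smul, ← Complex.ofReal_mul, inv_mul_cancel₀ (hd ℓ), Complex.ofReal_one, one_smul]
  have hχ : inner ℂ (fn z.1) (P.chi (fn z.1)) = ((‖P.chi (fn z.1)‖ ^ 2 : ℝ) : ℂ) := by
    rw [← hsq, inner_chi_left, chi_chi]
  have hpχ : ∀ ℓ, P.chi (p (some ℓ)) = p (some ℓ) := fun ℓ => by
    rw [hpℓ, map_sub, map_smul, hw.1, chi_coe]
  have hcross : ∀ ℓ, (P.b ℓ : ℂ) * inner ℂ (fn z.1) (z.2 ℓ : P.H) =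
      ((P.b ℓ * (P.η ℓ ^ 2 - (lam + δ))⁻¹ : ℝ) : ℂ) * inner ℂ (fn z.1) (p (some ℓ)) +
        ((P.b ℓ ^ 2 / (P.η ℓ ^ 2 - (lam + δ)) * ‖P.chi (fn z.1)‖ ^ 2 : ℝ) : ℂ) := by
    intro ℓ
    rw [hx, inner_smul_right, inner_add_right, inner_smul_right, hχ]
    push_cast
    ring
  have haux : ∀ ℓ, inner ℂ (z.2 ℓ : P.H) (p (some ℓ)) =
      ((P.b ℓ * (P.η ℓ ^ 2 - (lam + δ))⁻¹ : ℝ) : ℂ) * inner ℂ (fn z.1) (p (some ℓ)) +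
        (((P.η ℓ ^ 2 - (lam + δ))⁻¹ * ‖p (some ℓ)‖ ^ 2 : ℝ) : ℂ) := by
    intro ℓ
    rw [hx, inner_smul_left, inner_add_left, inner_smul_left, inner_chi_left, hpχ, hsq,
      Complex.conj_ofReal, Complex.conj_ofReal]
    push_cast
    ring
  have hfun : inner ℂ (P.sqrtα (fn z.1)) (p none) =
      ((∑ j, ‖P.shiftedD j z.1‖ ^ 2 + P.Xi * ‖P.chi (fn z.1)‖ ^ 2
        - (lam + δ) * ‖P.sqrtα (fn z.1)‖ ^ 2 : ℝ) : ℂ)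
        - ∑ ℓ, (P.b ℓ : ℂ) * inner ℂ (fn z.1) (z.2 ℓ : P.H) := by
    have h1 := h.first z.1
    simp_rw [hsq, hχ] at h1
    rw [hp0, inner_sub_right, inner_smul_right, hsq, ← h1]
    push_cast
    ring
  have htot : inner ℂ (P.toPivot z) p =
      ((∑ j, ‖P.shiftedD j z.1‖ ^ 2 + P.Xi * ‖P.chi (fn z.1)‖ ^ 2
        - (lam + δ) * ‖P.sqrtα (fn z.1)‖ ^ 2
        - (∑ ℓ, P.b ℓ ^ 2 / (P.η ℓ ^ 2 - (lam + δ))) * ‖P.chi (fn z.1)‖ ^ 2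
        + ∑ ℓ, (P.η ℓ ^ 2 - (lam + δ))⁻¹ * ‖p (some ℓ)‖ ^ 2 : ℝ) : ℂ) := by
    rw [PiLp.inner_apply, Fintype.sum_option]
    simp only [toPivot_none, toPivot_some]
    rw [hfun]
    -- The terms with `⟪u, p_ℓ⟫` cancel.
    simp_rw [hcross, haux]
    rw [Finset.sum_add_distrib, Finset.sum_add_distrib, Finset.sum_mul]
    push_cast
    ring
  rw [hsplit, inner_add_left, inner_smul_left, htot, Complex.conj_ofReal,
    inner_self_eq_norm_sq_to_K]
  have hnorm : ‖p‖ ^ 2 = ‖p none‖ ^ 2 + ∑ ℓ, ‖p (some ℓ)‖ ^ 2 := by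
    rw [PiLp.norm_sq_eq_of_L2, Fintype.sum_option]
  have hre : ((RCLike.ofReal ‖p‖ : ℂ) ^ 2) = ((‖p‖ ^ 2 : ℝ) : ℂ) := by norm_cast
  rw [hre, ← Complex.ofReal_mul, ← Complex.ofReal_add, Complex.ofReal_re, hnorm]
  simp_rw [add_mul, one_mul]
  rw [Finset.sum_add_distrib, mul_add, Finset.mul_sum _ _ δ]
  have h3 : ∀ ℓ, δ / (P.η ℓ ^ 2 - (lam + δ)) * ‖p (some ℓ)‖ ^ 2 =
      δ * ((P.η ℓ ^ 2 - (lam + δ))⁻¹ * ‖p (some ℓ)‖ ^ 2) := fun ℓ => by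
    rw [div_eq_mul_inv, mul_assoc]
  simp_rw [h3]
  ring

/-- The coefficient of an auxiliary component in the form of `re_inner_eq` is non-negative on both
sides of the interval. -/
lemma one_add_div_nonneg {t lam δ : ℝ} (hδ : 0 < δ) (h : t ≤ lam ∨ lam + δ < t) :
    0 ≤ 1 + δ / (t - (lam + δ)) := by
  rcases h with h | h
  · have h1 : t - (lam + δ) < 0 := by linarith
    have h2 : -1 ≤ δ / (t - (lam + δ)) := by
      rw [le_div_iff_of_neg h1]
      linarith
    linarith
  · have := div_pos hδ (sub_pos.2 h)
    linarith

lemma one_add_div_ne_zero {t lam δ : ℝ} (h : t - (lam + δ) ≠ 0) (ht : t ≠ lam) :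
    1 + δ / (t - (lam + δ)) ≠ 0 := by
  rw [one_add_div h]
  refine div_ne_zero (fun h1 => ht ?_) h
  linarith

/-- A vector of `coupled` on which the form of `re_inner_eq` is non-positive is determined by its
function part, although the coefficients of the components belonging to the pole `lam` vanish in the
form: they are recovered from the equation for the function part. -/
lemma SolvesSource.eq_zero_of_fn_eq_zero (hΩ₂ : 0 < volume P.Ω₂) (hβ : 0 < β) {w : P.Pivot}
    {z : P.Ext} (h : P.SolvesSource β w z) (hw : w ∈ P.coupled) {lam δ : ℝ} (hδ : 0 < δ)
    (hb : ∀ ℓ, P.η ℓ ^ 2 = lam → P.b ℓ ≠ 0)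
    (hd : ∀ ℓ, P.η ℓ ^ 2 ≤ lam ∨ lam + δ < P.η ℓ ^ 2)
    (hle : (inner ℂ (w - ((lam + β : ℝ) : ℂ) • P.toPivot z)
      (w - ((lam + δ + β : ℝ) : ℂ) • P.toPivot z)).re ≤ 0) (hu : fn z.1 = 0) : w = 0 := by
  have hd0 : ∀ ℓ, P.η ℓ ^ 2 - (lam + δ) ≠ 0 := fun ℓ => by
    rcases hd ℓ with h1 | h1 <;> intro h2 <;> linarith
  rw [h.re_inner_eq hw hd0, hu] at hle
  have hu1 : z.1 = 0 := P.fn_injective hu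
  rw [hu1] at hle
  simp only [map_zero, norm_zero, smul_zero, sub_zero, ne_eq, OfNat.ofNat_ne_zero,
    not_false_eq_true, zero_pow, Finset.sum_const_zero, mul_zero, add_zero] at hle
  have hterm : ∀ ℓ, 0 ≤ (1 + δ / (P.η ℓ ^ 2 - (lam + δ))) *
      ‖w (some ℓ) - ((lam + δ + β : ℝ) : ℂ) • (z.2 ℓ : P.H)‖ ^ 2 := fun ℓ =>
    mul_nonneg (one_add_div_nonneg hδ (hd ℓ)) (sq_nonneg _)
  have hsum := Finset.sum_nonneg fun ℓ (_ : ℓ ∈ Finset.univ) => hterm ℓ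
  have hw0 : w none = 0 := by
    have h1 : ‖w none‖ ^ 2 = 0 := le_antisymm (by linarith) (sq_nonneg _)
    exact norm_eq_zero.1 (pow_eq_zero_iff two_ne_zero |>.1 h1)
  have hsum0 : ∑ ℓ, (1 + δ / (P.η ℓ ^ 2 - (lam + δ))) *
      ‖w (some ℓ) - ((lam + δ + β : ℝ) : ℂ) • (z.2 ℓ : P.H)‖ ^ 2 = 0 :=
    le_antisymm (by linarith [sq_nonneg ‖w none‖]) hsum
  have hsecond : ∀ ℓ, ((P.η ℓ ^ 2 + β : ℝ) : ℂ) • (z.2 ℓ : P.H) = w (some ℓ) := fun ℓ => by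
    rw [h.second ℓ, hu, map_zero, smul_zero, zero_add, hw.1]
  have hx0 : ∀ ℓ, P.η ℓ ^ 2 ≠ lam → (z.2 ℓ : P.H) = 0 := by
    intro ℓ hℓ
    have h1 := (Finset.sum_eq_zero_iff_of_nonneg fun ℓ _ => hterm ℓ).1 hsum0 ℓ (Finset.mem_univ ℓ)
    have h2 := (mul_eq_zero.1 h1).resolve_left (one_add_div_ne_zero (hd0 ℓ) hℓ)
    have h3 := norm_eq_zero.1 (pow_eq_zero_iff two_ne_zero |>.1 h2)
    rw [← hsecond, ← sub_smul, ← Complex.ofReal_sub] at h3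
    refine (smul_eq_zero.1 h3).resolve_left ?_
    rw [show P.η ℓ ^ 2 + β - (lam + δ + β) = P.η ℓ ^ 2 - (lam + δ) by ring]
    exact_mod_cast hd0 ℓ
  have hχ : P.chi (∑ ℓ, (P.b ℓ : ℂ) • (z.2 ℓ : P.H)) = ∑ ℓ, (P.b ℓ : ℂ) • (z.2 ℓ : P.H) := by
    rw [map_sum]
    exact Finset.sum_congr rfl fun ℓ _ => by rw [map_smul, chi_coe]
  have huc := P.unique_continuation hΩ₂ (u := 0) (c := 0) (map_zero P.chi) hχ fun v => by
    have h1 := h.first v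
    rw [hu, hu1, hw0] at h1
    simp only [map_zero, inner_zero_right, Finset.sum_const_zero, mul_zero, add_zero,
      zero_sub, neg_eq_zero] at h1
    rw [inner_sum]
    simp_rw [inner_smul_right]
    rw [h1]
    simp
  have hx : ∀ ℓ, (z.2 ℓ : P.H) = 0 :=
    eq_zero_of_coupled_of_sum (h.toPivot_mem_coupled hβ hw).2.2 hb hx0 huc.2
  ext1 o
  cases o with
  | none => exact hw0
  | some ℓ => rw [← hsecond, hx, smul_zero]; rfl

/-- On `coupled` the spectrum of the linearised problem between a pole `lam` and `lam + δ` is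
finite-dimensional, stated in terms of the subspaces on which the form that characterises this
part of the spectrum is non-positive. -/
lemma finiteDimensional_of_re_inner_nonpos (hΩ₂ : 0 < volume P.Ω₂) (hβ : 0 < β)
    {T : P.Pivot →L[ℂ] P.Pivot}
    (hT : ∀ k, ∃ z : P.Ext, P.toPivot z = T k ∧ P.SolvesSource β k z)
    {lam δ : ℝ} (hδ : 0 < δ) (hb : ∀ ℓ, P.η ℓ ^ 2 = lam → P.b ℓ ≠ 0)
    (hd : ∀ ℓ, P.η ℓ ^ 2 ≤ lam ∨ lam + δ < P.η ℓ ^ 2) (N : Submodule ℂ P.Pivot)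
    (hN : N ≤ P.coupled) (hle : ∀ w ∈ N, (inner ℂ (w - ((lam + β : ℝ) : ℂ) • T w)
      (w - ((lam + δ + β : ℝ) : ℂ) • T w)).re ≤ 0) : FiniteDimensional ℂ N := by
  have hd0 : ∀ ℓ, P.η ℓ ^ 2 - (lam + δ) ≠ 0 := fun ℓ => by
    rcases hd ℓ with h1 | h1 <;> intro h2 <;> linarith
  set F : N →ₗ[ℂ] P.H := (P.sqrtαInv.comp
    ((PiLp.proj (𝕜 := ℂ) 2 (fun _ : Option (Fin L) => P.H) none).comp T)).toLinearMap ∘ₗ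
      N.subtype with hF
  have hFapply : ∀ (w : N) (z : P.Ext), P.toPivot z = T w → F w = fn z.1 := by
    intro w z hz
    change P.sqrtαInv (T w none) = _
    rw [← hz, toPivot_none, sqrtαInv_sqrtα]
  have hinj : Function.Injective F := by
    refine (injective_iff_map_eq_zero F).2 fun w hw => ?_
    obtain ⟨z, hz, hz'⟩ := hT w
    have h1 := hle w w.2
    rw [← hz] at h1
    exact Subtype.ext (hz'.eq_zero_of_fn_eq_zero hΩ₂ hβ (hN w.2) hδ hb hd h1
      ((hFapply w z hz).symm.trans hw))
  -- The form bounds the shifted gradient of `u` by `√c ‖u‖`.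
  set c : ℝ := |lam + δ| * ‖P.sqrtα‖ ^ 2
    + (∑ ℓ, |P.b ℓ ^ 2 / (P.η ℓ ^ 2 - (lam + δ))|) * ‖P.chi‖ ^ 2 with hc
  have hc0 : 0 ≤ c := by positivity
  have : FiniteDimensional ℂ (LinearMap.range F) := by
    refine finiteDimensional_of_shiftedD_le _ (Real.sqrt c) ?_
    rintro _ ⟨w, rfl⟩
    obtain ⟨z, hz, hz'⟩ := hT w
    refine ⟨z.1, (hFapply w z hz).symm, fun j => ?_⟩
    rw [hFapply w z hz]
    have h1 := hle w w.2
    rw [← hz, hz'.re_inner_eq (hN w.2) hd0] at h1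
    have hsum := Finset.sum_nonneg fun ℓ (_ : ℓ ∈ Finset.univ) =>
      mul_nonneg (one_add_div_nonneg hδ (hd ℓ))
        (sq_nonneg ‖(w : P.Pivot) (some ℓ) - ((lam + δ + β : ℝ) : ℂ) • (z.2 ℓ : P.H)‖)
    have h2 : ∑ j, ‖P.shiftedD j z.1‖ ^ 2 + P.Xi * ‖P.chi (fn z.1)‖ ^ 2
        - (lam + δ) * ‖P.sqrtα (fn z.1)‖ ^ 2
        - (∑ ℓ, P.b ℓ ^ 2 / (P.η ℓ ^ 2 - (lam + δ))) * ‖P.chi (fn z.1)‖ ^ 2 ≤ 0 := by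
      refine nonpos_of_mul_nonpos_right ?_ hδ
      linarith [sq_nonneg ‖(w : P.Pivot) none - ((lam + δ + β : ℝ) : ℂ) • P.sqrtα (fn z.1)‖]
    have hXi : 0 ≤ P.Xi := Finset.sum_nonneg fun _ _ => sq_nonneg _
    have h3 : (lam + δ) * ‖P.sqrtα (fn z.1)‖ ^ 2 ≤
        |lam + δ| * (‖P.sqrtα‖ * ‖fn z.1‖) ^ 2 :=
      mul_le_mul (le_abs_self _) (pow_le_pow_left₀ (norm_nonneg _) (P.sqrtα.le_opNorm _) 2)
        (sq_nonneg _) (abs_nonneg _)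
    have h4 : (∑ ℓ, P.b ℓ ^ 2 / (P.η ℓ ^ 2 - (lam + δ))) * ‖P.chi (fn z.1)‖ ^ 2 ≤
        (∑ ℓ, |P.b ℓ ^ 2 / (P.η ℓ ^ 2 - (lam + δ))|) * (‖P.chi‖ * ‖fn z.1‖) ^ 2 :=
      mul_le_mul (Finset.sum_le_sum fun _ _ => le_abs_self _)
        (pow_le_pow_left₀ (norm_nonneg _) (P.chi.le_opNorm _) 2) (sq_nonneg _)
        (Finset.sum_nonneg fun _ _ => abs_nonneg _)
    have h5 : ‖P.shiftedD j z.1‖ ^ 2 ≤ ∑ j, ‖P.shiftedD j z.1‖ ^ 2 :=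
      Finset.single_le_sum (f := fun j => ‖P.shiftedD j z.1‖ ^ 2) (fun _ _ => sq_nonneg _)
        (Finset.mem_univ j)
    refine le_of_sq_le_sq ?_ (by positivity)
    rw [mul_pow, Real.sq_sqrt hc0, hc]
    have h6 := mul_nonneg hXi (sq_nonneg ‖P.chi (fn z.1)‖)
    rw [mul_pow] at h3 h4
    linarith
  exact LinearEquiv.finiteDimensional (LinearEquiv.ofInjective F hinj).symm

end TMCrystal

namespace TMCrystal

variable {L : ℕ} {P : TMCrystal L} {β : ℝ}

/-! ### Compactness of normalised iterates -/

/-- Away from the poles approximate eigenvectors have convergent subsequences: the function parts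
converge by Rellich's theorem, and the auxiliary components are determined by them. -/
lemma exists_subseq_tendsto_of_forall_ne (hβ : 0 < β) {T : P.Pivot →L[ℂ] P.Pivot}
    (hT : ∀ k, ∃ z : P.Ext, P.toPivot z = T k ∧ P.SolvesSource β k z) {σ : ℝ} (hσ : 0 < σ)
    (hpole : ∀ ℓ, P.η ℓ ≠ 0 → P.η ℓ ^ 2 + β ≠ σ⁻¹) {y : ℕ → P.Pivot} {C : ℝ}
    (hy : ∀ n, ‖y n‖ ≤ C) (hyc : ∀ n, y n ∈ P.coupled)
    (hlim : Tendsto (fun n => T (y n) - (σ : ℂ) • y n) atTop (𝓝 0)) :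
    ∃ (y' : P.Pivot) (s : ℕ → ℕ), StrictMono s ∧ Tendsto (fun n => y (s n)) atTop (𝓝 y') := by
  choose z hz hz' using fun n => hT (y n)
  have hC0 : 0 ≤ C := (norm_nonneg _).trans (hy 0)
  obtain ⟨c, hc⟩ := P.exists_norm_le_energy hβ
  have hen : ∀ n, ‖P.energy β (z n)‖ ≤ Real.sqrt (‖T‖ * C * C) := by
    intro n
    refine Real.le_sqrt_of_sq_le ?_
    have h1 := hz' n (z n)
    rw [P.extShifted_eq hβ, inner_self_eq_norm_sq_to_K, hz] at h1
    have h2 : ‖P.energy β (z n)‖ ^ 2 = ‖inner ℂ (T (y n)) (y n)‖ := by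
      rw [← h1]
      simp
    rw [h2]
    refine (norm_inner_le_norm _ _).trans ?_
    exact mul_le_mul ((T.le_opNorm _).trans (mul_le_mul_of_nonneg_left (hy n) (norm_nonneg _)))
      (hy n) (norm_nonneg _) (by positivity)
  have hzb : ∀ n, ‖(z n).1‖ ≤ c * Real.sqrt (‖T‖ * C * C) := fun n =>
    (norm_fst_le (z n)).trans ((hc _).trans (mul_le_mul_of_nonneg_left (hen n) c.2))
  obtain ⟨v, s, hs, hv⟩ := P.exists_subseq_tendsto_of_bounded hzb
  have hlim' := hlim.comp hs.tendsto_atTop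
  set e : ℕ → P.Pivot := fun n => T (y (s n)) - (σ : ℂ) • y (s n) with he
  have he0 : Tendsto e atTop (𝓝 0) := hlim'
  have hproj : ∀ o, Tendsto (fun n => e n o) atTop (𝓝 0) := fun o =>
    ((PiLp.proj (𝕜 := ℂ) 2 (fun _ : Option (Fin L) => P.H) o).continuous.tendsto 0).comp he0
  have hσc : (σ : ℂ) ≠ 0 := by exact_mod_cast hσ.ne'
  have hyeq : ∀ n, y (s n) = (σ : ℂ)⁻¹ • (T (y (s n)) - e n) := fun n => by
    rw [he]
    simp only
    rw [sub_sub_cancel, inv_smul_smul₀ hσc]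
  have hcomp : ∀ o, ∃ a : P.H, Tendsto (fun n => T (y (s n)) o) atTop (𝓝 a) := by
    intro o
    simp_rw [← hz]
    cases o with
    | none =>
      simp only [toPivot_none]
      exact ⟨_, (P.sqrtα.continuous.tendsto _).comp hv⟩
    | some ℓ =>
      simp only [toPivot_some]
      by_cases hη : P.η ℓ = 0
      · refine ⟨0, tendsto_const_nhds.congr fun n => ?_⟩
        exact (((hz' (s n)).toPivot_mem_coupled hβ (hyc _)).2.1 ℓ hη).symm
      · have hd : ((P.η ℓ ^ 2 + β - σ⁻¹ : ℝ) : ℂ) ≠ 0 := by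
          exact_mod_cast sub_ne_zero.2 (hpole ℓ hη)
        refine ⟨((P.η ℓ ^ 2 + β - σ⁻¹ : ℝ) : ℂ)⁻¹ • ((P.b ℓ : ℂ) • P.chi v
          - (σ : ℂ)⁻¹ • 0), Tendsto.congr (fun n => ?_) (((((P.chi.continuous.tendsto _).comp
            hv).const_smul (P.b ℓ : ℂ)).sub ((hproj (some ℓ)).const_smul (σ : ℂ)⁻¹)).const_smul
              ((P.η ℓ ^ 2 + β - σ⁻¹ : ℝ) : ℂ)⁻¹)⟩
        have h1 := (hz' (s n)).second ℓ
        have h2 : y (s n) (some ℓ) = (σ : ℂ)⁻¹ • (((z (s n)).2 ℓ : P.H) - e n (some ℓ)) := by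
          have h3 := congrArg (fun k : P.Pivot => k (some ℓ)) (hyeq n)
          rw [← hz] at h3
          exact h3
        rw [(hyc (s n)).1, h2] at h1
        rw [inv_smul_eq_iff₀ hd, Function.comp_apply]
        have h4 : (P.b ℓ : ℂ) • P.chi (fn (z (s n)).1) =
            ((P.η ℓ ^ 2 + β : ℝ) : ℂ) • ((z (s n)).2 ℓ : P.H) -
              (σ : ℂ)⁻¹ • (((z (s n)).2 ℓ : P.H) - e n (some ℓ)) := by
          rw [h1, add_sub_cancel_right]
        rw [h4]
        push_cast
        module
  choose a ha using hcomp
  have hTy : Tendsto (fun n => T (y (s n))) atTop (𝓝 (WithLp.toLp 2 a)) :=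
    ((PiLp.continuous_toLp 2 (fun _ : Option (Fin L) => P.H)).tendsto a).comp (tendsto_pi_nhds.2 ha)
  exact ⟨_, s, hs, Tendsto.congr (fun n => (hyeq n).symm) ((hTy.sub he0).const_smul (σ : ℂ)⁻¹)⟩

/-- At a non-zero pole approximate eigenvectors of growth rate at most `σ` have convergent
subsequences: on the closure of the vectors of this growth rate the solution operator is bounded by
`σ`, so that only the spectrum next to the pole on one side matters, which is
finite-dimensional. -/
lemma exists_subseq_tendsto_of_pole (hΩ₂ : 0 < volume P.Ω₂) (hβ : 0 < β)
    {T : P.Pivot →L[ℂ] P.Pivot} (hTpos : T.IsPositive)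
    (hT : ∀ k, ∃ z : P.Ext, P.toPivot z = T k ∧ P.SolvesSource β k z) {σ : ℝ} (hσ : 0 < σ)
    (hb : ∀ ℓ, P.η ℓ ^ 2 = σ⁻¹ - β → P.b ℓ ≠ 0) {y : ℕ → P.Pivot} {C : ℝ}
    (hy : ∀ n, ‖y n‖ ≤ C) (hyc : ∀ n, y n ∈ P.coupled)
    (hyg : ∀ n, y n ∈ PowerIteration.growthSubmodule T σ)
    (hlim : Tendsto (fun n => T (y n) - (σ : ℂ) • y n) atTop (𝓝 0)) :
    ∃ (y' : P.Pivot) (s : ℕ → ℕ), StrictMono s ∧ Tendsto (fun n => y (s n)) atTop (𝓝 y') := by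
  set K := (PowerIteration.growthSubmodule T σ ⊓ P.coupled).topologicalClosure with hK
  have hle : PowerIteration.growthSubmodule T σ ⊓ P.coupled ≤ K :=
    Submodule.le_topologicalClosure _
  have hKc : K ≤ P.coupled :=
    Submodule.topologicalClosure_minimal _ inf_le_right isClosed_coupled
  have hKT : ∀ w : K, T w ∈ K := fun w => by
    refine map_mem_closure T.continuous w.2 fun k hk =>
      ⟨PowerIteration.apply_mem_growthSubmodule hk.1, ?_⟩
    obtain ⟨z, hz, hz'⟩ := hT k
    rw [← hz]
    exact hz'.toPivot_mem_coupled hβ hk.2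
  have hKn : ∀ w : K, ‖T w‖ ≤ σ * ‖(w : P.Pivot)‖ := fun w => by
    have hcl : IsClosed {k : P.Pivot | ‖T k‖ ≤ σ * ‖k‖} :=
      isClosed_le T.continuous.norm (continuous_const.mul continuous_norm)
    exact closure_minimal (fun k hk =>
      PowerIteration.norm_apply_le_of_mem_growthSubmodule hTpos hσ hk.1) hcl w.2
  have : CompleteSpace K := (Submodule.isClosed_topologicalClosure _).completeSpace_coe
  set T' : K →L[ℂ] K := (T.comp K.subtypeL).codRestrict K hKT with hT'
  have hT'pos : T'.IsPositive :=
    ⟨fun v w => hTpos.isSymmetric v w, fun v => hTpos.re_inner_nonneg_left v⟩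
  obtain ⟨δ, hδ, hd⟩ : ∃ δ : ℝ, 0 < δ ∧
      ∀ ℓ, P.η ℓ ^ 2 ≤ σ⁻¹ - β ∨ σ⁻¹ - β + δ < P.η ℓ ^ 2 := by
    have h1 : ∀ᶠ δ : ℝ in 𝓝[>] 0, ∀ ℓ, P.η ℓ ^ 2 ≤ σ⁻¹ - β ∨ σ⁻¹ - β + δ < P.η ℓ ^ 2 := by
      refine eventually_all.2 fun ℓ => ?_
      rcases le_or_gt (P.η ℓ ^ 2) (σ⁻¹ - β) with h2 | h2
      · exact Eventually.of_forall fun _ => Or.inl h2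
      · filter_upwards [nhdsWithin_le_nhds (eventually_lt_nhds (sub_pos.2 h2))] with δ h3
        exact Or.inr (by linarith)
    obtain ⟨δ, h2, h3⟩ := (h1.and self_mem_nhdsWithin).exists
    exact ⟨δ, h3, h2⟩
  have hpos : 0 < σ⁻¹ + δ := by positivity
  have hfin : ∀ N : Submodule ℂ K, (∀ w ∈ N, (inner ℂ (w - ((σ⁻¹ : ℝ) : ℂ) • T' w)
      (w - (((σ⁻¹ + δ)⁻¹⁻¹ : ℝ) : ℂ) • T' w)).re ≤ 0) → FiniteDimensional ℂ N := by
    intro N hN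
    have h1 : FiniteDimensional ℂ (N.map K.subtype) := by
      refine finiteDimensional_of_re_inner_nonpos hΩ₂ hβ hT (lam := σ⁻¹ - β) hδ hb hd _ ?_ ?_
      · rintro _ ⟨w, _, rfl⟩
        exact hKc w.2
      · rintro _ ⟨w, hw, rfl⟩
        have h2 := hN w hw
        rw [inv_inv] at h2
        rw [show σ⁻¹ - β + β = σ⁻¹ by ring, show σ⁻¹ - β + δ + β = σ⁻¹ + δ by ring]
        exact h2
    exact LinearEquiv.finiteDimensional
      (Submodule.equivMapOfInjective K.subtype K.injective_subtype N).symm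
  obtain ⟨y', s, hs, h⟩ := PowerIteration.exists_subseq_tendsto_of_finiteDimensional hT'pos
    (inv_pos.2 hpos) (inv_lt_of_inv_lt₀ hσ (lt_add_of_pos_right _ hδ)) hKn hfin
    (y := fun n => ⟨y n, hle ⟨hyg n, hyc n⟩⟩) hy
    (tendsto_subtype_rng.2 hlim)
  exact ⟨y', s, hs, (continuous_subtype_val.tendsto _).comp h⟩

end TMCrystal

namespace TMCrystal

variable {L : ℕ} {P : TMCrystal L} {β : ℝ}

/-! ### The inverse power iteration -/

lemma extShifted_unique (hβ : 0 < β) {z z' : P.Ext}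
    (h : ∀ w, P.extShifted β z w = P.extShifted β z' w) : z = z' := by
  obtain ⟨c, hc⟩ := P.exists_norm_le_energy hβ
  have h1 : inner ℂ (P.energy β (z - z')) (P.energy β (z - z')) = 0 := by
    rw [map_sub (P.energy β) z z', inner_sub_right, ← map_sub (P.energy β) z z',
      ← P.extShifted_eq hβ, ← P.extShifted_eq hβ, h, sub_self]
  have h2 := hc (z - z')
  rw [inner_self_eq_zero.1 h1, norm_zero, mul_zero] at h2
  exact sub_eq_zero.1 (norm_le_zero_iff.1 h2)

lemma toPivot_normalized (z : P.Ext) :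
    P.toPivot (P.normalized z) = ((‖P.toPivot z‖⁻¹ : ℝ) : ℂ) • P.toPivot z := by
  rw [normalized, map_smul, extNorm_eq]

/-- The iteration step consists in the application of the solution operator. -/
lemma isInversePowerIteration_iff {z₀ : P.Ext} {z : ℕ → P.Ext} :
    P.IsInversePowerIteration β z₀ z ↔ z 0 = z₀ ∧ ∀ j, P.SolvesSource β
      ((P.rayleigh β (z j) : ℂ) • P.toPivot (P.normalized (z j))) (z (j + 1)) := by
  simp only [IsInversePowerIteration, SolvesSource, extInner_eq, inner_smul_right]

lemma existsUnique_isInversePowerIteration (hβ : 0 < β) (z₀ : P.Ext) :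
    ∃! z : ℕ → P.Ext, P.IsInversePowerIteration β z₀ z := by
  obtain ⟨T, -, hT⟩ := P.exists_solutionOperator hβ
  choose S hS hS' using hT
  set step : P.Ext → P.Ext := fun z =>
    S ((P.rayleigh β z : ℂ) • P.toPivot (P.normalized z)) with hstep
  have hsol : ∀ z : P.Ext, P.SolvesSource β
      ((P.rayleigh β z : ℂ) • P.toPivot (P.normalized z)) (step z) := fun z => hS' _
  clear_value step
  refine ⟨fun n => step^[n] z₀, isInversePowerIteration_iff.2 ⟨rfl, fun j => ?_⟩,
    fun z hz => funext fun n => ?_⟩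
  · simp only [Function.iterate_succ_apply']
    exact hsol _
  · obtain ⟨h0, h1⟩ := isInversePowerIteration_iff.1 hz
    induction n with
    | zero => exact h0
    | succ n ih =>
      simp only [Function.iterate_succ_apply']
      refine extShifted_unique hβ fun w => ?_
      rw [h1 n w, ih]
      exact (hsol _ w).symm

lemma rayleigh_pos (hβ : 0 < β) {z : P.Ext} (hz : P.toPivot z ≠ 0) : 0 < P.rayleigh β z := by
  have h1 : (P.extInner z z).re = ‖P.toPivot z‖ ^ 2 := by
    rw [extInner_eq]
    exact inner_self_eq_norm_sq (𝕜 := ℂ) (P.toPivot z)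
  have h2 : (P.extShifted β z z).re = ‖P.energy β z‖ ^ 2 := by
    rw [P.extShifted_eq hβ]
    exact inner_self_eq_norm_sq (𝕜 := ℂ) (P.energy β z)
  rw [rayleigh, h1, h2]
  have h3 : P.energy β z ≠ 0 := fun h => hz (by rw [← P.energyToPivot_energy hβ, h, map_zero])
  exact div_pos (pow_pos (norm_pos_iff.2 h3) 2) (pow_pos (norm_pos_iff.2 hz) 2)

/-- The solution operator has no kernel on the range of the embedding. -/
lemma solutionOperator_ne_zero {T : P.Pivot →L[ℂ] P.Pivot}
    (hT : ∀ k, ∃ z : P.Ext, P.toPivot z = T k ∧ P.SolvesSource β k z) {z : P.Ext}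
    (hz : P.toPivot z ≠ 0) : T (P.toPivot z) ≠ 0 := by
  intro h
  obtain ⟨z', hz', h'⟩ := hT (P.toPivot z)
  rw [h, toPivot_injective_iff] at hz'
  have h1 := h' z
  rw [hz', extShifted, extForm_eq, extInner_eq] at h1
  have h2 : inner ℂ (P.toPivot z) (P.toPivot z) = 0 := by
    rw [← h1]
    simp [show fn (0 : P.V) = 0 from rfl]
  exact hz (inner_self_eq_zero.1 h2)

variable {T : P.Pivot →L[ℂ] P.Pivot}

lemma pow_solutionOperator (hT : ∀ k, ∃ z : P.Ext, P.toPivot z = T k ∧ P.SolvesSource β k z)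
    (z₀ : P.Ext) (n : ℕ) : ∃ z : P.Ext, P.toPivot z = (T ^ n) (P.toPivot z₀) := by
  cases n with
  | zero => exact ⟨z₀, rfl⟩
  | succ n =>
    obtain ⟨z, hz, -⟩ := hT ((T ^ n) (P.toPivot z₀))
    exact ⟨z, by rw [hz, PowerIteration.pow_succ_apply']⟩

lemma pow_solutionOperator_ne_zero
    (hT : ∀ k, ∃ z : P.Ext, P.toPivot z = T k ∧ P.SolvesSource β k z)
    {z₀ : P.Ext} (hz₀ : z₀ ≠ 0) (n : ℕ) : (T ^ n) (P.toPivot z₀) ≠ 0 := by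
  induction n with
  | zero => exact fun h => hz₀ ((P.toPivot_injective_iff z₀).1 h)
  | succ n ih =>
    obtain ⟨z, hz⟩ := pow_solutionOperator hT z₀ n
    rw [PowerIteration.pow_succ_apply']
    rw [← hz] at ih ⊢
    exact solutionOperator_ne_zero hT ih

lemma pow_solutionOperator_mem_coupled (hβ : 0 < β)
    (hT : ∀ k, ∃ z : P.Ext, P.toPivot z = T k ∧ P.SolvesSource β k z)
    {k : P.Pivot} (hk : k ∈ P.coupled) (n : ℕ) : (T ^ n) k ∈ P.coupled := by
  induction n with
  | zero => exact hk
  | succ n ih =>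
    obtain ⟨z, hz, hz'⟩ := hT ((T ^ n) k)
    rw [PowerIteration.pow_succ_apply', ← hz]
    exact hz'.toPivot_mem_coupled hβ ih

lemma SolvesSource.toPivot_eq (hβ : 0 < β)
    (hT : ∀ k, ∃ z : P.Ext, P.toPivot z = T k ∧ P.SolvesSource β k z)
    {k : P.Pivot} {z : P.Ext} (h : P.SolvesSource β k z) : P.toPivot z = T k := by
  obtain ⟨z', hz', h'⟩ := hT k
  rw [← hz', extShifted_unique hβ fun w => (h w).trans (h' w).symm]

lemma norm_inv_smul_smul {E : Type*} [NormedAddCommGroup E] [NormedSpace ℂ E] {c : ℝ} (hc : 0 < c)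
    (y : E) : ((‖(c : ℂ) • y‖⁻¹ : ℝ) : ℂ) • (c : ℂ) • y = ((‖y‖⁻¹ : ℝ) : ℂ) • y := by
  rw [smul_smul, ← Complex.ofReal_mul, norm_smul, Complex.norm_real, Real.norm_of_nonneg hc.le,
    mul_inv_rev, mul_assoc, inv_mul_cancel₀ hc.ne', mul_one]

/-- Up to positive factors the iterates are the images of the starting value under the powers of the
solution operator. -/
lemma toPivot_iterate (hβ : 0 < β)
    (hT : ∀ k, ∃ z : P.Ext, P.toPivot z = T k ∧ P.SolvesSource β k z)
    {z₀ : P.Ext} (hz₀ : z₀ ≠ 0) {z : ℕ → P.Ext} (hz : P.IsInversePowerIteration β z₀ z) (n : ℕ) :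
    ∃ c : ℝ, 0 < c ∧ P.toPivot (z n) = (c : ℂ) • (T ^ n) (P.toPivot z₀) := by
  obtain ⟨h0, h1⟩ := isInversePowerIteration_iff.1 hz
  induction n with
  | zero => exact ⟨1, one_pos, by rw [h0]; simp⟩
  | succ n ih =>
    obtain ⟨c, hc, h2⟩ := ih
    have hne := pow_solutionOperator_ne_zero hT hz₀ n
    have hc' : (c : ℂ) ≠ 0 := by exact_mod_cast hc.ne'
    have hzn : P.toPivot (z n) ≠ 0 := by
      rw [h2]
      exact smul_ne_zero hc' hne
    refine ⟨P.rayleigh β (z n) * ‖(T ^ n) (P.toPivot z₀)‖⁻¹,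
      mul_pos (rayleigh_pos hβ hzn) (inv_pos.2 (norm_pos_iff.2 hne)), ?_⟩
    rw [(h1 n).toPivot_eq hβ hT, toPivot_normalized, h2, norm_inv_smul_smul hc, map_smul, map_smul,
      PowerIteration.pow_succ_apply', smul_smul, Complex.ofReal_mul]

lemma toPivot_normalized_iterate (hβ : 0 < β)
    (hT : ∀ k, ∃ z : P.Ext, P.toPivot z = T k ∧ P.SolvesSource β k z)
    {z₀ : P.Ext} (hz₀ : z₀ ≠ 0) {z : ℕ → P.Ext} (hz : P.IsInversePowerIteration β z₀ z) (n : ℕ) :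
    P.toPivot (P.normalized (z n)) =
      ((‖(T ^ n) (P.toPivot z₀)‖⁻¹ : ℝ) : ℂ) • (T ^ n) (P.toPivot z₀) := by
  obtain ⟨c, hc, h⟩ := toPivot_iterate hβ hT hz₀ hz n
  rw [toPivot_normalized, h, norm_inv_smul_smul hc]

/-- The Rayleigh quotient in terms of the preceding normalised iterate. -/
lemma rayleigh_succ {k : P.Pivot} {z : P.Ext} {μ : ℝ} (hμ : μ ≠ 0)
    (h : P.SolvesSource β ((μ : ℂ) • k) z) (hz : P.toPivot z = (μ : ℂ) • T k) :
    P.rayleigh β z = (inner ℂ (T k) k).re / ‖T k‖ ^ 2 := by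
  have h1 : (P.extInner z z).re = μ ^ 2 * ‖T k‖ ^ 2 := by
    rw [extInner_eq, hz, ← mul_pow, ← sq_abs (μ * _), abs_mul, abs_norm]
    have := inner_self_eq_norm_sq (𝕜 := ℂ) ((μ : ℂ) • T k)
    rw [norm_smul, Complex.norm_real] at this
    exact this
  have h2 : (P.extShifted β z z).re = μ ^ 2 * (inner ℂ (T k) k).re := by
    rw [h z, hz, inner_smul_left, inner_smul_right, Complex.conj_ofReal, ← mul_assoc,
      ← Complex.ofReal_mul, Complex.re_ofReal_mul, sq]
  rw [rayleigh, h1, h2, mul_div_mul_left _ _ (pow_ne_zero 2 hμ)]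

end TMCrystal

namespace TMCrystal

variable {L : ℕ} {P : TMCrystal L} {β : ℝ}

/-! ### Convergence of the iteration -/

/-- The Rayleigh quotients converge to the reciprocal of the growth rate of the iterates. -/
lemma tendsto_rayleigh (hβ : 0 < β) {T : P.Pivot →L[ℂ] P.Pivot}
    (hT : ∀ k, ∃ z : P.Ext, P.toPivot z = T k ∧ P.SolvesSource β k z)
    {z : ℕ → P.Ext} {y : ℕ → P.Pivot} {σ : ℝ} (hσ : 0 < σ) (hy : ∀ n, ‖y n‖ = 1)
    (hlim : Tendsto (fun n => T (y n) - (σ : ℂ) • y n) atTop (𝓝 0))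
    (hpos : ∀ n, P.rayleigh β (z n) ≠ 0)
    (hz : ∀ n, P.SolvesSource β ((P.rayleigh β (z n) : ℂ) • y n) (z (n + 1))) :
    Tendsto (fun n => P.rayleigh β (z n)) atTop (𝓝 σ⁻¹) := by
  rw [← tendsto_add_atTop_iff_nat 1]
  have hr : ∀ n, P.rayleigh β (z (n + 1)) = (inner ℂ (T (y n)) (y n)).re / ‖T (y n)‖ ^ 2 :=
    fun n => rayleigh_succ (hpos n) (hz n) (by rw [(hz n).toPivot_eq hβ hT, map_smul])
  simp_rw [hr]
  have hlim0 := tendsto_zero_iff_norm_tendsto_zero.1 hlim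
  have h1 : Tendsto (fun n => (inner ℂ (T (y n)) (y n)).re) atTop (𝓝 σ) := by
    refine tendsto_iff_norm_sub_tendsto_zero.2 (squeeze_zero (fun _ => norm_nonneg _)
      (fun n => ?_) hlim0)
    have h2 : (inner ℂ (T (y n)) (y n)).re - σ =
        (inner ℂ (T (y n) - (σ : ℂ) • y n) (y n)).re := by
      rw [inner_sub_left, inner_smul_left, inner_self_eq_norm_sq_to_K, hy, Complex.sub_re]
      simp
    rw [h2]
    refine (Complex.abs_re_le_norm _).trans ((norm_inner_le_norm _ _).trans ?_)
    rw [hy, mul_one]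
  have h2 : Tendsto (fun n => ‖T (y n)‖) atTop (𝓝 σ) := by
    refine tendsto_iff_norm_sub_tendsto_zero.2 (squeeze_zero (fun _ => norm_nonneg _)
      (fun n => ?_) hlim0)
    have h3 : ‖(σ : ℂ) • y n‖ = σ := by
      rw [norm_smul, hy, mul_one, Complex.norm_real, Real.norm_of_nonneg hσ.le]
    have h4 := abs_norm_sub_norm_le (T (y n)) ((σ : ℂ) • y n)
    rwa [h3] at h4
  have h3 := h1.div (h2.pow 2) (pow_ne_zero 2 hσ.ne')
  rwa [show σ / σ ^ 2 = σ⁻¹ by field_simp] at h3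

/-- The normalised powers of the solution operator have a subsequence that converges to an
eigenvector in `coupled`. -/
lemma exists_subseq_tendsto_eigenvector (hΩ₂ : 0 < volume P.Ω₂) (hξ : ∀ ℓ, P.ξ ℓ ≠ 0) (hβ : 0 < β)
    {T : P.Pivot →L[ℂ] P.Pivot} (hTpos : T.IsPositive)
    (hT : ∀ k, ∃ z : P.Ext, P.toPivot z = T k ∧ P.SolvesSource β k z)
    {y : ℕ → P.Pivot} {σ : ℝ} (hσ : 0 < σ) (hy : ∀ n, ‖y n‖ = 1) (hyc : ∀ n, y n ∈ P.coupled)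
    (hyg : ∀ n, y n ∈ PowerIteration.growthSubmodule T σ)
    (hlim : Tendsto (fun n => T (y n) - (σ : ℂ) • y n) atTop (𝓝 0)) :
    ∃ (y' : P.Pivot) (s : ℕ → ℕ), StrictMono s ∧ Tendsto (fun n => y (s n)) atTop (𝓝 y') ∧
      y' ≠ 0 ∧ y' ∈ P.coupled ∧ T y' = (σ : ℂ) • y' := by
  obtain ⟨y', s, hs, h⟩ : ∃ (y' : P.Pivot) (s : ℕ → ℕ), StrictMono s ∧
      Tendsto (fun n => y (s n)) atTop (𝓝 y') := by
    by_cases hpole : ∀ ℓ, P.η ℓ ≠ 0 → P.η ℓ ^ 2 + β ≠ σ⁻¹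
    · exact exists_subseq_tendsto_of_forall_ne hβ hT hσ hpole (fun n => (hy n).le) hyc hlim
    · push Not at hpole
      obtain ⟨m, hm, hm'⟩ := hpole
      refine exists_subseq_tendsto_of_pole hΩ₂ hβ hTpos hT hσ
        (fun ℓ hℓ => mul_ne_zero (hξ ℓ) fun h0 => hm ?_) (fun n => (hy n).le) hyc hyg hlim
      rw [h0] at hℓ
      exact pow_eq_zero_iff two_ne_zero |>.1 (by linarith)
  refine ⟨y', s, hs, h, fun h0 => ?_, isClosed_coupled.mem_of_tendsto h
    (Eventually.of_forall fun n => hyc _), ?_⟩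
  · have h1 := h.norm
    simp_rw [hy] at h1
    have h2 := tendsto_nhds_unique h1 tendsto_const_nhds
    rw [h0, norm_zero] at h2
    exact zero_ne_one h2
  · refine sub_eq_zero.1 (tendsto_nhds_unique ?_ (hlim.comp hs.tendsto_atTop))
    exact ((T.continuous.tendsto y').comp h).sub (h.const_smul _)

end TMCrystal

end

theorem mainTheorem2 {L : ℕ} (P : TMCrystal L)
    (hΩ₂ : 0 < volume P.Ω₂) (hξ : ∀ ℓ, P.ξ ℓ ≠ 0)
    (β : ℝ) (hβ : 0 < β)
    (u₀ : P.V) (x₀ : Fin L → P.X) (hz₀ : u₀ ≠ 0 ∨ x₀ ≠ 0)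
    (hx₀ : ∀ ℓ, P.η ℓ = 0 → x₀ ℓ = 0)
    (hx₀' : ∀ ℓ m, P.η ℓ ^ 2 = P.η m ^ 2 → (P.b m : ℂ) • x₀ ℓ = (P.b ℓ : ℂ) • x₀ m) :
    (∃! z : ℕ → P.Ext, P.IsInversePowerIteration β (u₀, x₀) z) ∧
      ∀ z : ℕ → P.Ext, P.IsInversePowerIteration β (u₀, x₀) z →
        ∃ (s : ℕ → ℕ) (u : P.V), StrictMono s ∧
          Tendsto (fun n => TMCrystal.fn (z (s n)).1) atTop (𝓝 (TMCrystal.fn u)) ∧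
          ∃ lam : ℝ, P.IsNonlinearEigenpair u lam := by
  refine ⟨TMCrystal.existsUnique_isInversePowerIteration hβ _, fun z hz => ?_⟩
  obtain ⟨T, hTpos, hT⟩ := P.exists_solutionOperator hβ
  replace hT : ∀ k, ∃ z : P.Ext, P.toPivot z = T k ∧ P.SolvesSource β k z := hT
  have hne : ((u₀, x₀) : P.Ext) ≠ 0 := fun h =>
    hz₀.elim (fun h1 => h1 (congrArg Prod.fst h)) fun h1 => h1 (congrArg Prod.snd h)
  have hcoupled : P.toPivot (u₀, x₀) ∈ P.coupled := by
    refine ⟨fun ℓ => ?_, fun ℓ hℓ => ?_, fun ℓ m h => ?_⟩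
    · rw [TMCrystal.toPivot_some, TMCrystal.chi_coe]
    · rw [TMCrystal.toPivot_some]
      exact congrArg Subtype.val (hx₀ ℓ hℓ)
    · rw [TMCrystal.toPivot_some, TMCrystal.toPivot_some]
      exact congrArg Subtype.val (hx₀' ℓ m h)
  set y₀ := P.toPivot (u₀, x₀) with hy₀
  have hpow : ∀ n, (T ^ n) y₀ ≠ 0 := TMCrystal.pow_solutionOperator_ne_zero hT hne
  obtain ⟨σ, hσ, hgrow, hlim⟩ := PowerIteration.exists_growth_rate hTpos hpow
  set y : ℕ → P.Pivot := fun n => ((‖(T ^ n) y₀‖⁻¹ : ℝ) : ℂ) • (T ^ n) y₀ with hy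
  have hnorm : ∀ n, ‖y n‖ = 1 := fun n => by
    rw [hy]
    simp only
    rw [norm_smul, Complex.norm_real, norm_inv, norm_norm,
      inv_mul_cancel₀ (norm_ne_zero_iff.2 (hpow n))]
  have hyc : ∀ n, y n ∈ P.coupled := fun n =>
    P.coupled.smul_mem _ (TMCrystal.pow_solutionOperator_mem_coupled hβ hT hcoupled n)
  have hyg : ∀ n, y n ∈ PowerIteration.growthSubmodule T σ := fun n => by
    refine Submodule.smul_mem _ _ ?_
    induction n with
    | zero => exact ⟨‖y₀‖, fun n => (hgrow n).trans (mul_comm _ _).le⟩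
    | succ n ih =>
      rw [PowerIteration.pow_succ_apply']
      exact PowerIteration.apply_mem_growthSubmodule ih
  obtain ⟨y', s, hs, hys, hy0, hy'c, hTy'⟩ :=
    TMCrystal.exists_subseq_tendsto_eigenvector hΩ₂ hξ hβ hTpos hT hσ hnorm hyc hyg hlim
  have hσc : (σ : ℂ) ≠ 0 := by exact_mod_cast hσ.ne'
  -- The limit `y'` lies in the range of `T` and thus comes from some `z'` in `V × X^L`.
  obtain ⟨z', hz', hsol'⟩ := hT ((σ : ℂ)⁻¹ • y')
  rw [map_smul, hTy', inv_smul_smul₀ hσc] at hz'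
  have hstep : ∀ n, P.SolvesSource β ((P.rayleigh β (z n) : ℂ) • y n) (z (n + 1)) := fun n => by
    have h1 := (TMCrystal.isInversePowerIteration_iff.1 hz).2 n
    rwa [TMCrystal.toPivot_normalized_iterate hβ hT hne hz] at h1
  have hray : ∀ n, P.rayleigh β (z n) ≠ 0 := fun n => by
    obtain ⟨c, hc, h1⟩ := TMCrystal.toPivot_iterate hβ hT hne hz n
    refine (TMCrystal.rayleigh_pos hβ ?_).ne'
    rw [h1]
    exact smul_ne_zero (by exact_mod_cast hc.ne') (hpow n)
  have hμ := TMCrystal.tendsto_rayleigh hβ hT hσ hnorm hlim hray hstep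
  have hzlim : Tendsto (fun n => P.toPivot (z (s n + 1))) atTop (𝓝 y') := by
    have h1 : Tendsto (fun n => (P.rayleigh β (z (s n)) : ℂ) • T (y (s n))) atTop
        (𝓝 (((σ⁻¹ : ℝ) : ℂ) • T y')) :=
      ((Complex.continuous_ofReal.tendsto _).comp (hμ.comp hs.tendsto_atTop)).smul
        ((T.continuous.tendsto y').comp hys)
    rw [hTy', Complex.ofReal_inv, inv_smul_smul₀ hσc] at h1
    refine h1.congr fun n => ?_
    rw [(hstep (s n)).toPivot_eq hβ hT]
    exact (map_smul T _ (y (s n))).symm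
  have hfn : ∀ z : P.Ext, TMCrystal.fn z.1 = P.sqrtαInv (P.toPivot z none) := fun z => by
    rw [TMCrystal.toPivot_none, TMCrystal.sqrtαInv_sqrtα]
  refine ⟨fun n => s n + 1, z'.1, fun m n h => Nat.succ_lt_succ (hs h), ?_, σ⁻¹ - β, ?_⟩
  · simp_rw [hfn, hz']
    exact (P.sqrtαInv.continuous.tendsto _).comp
      (((PiLp.proj (𝕜 := ℂ) 2 (fun _ : Option (Fin L) => P.H) none).continuous.tendsto y').comp
        hzlim)
  · refine TMCrystal.isNonlinearEigenpair_of_solvesSource (β := β) hΩ₂ hξ (hz' ▸ hy'c)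
      (fun h => hy0 ?_) ?_
    · rw [← hz', h, map_zero]
    · rw [sub_add_cancel, hz', Complex.ofReal_inv]
      exact hsol'
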